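/- **Setting.** For a smooth regular curve $\gamma:[0,1]\to\mathbb{R}^2$ let $\mathcal{L}[\gamma]=\int_\gamma ds$ be its length, $\kappa$ its signed curvature, $s$ its arc length parameter, $\tilde\gamma:[0,\mathcal L[\gamma]]\to\mathbb{R}^2$ its arc length reparameterization, and for $\varepsilon>0$ let $$\mathcal{E}_\varepsilon[\gamma]=\varepsilon^2\int_\gamma\kappa^2\,ds+\int_\gamma ds .$$ For $l>0$ and $\theta_0,\theta_1\in[-\pi,\pi]$ let $\mathcal{A}_{\theta_0,\theta_1,l}$ be the set of all $\gamma\in C^\infty([0,1];\mathbb{R}^2)$ with $|\dot\gamma|\equiv\mathcal{L}[\gamma]>0$ and $$\gamma(0)=(0,0),\quad \dot\gamma(0)=\mathcal{L}[\gamma](\cos\theta_0,\sin\theta_0),\quad \gamma(1)=(l,0),\quad \dot\gamma(1)=\mathcal{L}[\gamma](\cos\theta_1,\sin\theta_1).$$ For $\theta\in[-\pi,\pi]$, the *borderline elastica with initial angle $\theta$* is the smooth unit speed curve $\gamma_B^\theta:[0,\infty)\to\mathbb{R}^2$ with $\gamma_B^\theta(0)=(0,0)$ that has a smooth tangential angle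 $\vartheta:[0,\infty)\to\mathbb{R}$ (that is, $\partial_s\gamma_B^\theta=(\cos\vartheta,\sin\vartheta)$) with $\vartheta(0)=\theta$, $\lim_{s\to\infty}\vartheta(s)=0$ and $|\partial_s\vartheta|^2=1-\cos\vartheta$ in $(0,\infty)$. Curves $f_\varepsilon:[0,T_\varepsilon]\to\mathbb{R}^2$ *converge to $g:[0,\infty)\to\mathbb{R}^2$ in $C^\infty_{loc}$* if for every $c>0$ they are eventually defined and smooth on $[0,c]$, and the derivatives of every order $k\ge0$ of $f_\varepsilon$ converge to those of $g$ uniformly on $[0,c]$. **Theorem.** For every $\theta\in[-\pi,\pi]$ the borderline elastica $\gamma_B^\theta$ exists and is unique. Moreover, let $P\subset(0,\infty)$ be a set of parameters with $0\in\overline{P}$ (for example $P=(0,\infty)$, or $P=\{\varepsilon_n\}$ for a sequence $\varepsilon_n\to0$); all limits $\varepsilon\to0$ are taken with $\varepsilon\in P$. Let $l_\varepsilon\to l$ in $(0,\infty)$ and $\theta_0^\varepsilon\to\theta_0$, $\theta_1^\varepsilon\to\theta_1$ in $[-\pi,\pi]$ as $\varepsilon\to0$. For $\varepsilon\in P$ let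 $\gamma_\varepsilon$ be a minimizer of $\mathcal{E}_\varepsilon$ in $\mathcal{A}_{\theta_0^\varepsilon,\theta_1^\varepsilon,l_\varepsilon}$, let $\tilde\gamma_\varepsilon$ be its arc length reparameterization and $L_\varepsilon$ its length. Then: 1. Let $\hat\gamma_\varepsilon(\hat s):=\varepsilon^{-1}\tilde\gamma_\varepsilon(\varepsilon\hat s)$ for $\hat s\in[0,L_\varepsilon/\varepsilon]$. If $|\theta_0|<\pi$, then $\hat\gamma_\varepsilon$ converges to $\gamma_B^{\theta_0}$ in $C^\infty_{loc}$ as $\varepsilon\to0$. If $|\theta_0|=\pi$, then every sequence in $P$ converging to $0$ has a subsequence $\varepsilon'\to0$ along which $\hat\gamma_{\varepsilon'}$ converges in $C^\infty_{loc}$ to $\gamma_B^{\pi}$ or to $\gamma_B^{-\pi}$. 2. For every $c>0$, the interval $K_{c\varepsilon}=[c\varepsilon,L_\varepsilon-c\varepsilon]$ is non-empty for all sufficiently small $\varepsilon\in P$, and $$\limsup_{\varepsilon\to0}\ \max_{s\in K_{c\varepsilon}}|\partial_s\tilde\gamma_\varepsilon(s)-(1,0)|\le 4e^{-c/\sqrt2}.$$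 -/

import Mathlib

open Set Filter Topology
open scoped ContDiff

namespace ClampedElastica

noncomputable section

/-- The Euclidean plane. A curve `[0,1] → ℝ²` is represented by a function `ℝ → Plane`, of which
only the values on `[0,1]` are ever used (derivatives are taken within the interval). -/
abbrev Plane : Type := EuclideanSpace ℝ (Fin 2)

/-- The unit vector `(cos θ, sin θ)`. -/
def dir (θ : ℝ) : Plane := !₂[Real.cos θ, Real.sin θ]

/-- First derivative of a curve on `[0,1]`. -/
def velocity (γ : ℝ → Plane) (t : ℝ) : Plane := derivWithin γ (Icc 0 1) t

/-- Second derivative of a curve on `[0,1]`. -/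
def acceleration (γ : ℝ → Plane) (t : ℝ) : Plane := derivWithin (velocity γ) (Icc 0 1) t

/-- Signed curvature `det(γ', γ'') / |γ'|³` of a curve on `[0,1]`. -/
def curvature (γ : ℝ → Plane) (t : ℝ) : ℝ :=
  (velocity γ t 0 * acceleration γ t 1 - velocity γ t 1 * acceleration γ t 0) / ‖velocity γ t‖ ^ 3

/-- Arc length from the initial point, `s(t) = ∫₀ᵗ |γ'|`. -/
def arcLength (γ : ℝ → Plane) (t : ℝ) : ℝ := ∫ τ in (0 : ℝ)..t, ‖velocity γ τ‖

/-- Total length. -/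
def length (γ : ℝ → Plane) : ℝ := arcLength γ 1

/-- Bending energy `∫_γ κ² ds`, with `ds = |γ'| dt`. -/
def bendingEnergy (γ : ℝ → Plane) : ℝ :=
  ∫ t in (0 : ℝ)..1, curvature γ t ^ 2 * ‖velocity γ t‖

/-- Modified total squared curvature `ε² ∫_γ κ² ds + ∫_γ ds`. -/
def energy (ε : ℝ) (γ : ℝ → Plane) : ℝ := ε ^ 2 * bendingEnergy γ + length γ

/-- The smooth constant speed clamped curves from `(0,0)` to `(l,0)` with initial and final
tangential angles `θ₀`, `θ₁`. -/
def admissible (θ₀ θ₁ l : ℝ) : Set (ℝ → Plane) :=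
  {γ | ContDiffOn ℝ ∞ γ (Icc 0 1) ∧
    0 < length γ ∧ (∀ t ∈ Icc (0 : ℝ) 1, ‖velocity γ t‖ = length γ) ∧
    γ 0 = !₂[0, 0] ∧ velocity γ 0 = length γ • dir θ₀ ∧
    γ 1 = !₂[l, 0] ∧ velocity γ 1 = length γ • dir θ₁}

/-- `γ` is a global minimizer of the energy among admissible curves. -/
def IsMinimizer (ε θ₀ θ₁ l : ℝ) (γ : ℝ → Plane) : Prop :=
  γ ∈ admissible θ₀ θ₁ l ∧ ∀ η ∈ admissible θ₀ θ₁ l, energy ε γ ≤ energy ε η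

/-- Arc length reparameterization, defined on `[0, length γ]`: the curve composed with the inverse
of its arc length function. -/
def arcLengthParam (γ : ℝ → Plane) (s : ℝ) : Plane :=
  γ (Function.invFunOn (arcLength γ) (Icc 0 1) s)

/-- Dilation at the origin of the arc length reparameterization,
`s ↦ ε⁻¹ γ̃(ε s)`, defined on `[0, length γ / ε]`. -/
def rescaled (ε : ℝ) (γ : ℝ → Plane) (s : ℝ) : Plane := ε⁻¹ • arcLengthParam γ (ε * s)

/-- `ϑ` is a (smooth) tangential angle of the curve `γ : [0,∞) → ℝ²`. -/
def IsTangentialAngle (γ : ℝ → Plane) (ϑ : ℝ → ℝ) : Prop :=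
  ContDiffOn ℝ ∞ ϑ (Ici 0) ∧
    ∀ s ∈ Ici (0 : ℝ), derivWithin γ (Ici 0) s = ‖derivWithin γ (Ici 0) s‖ • dir (ϑ s)

/-- `γ : [0,∞) → ℝ²` is the borderline elastica with initial angle `θ`. -/
def IsBorderlineElastica (θ : ℝ) (γ : ℝ → Plane) : Prop :=
  ContDiffOn ℝ ∞ γ (Ici 0) ∧ (∀ s ∈ Ici (0 : ℝ), ‖derivWithin γ (Ici 0) s‖ = 1) ∧
    γ 0 = !₂[0, 0] ∧
    ∃ ϑ : ℝ → ℝ, IsTangentialAngle γ ϑ ∧ ϑ 0 = θ ∧ Tendsto ϑ atTop (𝓝 0) ∧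
      ∀ s ∈ Ioi (0 : ℝ), deriv ϑ s ^ 2 = 1 - Real.cos (ϑ s)

/-- `C^∞_loc` convergence on `[0,∞)`: the curves `f a`, defined on `[0, T a]`, converge along `F` to
`g`, that is, for every `c > 0` they are eventually defined and smooth on `[0,c]` and each of their
derivatives converges uniformly on `[0,c]`. -/
def TendstoSmoothLoc {α : Type*} (f : α → ℝ → Plane) (T : α → ℝ) (F : Filter α)
    (g : ℝ → Plane) : Prop :=
  ∀ c : ℝ, 0 < c →
    (∀ᶠ a in F, c ≤ T a ∧ ContDiffOn ℝ ∞ (f a) (Icc 0 c)) ∧ ContDiffOn ℝ ∞ g (Icc 0 c) ∧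
    ∀ k : ℕ, TendstoUniformlyOn (fun a => iteratedDerivWithin k (f a) (Icc 0 c))
      (iteratedDerivWithin k g (Icc 0 c)) F (Icc 0 c)

end

end ClampedElastica

open ClampedElastica

/-! Dilated by 1/ε, a minimizer becomes a unit speed curve of length T = L/ε with tangential angle ϑ
and curvature κ, and its energy equals l + ε ∫ (κ² + 1 − cos ϑ). This excess is a phase transition
energy with wells 2πℤ. Since 1 − cos ϑ = 2 sin²(ϑ/2), Young's inequality bounds its density below by
4√2 |(cos(ϑ/2))'|, so reaching a well from an angle θ in [−π, π] costs at least 4√2 (1 − cos(θ/2))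
(`Profile.variation_le`). Equality means ϑ' = −√2 sin(ϑ/2), solved by ϑ = 4 arctan(tan(θ/4)
e^{−s/√2}); this is the borderline elastica.

Truncated optimal layers at both ends, joined by a long horizontal piece with a shallow vertical
step that corrects the displacement, form a competitor. Hence the excess of a minimizer is at most
the cost of two optimal layers plus o(1) (`exists_energy_bound`).

Minimality also yields the elastica equation with a conserved vector multiplier (p, q)
(`IsMinimizer.exists_multiplier`). Integral identities together with the bounded excess force (p, q)
→ (1, 0) as T → ∞ (`Profile.multiplier_le`), so the initial curvature can accumulate only at ±√2
sin(θ₀/2). For 0 < |θ₀| < π the wrong sign would lead the angle to ±2π, where cos(ϑ/2) = −1, at a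
cost exceeding the upper bound (`LayerFamily.curv_lim_eq`); for |θ₀| = π both directions cost the
same. Once the initial data converge, continuous dependence for the elastica equation gives
convergence of all derivatives on compact intervals (`LayerFamily.tendsto_borderline`).

For the estimate away from the endpoints, the variation of cos(ϑ/2) is nearly minimal, so |cos(ϑ/2)|
cannot dip between s = c and a nearly horizontal point of the second half. Up to o(1), |sin(ϑ/2)| on
[c, T/2] is therefore bounded by its value at c, hence by 2e^{−c/√2}. Reversing the curve treats the
other half, and |(cos ϑ, sin ϑ) − (1, 0)| = 2|sin(ϑ/2)| produces the constant 4. -/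

namespace ClampedElastica

/-! ### Plane-valued functions and smoothness on intervals. -/

theorem plane_norm_sq (v : Plane) : ‖v‖ ^ 2 = v 0 ^ 2 + v 1 ^ 2 := by
  rw [EuclideanSpace.norm_sq_eq]; simp

theorem plane_ext {v w : Plane} (h0 : v 0 = w 0) (h1 : v 1 = w 1) : v = w := by
  ext i; fin_cases i <;> assumption

@[simp] theorem dir_zero (θ : ℝ) : dir θ 0 = Real.cos θ := rfl

@[simp] theorem dir_one (θ : ℝ) : dir θ 1 = Real.sin θ := rfl

@[simp] theorem norm_dir (θ : ℝ) : ‖dir θ‖ = 1 := by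
  have h := plane_norm_sq (dir θ)
  rw [dir_zero, dir_one, Real.cos_sq_add_sin_sq] at h
  nlinarith [norm_nonneg (dir θ)]

theorem hasDerivWithinAt_plane {f : ℝ → Plane} {f' : Plane} {s : Set ℝ} {t : ℝ} :
    HasDerivWithinAt f f' s t ↔
      HasDerivWithinAt (fun t => f t 0) (f' 0) s t ∧ HasDerivWithinAt (fun t => f t 1) (f' 1) s t := by
  rw [hasDerivWithinAt_iff_hasFDerivWithinAt, hasFDerivWithinAt_euclidean, Fin.forall_fin_two]
  rfl

theorem hasDerivAt_plane {f : ℝ → Plane} {f' : Plane} {t : ℝ} :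
    HasDerivAt f f' t ↔
      HasDerivAt (fun t => f t 0) (f' 0) t ∧ HasDerivAt (fun t => f t 1) (f' 1) t := by
  simp only [← hasDerivWithinAt_univ, hasDerivWithinAt_plane]

theorem contDiffOn_plane {n : WithTop ℕ∞} {f : ℝ → Plane} {s : Set ℝ} :
    ContDiffOn ℝ n f s ↔
      ContDiffOn ℝ n (fun t => f t 0) s ∧ ContDiffOn ℝ n (fun t => f t 1) s := by
  rw [contDiffOn_euclidean, Fin.forall_fin_two]

theorem contDiff_plane {n : WithTop ℕ∞} {E : Type*} [NormedAddCommGroup E] [NormedSpace ℝ E]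
    {f : E → Plane} :
    ContDiff ℝ n f ↔ ContDiff ℝ n (fun t => f t 0) ∧ ContDiff ℝ n (fun t => f t 1) := by
  rw [contDiff_euclidean, Fin.forall_fin_two]

theorem contDiff_dir {n : WithTop ℕ∞} : ContDiff ℝ n dir :=
  contDiff_plane.2 ⟨Real.contDiff_cos, Real.contDiff_sin⟩

/-- A solution of an autonomous equation with smooth right-hand side is smooth. -/
theorem contDiffOn_of_ode {E : Type*} [NormedAddCommGroup E] [NormedSpace ℝ E] {f : E → E}
    {S : Set E} (hf : ContDiffOn ℝ ∞ f S) {D : Set ℝ} (hD : UniqueDiffOn ℝ D) {y : ℝ → E}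
    (hm : MapsTo y D S) (hy : ∀ t ∈ D, HasDerivWithinAt y (f (y t)) D t) :
    ContDiffOn ℝ ∞ y D := by
  have hdw : EqOn (derivWithin y D) (f ∘ y) D := fun t ht => (hy t ht).derivWithin (hD t ht)
  refine contDiffOn_infty.2 fun n => ?_
  induction n with
  | zero => exact contDiffOn_zero.2 fun t ht => (hy t ht).continuousWithinAt
  | succ n ih =>
    push_cast
    refine (contDiffOn_succ_iff_derivWithin (n := (n : WithTop ℕ∞)) hD).2
      ⟨fun t ht => (hy t ht).differentiableWithinAt, fun h => absurd h (WithTop.coe_ne_top (a := (n : ℕ∞))), ?_⟩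
    exact ((hf.of_le (by exact_mod_cast le_top)).comp ih hm).congr hdw

theorem contDiffOn_of_hasDerivWithinAt {E : Type*} [NormedAddCommGroup E] [NormedSpace ℝ E]
    {D : Set ℝ} (hD : UniqueDiffOn ℝ D) {y y' : ℝ → E}
    (hy : ∀ t ∈ D, HasDerivWithinAt y (y' t) D t) (hy' : ContDiffOn ℝ ∞ y' D) :
    ContDiffOn ℝ ∞ y D :=
  (contDiffOn_infty_iff_derivWithin hD).2 ⟨fun t ht => (hy t ht).differentiableWithinAt,
    hy'.congr fun t ht => (hy t ht).derivWithin (hD t ht)⟩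

theorem uniqueDiffOn_unit : UniqueDiffOn ℝ (Icc (0 : ℝ) 1) := uniqueDiffOn_Icc zero_lt_one

theorem contDiffOn_velocity {γ : ℝ → Plane} (h : ContDiffOn ℝ ∞ γ (Icc 0 1)) :
    ContDiffOn ℝ ∞ (velocity γ) (Icc 0 1) :=
  ((contDiffOn_infty_iff_derivWithin uniqueDiffOn_unit).1 h).2

theorem contDiffOn_acceleration {γ : ℝ → Plane} (h : ContDiffOn ℝ ∞ γ (Icc 0 1)) :
    ContDiffOn ℝ ∞ (acceleration γ) (Icc 0 1) :=
  contDiffOn_velocity (contDiffOn_velocity h)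

theorem hasDerivWithinAt_velocity {γ : ℝ → Plane} (h : ContDiffOn ℝ ∞ γ (Icc 0 1)) {t : ℝ}
    (ht : t ∈ Icc (0 : ℝ) 1) :
    HasDerivWithinAt γ (velocity γ t) (Icc 0 1) t :=
  (((contDiffOn_infty_iff_derivWithin uniqueDiffOn_unit).1 h).1 t ht).hasDerivWithinAt

theorem hasDerivWithinAt_acceleration {γ : ℝ → Plane} (h : ContDiffOn ℝ ∞ γ (Icc 0 1)) {t : ℝ}
    (ht : t ∈ Icc (0 : ℝ) 1) :
    HasDerivWithinAt (velocity γ) (acceleration γ t) (Icc 0 1) t :=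
  hasDerivWithinAt_velocity (contDiffOn_velocity h) ht

theorem velocity_eq {γ : ℝ → Plane} {t : ℝ} {v : Plane} (ht : t ∈ Icc (0 : ℝ) 1)
    (h : HasDerivWithinAt γ v (Icc 0 1) t) : velocity γ t = v :=
  h.derivWithin (uniqueDiffOn_unit t ht)

theorem acceleration_eq {γ v : ℝ → Plane} {t : ℝ} {a : Plane} (ht : t ∈ Icc (0 : ℝ) 1)
    (hv : EqOn (velocity γ) v (Icc 0 1)) (h : HasDerivWithinAt v a (Icc 0 1) t) :
    acceleration γ t = a :=
  (h.congr hv (hv ht)).derivWithin (uniqueDiffOn_unit t ht)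

/-! ### Integrals on intervals and constant speed reparametrization. -/

theorem length_eq_integral (γ : ℝ → Plane) : length γ = ∫ t in (0 : ℝ)..1, ‖velocity γ t‖ := rfl

/-- A continuous function on the unit interval, extended continuously to the line, has a primitive. -/
theorem exists_primitive_unit {E : Type*} [NormedAddCommGroup E] [NormedSpace ℝ E]
    [CompleteSpace E] {T : ℝ} (hT : 0 ≤ T) {f : ℝ → E} (hf : ContinuousOn f (Icc 0 T)) (y : E) :
    ∃ F : ℝ → E, F 0 = y ∧ ∀ t ∈ Icc 0 T, HasDerivWithinAt F (f t) (Icc 0 T) t := by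
  let u : ℝ → E := IccExtend hT ((Icc 0 T).domRestrict f)
  have hu : Continuous u := hf.domRestrict.Icc_extend'
  refine ⟨fun t => y + ∫ τ in (0 : ℝ)..t, u τ, by simp, fun t ht => ?_⟩
  have h1 : u t = f t := by simp [u, IccExtend_of_mem hT _ ht, domRestrict]
  rw [← h1]
  exact ((hu.integral_hasStrictDerivAt 0 t).hasDerivAt.const_add y).hasDerivWithinAt

theorem intervalIntegral_eq_sub_Icc {E : Type*} [NormedAddCommGroup E] [NormedSpace ℝ E]
    [CompleteSpace E] {a b : ℝ} (hab : a ≤ b) {F f : ℝ → E}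
    (hF : ∀ t ∈ Icc a b, HasDerivWithinAt F (f t) (Icc a b) t) (hf : ContinuousOn f (Icc a b)) :
    ∫ t in a..b, f t = F b - F a :=
  intervalIntegral.integral_eq_sub_of_hasDerivAt_of_le hab
    (fun t ht => (hF t ht).continuousWithinAt)
    (fun t ht => (hF t (Ioo_subset_Icc_self ht)).hasDerivAt (Icc_mem_nhds ht.1 ht.2))
    (ContinuousOn.intervalIntegrable (by rwa [uIcc_of_le hab]))

/-- A reparametrization with derivative r replaces the velocity v by r v and the acceleration a by
r² a + r' v. The r' term is parallel to v and drops out of the determinant. -/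
theorem curvature_scale {r n : ℝ} (hr : r ≠ 0) (hn : n ≠ 0) (r' : ℝ) (v a : Plane) :
    ((r • v) 0 * (r • r • a + r' • v) 1 - (r • v) 1 * (r • r • a + r' • v) 0) / (r * n) ^ 3 =
      (v 0 * a 1 - v 1 * a 0) / n ^ 3 := by
  simp only [PiLp.add_apply, PiLp.smul_apply, smul_eq_mul]
  field_simp
  ring

/-- Constant speed reparametrization of a smooth regular curve. -/
theorem exists_constSpeed_reparam {σ : ℝ → Plane} (hσ : ContDiffOn ℝ ∞ σ (Icc 0 1))
    (hreg : ∀ t ∈ Icc (0 : ℝ) 1, velocity σ t ≠ 0) :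
    ∃ η : ℝ → Plane, ContDiffOn ℝ ∞ η (Icc 0 1) ∧ 0 < length σ ∧ length η = length σ ∧
      (∀ t ∈ Icc (0 : ℝ) 1, ‖velocity η t‖ = length σ) ∧ η 0 = σ 0 ∧ η 1 = σ 1 ∧
      velocity η 0 = (length σ / ‖velocity σ 0‖) • velocity σ 0 ∧
      velocity η 1 = (length σ / ‖velocity σ 1‖) • velocity σ 1 ∧
      bendingEnergy η = bendingEnergy σ := by
  have hvs : ContDiffOn ℝ ∞ (fun t => ‖velocity σ t‖) (Icc 0 1) :=
    (contDiffOn_velocity hσ).norm ℝ hreg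
  have hvpos : ∀ t ∈ Icc (0 : ℝ) 1, 0 < ‖velocity σ t‖ := fun t ht => norm_pos_iff.2 (hreg t ht)
  obtain ⟨t₀, ht₀, hmin⟩ := isCompact_Icc.exists_isMinOn (nonempty_Icc.2 zero_le_one)
    hvs.continuousOn
  -- Extended by its boundary values, the speed keeps its positive minimum on the whole line, so the
  -- normalized arc length `h` is a bijection of ℝ and its inverse needs no special care at the
  -- endpoints.
  let u : ℝ → ℝ := IccExtend zero_le_one ((Icc (0 : ℝ) 1).domRestrict fun t => ‖velocity σ t‖)
  have hu : Continuous u := hvs.continuousOn.domRestrict.Icc_extend'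
  have huv : ∀ t ∈ Icc (0 : ℝ) 1, u t = ‖velocity σ t‖ := fun t ht => by
    simp [u, IccExtend_of_mem zero_le_one _ ht, domRestrict]
  have hum : ∀ t, ‖velocity σ t₀‖ ≤ u t := fun t => hmin (projIcc 0 1 zero_le_one t).2
  have hm := hvpos t₀ ht₀
  have hupos : ∀ t, 0 < u t := fun t => hm.trans_le (hum t)
  have hΛ : length σ = ∫ t in (0 : ℝ)..1, u t := by
    rw [length_eq_integral]
    refine intervalIntegral.integral_congr fun t ht => ?_
    rw [uIcc_of_le zero_le_one] at ht
    exact (huv t ht).symm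
  have hΛpos : 0 < length σ := by
    rw [hΛ]
    exact intervalIntegral.intervalIntegral_pos_of_pos (hu.intervalIntegrable _ _) hupos zero_lt_one
  set Λ := length σ
  let h : ℝ → ℝ := fun t => (∫ τ in (0 : ℝ)..t, u τ) / Λ
  have hh : ∀ t, HasDerivAt h (u t / Λ) t := fun t =>
    (hu.integral_hasStrictDerivAt 0 t).hasDerivAt.div_const Λ
  have hmono : StrictMono h := strictMono_of_hasDerivAt_pos hh fun t => div_pos (hupos t) hΛpos
  have hcont : Continuous h := continuous_iff_continuousAt.2 fun t => (hh t).continuousAt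
  have hg : Monotone fun t => h t - ‖velocity σ t₀‖ / Λ * t := by
    have hd : ∀ t, HasDerivAt (fun t => h t - ‖velocity σ t₀‖ / Λ * t)
        (u t / Λ - ‖velocity σ t₀‖ / Λ * 1) t := fun t => (hh t).sub ((hasDerivAt_id t).const_mul _)
    refine monotone_of_deriv_nonneg (fun t => (hd t).differentiableAt) fun t => ?_
    rw [(hd t).deriv, mul_one, sub_nonneg]
    exact div_le_div_of_nonneg_right (hum t) hΛpos.le
  have h0 : h 0 = 0 := by simp [h]
  have h1 : h 1 = 1 := by simp only [h, ← hΛ]; exact div_self hΛpos.ne'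
  have hmΛ : 0 < ‖velocity σ t₀‖ / Λ := div_pos hm hΛpos
  have htop : Tendsto h atTop atTop := by
    refine tendsto_atTop_mono' _ ?_ (tendsto_id.const_mul_atTop hmΛ)
    filter_upwards [eventually_ge_atTop 0] with t ht
    have := hg ht
    simp only [h0, mul_zero, sub_zero] at this
    simpa using this
  have hbot : Tendsto h atBot atBot := by
    refine tendsto_atBot_mono' _ ?_ (tendsto_id.const_mul_atBot hmΛ)
    filter_upwards [eventually_le_atBot 0] with t ht
    have := hg ht
    simp only [h0, mul_zero, sub_zero] at this
    simpa using this
  have hsurj := hcont.surjective htop hbot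
  let e := hmono.orderIsoOfSurjective h hsurj
  let k : ℝ → ℝ := e.symm
  have hhk : ∀ t, h (k t) = t := fun t => e.apply_symm_apply t
  have hkh : ∀ t, k (h t) = t := fun t => e.symm_apply_apply t
  have hkc : Continuous k := e.symm.continuous
  have hk0 : k 0 = 0 := by rw [← h0, hkh, h0]
  have hk1 : k 1 = 1 := by rw [← h1, hkh, h1]
  have hkmaps : MapsTo k (Icc 0 1) (Icc 0 1) := fun t ht =>
    ⟨by rw [← hk0]; exact e.symm.monotone ht.1, by rw [← hk1]; exact e.symm.monotone ht.2⟩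
  have hkd : ∀ t, HasDerivAt k (u (k t) / Λ)⁻¹ t := fun t =>
    HasDerivAt.of_local_left_inverse hkc.continuousAt (hh (k t))
      (div_pos (hupos _) hΛpos).ne' (Eventually.of_forall hhk)
  have hkd' : ∀ t ∈ Icc (0 : ℝ) 1,
      HasDerivWithinAt k (Λ / ‖velocity σ (k t)‖) (Icc 0 1) t := fun t ht => by
    have := (hkd t).hasDerivWithinAt (s := Icc 0 1)
    rwa [huv _ (hkmaps ht), inv_div] at this
  -- The inverse solves the autonomous equation k' = Λ/|σ'(k)|, which yields its smoothness by
  -- bootstrapping.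
  have hks : ContDiffOn ℝ ∞ k (Icc 0 1) :=
    contDiffOn_of_ode (f := fun x => Λ / ‖velocity σ x‖) (S := Icc 0 1)
      (contDiffOn_const.div hvs fun t ht => (hvpos t ht).ne') uniqueDiffOn_unit hkmaps hkd'
  have hηv : ∀ t ∈ Icc (0 : ℝ) 1,
      velocity (σ ∘ k) t = (Λ / ‖velocity σ (k t)‖) • velocity σ (k t) := fun t ht =>
    velocity_eq ht ((hasDerivWithinAt_velocity hσ (hkmaps ht)).scomp t (hkd' t ht) hkmaps)
  have hηn : ∀ t ∈ Icc (0 : ℝ) 1, ‖velocity (σ ∘ k) t‖ = Λ := fun t ht => by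
    rw [hηv t ht, norm_smul, Real.norm_of_nonneg (div_nonneg hΛpos.le (norm_nonneg _)),
      div_mul_cancel₀ _ (hvpos _ (hkmaps ht)).ne']
  have hlen : length (σ ∘ k) = Λ := by
    rw [length_eq_integral, intervalIntegral.integral_congr (g := fun _ => Λ)]
    · simp
    · intro t ht
      rw [uIcc_of_le zero_le_one] at ht
      exact hηn t ht
  have hη : ContDiffOn ℝ ∞ (σ ∘ k) (Icc 0 1) := hσ.comp hks hkmaps
  refine ⟨σ ∘ k, hη, hΛpos, hlen, hηn, by simp [hk0], by simp [hk1], ?_, ?_, ?_⟩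
  · rw [hηv 0 (by simp), hk0]
  · rw [hηv 1 (by simp), hk1]
  let r : ℝ → ℝ := fun t => Λ / ‖velocity σ (k t)‖
  have hr : ContDiffOn ℝ ∞ r (Icc 0 1) :=
    contDiffOn_const.div (hvs.comp hks hkmaps) fun t ht => (hvpos _ (hkmaps ht)).ne'
  have hrpos : ∀ t ∈ Icc (0 : ℝ) 1, 0 < r t := fun t ht => div_pos hΛpos (hvpos _ (hkmaps ht))
  have hcurv : ∀ t ∈ Icc (0 : ℝ) 1, curvature (σ ∘ k) t = curvature σ (k t) := fun t ht => by
    have hr' := ((contDiffOn_infty_iff_derivWithin uniqueDiffOn_unit).1 hr).1 t ht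
      |>.hasDerivWithinAt
    have ha := acceleration_eq ht hηv (hr'.smul
      ((hasDerivWithinAt_acceleration hσ (hkmaps ht)).scomp t (hkd' t ht) hkmaps))
    have hrt := (hrpos t ht).ne'
    have hvt := (hvpos _ (hkmaps ht)).ne'
    rw [curvature, curvature, ha, hηv t ht, norm_smul, Real.norm_of_nonneg (hrpos t ht).le]
    exact curvature_scale hrt hvt _ _ _
  have hD : ContinuousOn (fun t => curvature σ t ^ 2 * ‖velocity σ t‖) (Icc 0 1) := by
    have hv := contDiffOn_plane.1 (contDiffOn_velocity hσ)
    have ha := contDiffOn_plane.1 (contDiffOn_acceleration hσ)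
    refine ContinuousOn.mul (ContinuousOn.pow (ContinuousOn.div ?_ ?_ ?_) 2) hvs.continuousOn
    · exact ((hv.1.mul ha.2).sub (hv.2.mul ha.1)).continuousOn
    · exact hvs.continuousOn.pow 3
    · exact fun t ht => (pow_pos (hvpos t ht) 3).ne'
  have himg : k '' Icc 0 1 ⊆ Icc 0 1 := hkmaps.image_subset
  have hsub := intervalIntegral.integral_comp_mul_deriv'' (a := 0) (b := 1) (f := k) (f' := r)
    (g := fun t => curvature σ t ^ 2 * ‖velocity σ t‖)
    (by rw [uIcc_of_le zero_le_one]; exact hkc.continuousOn)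
    (fun t ht => by
      rw [min_eq_left zero_le_one, max_eq_right zero_le_one] at ht
      exact ((hkd' t (Ioo_subset_Icc_self ht)).hasDerivAt (Icc_mem_nhds ht.1 ht.2)).hasDerivWithinAt)
    (by rw [uIcc_of_le zero_le_one]; exact hr.continuousOn)
    (by rw [uIcc_of_le zero_le_one]; exact hD.mono himg)
  rw [hk0, hk1] at hsub
  rw [bendingEnergy, bendingEnergy, ← hsub]
  refine intervalIntegral.integral_congr fun t ht => ?_
  rw [uIcc_of_le zero_le_one] at ht
  have hvt := (hvpos _ (hkmaps ht)).ne'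
  simp only [Function.comp_apply, r]
  rw [hcurv t ht, hηn t ht]
  field_simp

/-- Minimality among smooth regular curves, not necessarily of constant speed. -/
theorem IsMinimizer.energy_le {ε θ₀ θ₁ l : ℝ} {γ σ : ℝ → Plane} (hγ : IsMinimizer ε θ₀ θ₁ l γ)
    (hσ : ContDiffOn ℝ ∞ σ (Icc 0 1)) (hreg : ∀ t ∈ Icc (0 : ℝ) 1, velocity σ t ≠ 0)
    (h0 : σ 0 = !₂[0, 0]) (h1 : σ 1 = !₂[l, 0])
    (hv0 : velocity σ 0 = ‖velocity σ 0‖ • dir θ₀) (hv1 : velocity σ 1 = ‖velocity σ 1‖ • dir θ₁) :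
    energy ε γ ≤ energy ε σ := by
  obtain ⟨η, hη, hpos, hlen, hn, hη0, hη1, hηv0, hηv1, hb⟩ := exists_constSpeed_reparam hσ hreg
  have hc : ∀ t ∈ Icc (0 : ℝ) 1, length σ / ‖velocity σ t‖ * ‖velocity σ t‖ = length σ :=
    fun t ht => div_mul_cancel₀ _ (norm_pos_iff.2 (hreg t ht)).ne'
  refine (hγ.2 η ⟨hη, hlen ▸ hpos, fun t ht => by rw [hn t ht, hlen], hη0.trans h0, ?_,
    hη1.trans h1, ?_⟩).trans_eq (by rw [energy, energy, hb, hlen])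
  · rw [hηv0, hlen, hv0, smul_smul, ← hv0, hc 0 (by simp)]
  · rw [hηv1, hlen, hv1, smul_smul, ← hv1, hc 1 (by simp)]

/-! ### Tangential angle. -/

theorem hasDerivWithinAt_of_smooth {f : ℝ → ℝ} (hf : ContDiffOn ℝ ∞ f (Icc 0 1)) {t : ℝ}
    (ht : t ∈ Icc (0 : ℝ) 1) : HasDerivWithinAt f (derivWithin f (Icc 0 1) t) (Icc 0 1) t :=
  (((contDiffOn_infty_iff_derivWithin uniqueDiffOn_unit).1 hf).1 t ht).hasDerivWithinAt

theorem contDiffOn_derivWithin_of_smooth {f : ℝ → ℝ} (hf : ContDiffOn ℝ ∞ f (Icc 0 1)) :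
    ContDiffOn ℝ ∞ (derivWithin f (Icc 0 1)) (Icc 0 1) :=
  ((contDiffOn_infty_iff_derivWithin uniqueDiffOn_unit).1 hf).2

theorem constant_unit {f : ℝ → ℝ} (hf : ∀ t ∈ Icc (0 : ℝ) 1, HasDerivWithinAt f 0 (Icc 0 1) t) :
    ∀ t ∈ Icc (0 : ℝ) 1, f t = f 0 :=
  constant_of_derivWithin_zero (fun t ht => (hf t ht).differentiableWithinAt) fun t ht =>
    (hf t (Ico_subset_Icc_self ht)).derivWithin (uniqueDiffOn_unit t (Ico_subset_Icc_self ht))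

/-- Smooth tangential angle of an admissible curve. -/
theorem exists_angle {θ₀ θ₁ l : ℝ} {γ : ℝ → Plane} (h : γ ∈ admissible θ₀ θ₁ l) :
    ∃ ϑ : ℝ → ℝ, ContDiffOn ℝ ∞ ϑ (Icc 0 1) ∧ ϑ 0 = θ₀ ∧
      (∀ t ∈ Icc (0 : ℝ) 1, velocity γ t = length γ • dir (ϑ t)) ∧ dir (ϑ 1) = dir θ₁ := by
  obtain ⟨hγ, hL, hn, -, hv0, -, hv1⟩ := h
  set L := length γ
  have hL' := hL.ne'
  set v := velocity γ with hv
  set a := acceleration γ with ha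
  have hvs := contDiffOn_plane.1 (contDiffOn_velocity hγ)
  have has := contDiffOn_plane.1 (contDiffOn_acceleration hγ)
  -- At constant speed L, this is the derivative that any tangential angle must have; integrating it
  -- avoids lifting through the covering of the circle.
  let k : ℝ → ℝ := fun t => (v t 0 * a t 1 - v t 1 * a t 0) / L ^ 2
  have hk : ContDiffOn ℝ ∞ k (Icc 0 1) := ((hvs.1.mul has.2).sub (hvs.2.mul has.1)).div_const _
  obtain ⟨ϑ, hϑ0, hϑ⟩ := exists_primitive_unit zero_le_one hk.continuousOn θ₀
  have hϑs : ContDiffOn ℝ ∞ ϑ (Icc 0 1) := contDiffOn_of_hasDerivWithinAt uniqueDiffOn_unit hϑ hk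
  have hsq : ∀ t ∈ Icc (0 : ℝ) 1, v t 0 ^ 2 + v t 1 ^ 2 = L ^ 2 := fun t ht => by
    rw [← plane_norm_sq, hn t ht]
  have hva : ∀ t ∈ Icc (0 : ℝ) 1, HasDerivWithinAt (fun t => v t 0) (a t 0) (Icc 0 1) t ∧
      HasDerivWithinAt (fun t => v t 1) (a t 1) (Icc 0 1) t := fun t ht =>
    hasDerivWithinAt_plane.1 (hasDerivWithinAt_acceleration hγ ht)
  have horth : ∀ t ∈ Icc (0 : ℝ) 1, v t 0 * a t 0 + v t 1 * a t 1 = 0 := fun t ht => by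
    have h1 := ((hva t ht).1.pow 2).add ((hva t ht).2.pow 2)
    have h2 : HasDerivWithinAt (fun t => v t 0 ^ 2 + v t 1 ^ 2) 0 (Icc 0 1) t :=
      (hasDerivWithinAt_const t _ (L ^ 2)).congr hsq (hsq t ht)
    have := (uniqueDiffOn_unit t ht).eq_deriv _ h1 h2
    norm_num at this
    linarith
  have ha' : ∀ t ∈ Icc (0 : ℝ) 1, a t 0 = -(k t * v t 1) ∧ a t 1 = k t * v t 0 := fun t ht => by
    have h1 := horth t ht
    have h2 := hsq t ht
    simp only [k]
    constructor
    · field_simp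
      linear_combination (-(a t 0)) * h2 + v t 0 * h1
    · field_simp
      linear_combination (-(a t 1)) * h2 + v t 1 * h1
  -- The inner product of v with (cos ϑ, sin ϑ) is conserved because both vectors rotate at the same
  -- rate. Equality in Cauchy-Schwarz then identifies v with L (cos ϑ, sin ϑ).
  have hI : ∀ t ∈ Icc (0 : ℝ) 1, v t 0 * Real.cos (ϑ t) + v t 1 * Real.sin (ϑ t) = L := by
    intro t ht
    rw [constant_unit (f := fun t => v t 0 * Real.cos (ϑ t) + v t 1 * Real.sin (ϑ t)) _ t ht]
    · rw [hv0, hϑ0]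
      simp only [PiLp.smul_apply, dir_zero, dir_one, smul_eq_mul]
      linear_combination L * Real.cos_sq_add_sin_sq θ₀
    · intro t ht
      have := ((hva t ht).1.mul (hϑ t ht).cos).add ((hva t ht).2.mul (hϑ t ht).sin)
      refine this.congr_deriv ?_
      rw [(ha' t ht).1, (ha' t ht).2]
      ring
  have hvel : ∀ t ∈ Icc (0 : ℝ) 1, v t = L • dir (ϑ t) := fun t ht => by
    have h1 := hI t ht
    have h2 := hsq t ht
    have h3 := Real.cos_sq_add_sin_sq (ϑ t)
    have h4 : (v t 0 - L * Real.cos (ϑ t)) ^ 2 + (v t 1 - L * Real.sin (ϑ t)) ^ 2 = 0 := by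
      linear_combination h2 - 2 * L * h1 + L ^ 2 * h3
    have h5 : v t 0 - L * Real.cos (ϑ t) = 0 := by
      nlinarith [sq_nonneg (v t 0 - L * Real.cos (ϑ t)), sq_nonneg (v t 1 - L * Real.sin (ϑ t))]
    have h6 : v t 1 - L * Real.sin (ϑ t) = 0 := by
      nlinarith [sq_nonneg (v t 0 - L * Real.cos (ϑ t)), sq_nonneg (v t 1 - L * Real.sin (ϑ t))]
    exact plane_ext (by simp; linarith) (by simp; linarith)
  exact ⟨ϑ, hϑs, hϑ0, hvel, smul_right_injective _ hL' ((hvel 1 (by simp)).symm.trans hv1)⟩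

/-! ### First variation and Euler-Lagrange equations. -/

/-- Density of the energy with respect to the parameter. -/
noncomputable def energyDensity (ε : ℝ) (v a : Plane) : ℝ :=
  ε ^ 2 * ((v 0 * a 1 - v 1 * a 0) ^ 2 / ‖v‖ ^ 5) + ‖v‖

theorem energy_eq_integral (ε : ℝ) {σ : ℝ → Plane} (hσ : ContDiffOn ℝ ∞ σ (Icc 0 1))
    (hreg : ∀ t ∈ Icc (0 : ℝ) 1, velocity σ t ≠ 0) :
    energy ε σ = ∫ t in (0 : ℝ)..1, energyDensity ε (velocity σ t) (acceleration σ t) := by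
  have hv := contDiffOn_plane.1 (contDiffOn_velocity hσ)
  have ha := contDiffOn_plane.1 (contDiffOn_acceleration hσ)
  have hn := (contDiffOn_velocity hσ).continuousOn.norm
  have hc : ContinuousOn (fun t => curvature σ t ^ 2 * ‖velocity σ t‖) (Icc 0 1) := by
    refine ContinuousOn.mul (ContinuousOn.pow (ContinuousOn.div ?_ (hn.pow 3) ?_) 2) hn
    · exact ((hv.1.mul ha.2).sub (hv.2.mul ha.1)).continuousOn
    · exact fun t ht => (pow_pos (norm_pos_iff.2 (hreg t ht)) 3).ne'
  rw [← uIcc_of_le zero_le_one] at hn hc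
  rw [energy, bendingEnergy, length_eq_integral, ← intervalIntegral.integral_const_mul,
    ← intervalIntegral.integral_add (hc.intervalIntegrable.const_mul _) hn.intervalIntegrable]
  refine intervalIntegral.integral_congr fun t ht => ?_
  rw [uIcc_of_le zero_le_one] at ht
  have := (norm_pos_iff.2 (hreg t ht)).ne'
  simp only [energyDensity, curvature]
  field_simp

theorem plane_norm_eq (v : Plane) : ‖v‖ = √(v 0 ^ 2 + v 1 ^ 2) := by
  rw [← plane_norm_sq, Real.sqrt_sq (norm_nonneg v)]

/-- Derivative of the energy density along a line. -/
noncomputable def energyDensityDeriv (ε : ℝ) (v a w b : Plane) : ℝ :=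
  ε ^ 2 * (2 * (v 0 * a 1 - v 1 * a 0) * (w 0 * a 1 + v 0 * b 1 - (w 1 * a 0 + v 1 * b 0)) / ‖v‖ ^ 5
    - 5 * (v 0 * a 1 - v 1 * a 0) ^ 2 * ((v 0 * w 0 + v 1 * w 1) / ‖v‖) / ‖v‖ ^ 6)
    + (v 0 * w 0 + v 1 * w 1) / ‖v‖

theorem hasDerivAt_energyDensity (ε : ℝ) {v a w b : Plane} {δ : ℝ} (h : v + δ • w ≠ 0) :
    HasDerivAt (fun δ : ℝ => energyDensity ε (v + δ • w) (a + δ • b))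
      (energyDensityDeriv ε (v + δ • w) (a + δ • b) w b) δ := by
  have hlin : ∀ x y : ℝ, HasDerivAt (fun δ : ℝ => x + δ * y) y δ := fun x y => by
    simpa using ((hasDerivAt_id δ).mul_const y).const_add x
  have hn : HasDerivAt (fun δ : ℝ => ‖v + δ • w‖)
      (((v + δ • w) 0 * w 0 + (v + δ • w) 1 * w 1) / ‖v + δ • w‖) δ := by
    have h1 := (((hlin (v 0) (w 0)).pow 2).add ((hlin (v 1) (w 1)).pow 2)).sqrt (by
      have := plane_norm_sq (v + δ • w)
      have h2 := pow_pos (norm_pos_iff.2 h) 2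
      rw [this] at h2
      exact h2.ne')
    simp only [plane_norm_eq, PiLp.add_apply, PiLp.smul_apply, smul_eq_mul]
    refine h1.congr_deriv ?_
    simp only [Pi.add_apply, Pi.pow_apply]
    push_cast
    rw [show ∀ x y p q r : ℝ, (2 * x ^ (2 - 1) * p + 2 * y ^ (2 - 1) * q) / (2 * r) =
      2 * (x * p + y * q) / (2 * r) from fun x y p q r => by norm_num; ring,
      mul_div_mul_left _ _ two_ne_zero]
  have hD := ((hlin (v 0) (w 0)).mul (hlin (a 1) (b 1))).sub
    ((hlin (v 1) (w 1)).mul (hlin (a 0) (b 0)))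
  have hn0 := (norm_pos_iff.2 h).ne'
  have := (((hD.pow 2).div (hn.pow 5) (pow_ne_zero 5 hn0)).const_mul (ε ^ 2)).add hn
  simp only [energyDensity, energyDensityDeriv, PiLp.add_apply, PiLp.smul_apply, smul_eq_mul] at *
  refine this.congr_deriv ?_
  simp only [Pi.sub_apply, Pi.mul_apply, Pi.pow_apply]
  field_simp
  ring

/-- Differentiation under the integral sign; compactness of the parameter rectangle supplies a
constant dominating function. -/
theorem hasDerivAt_integral_of_continuousOn {d : ℝ} (hd : 0 < d) {F F' : ℝ → ℝ → ℝ}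
    (hF : ∀ δ ∈ Ioo (-d) d, ContinuousOn (F δ) (Icc 0 1))
    (hF' : ContinuousOn (fun z : ℝ × ℝ => F' z.1 z.2) (Icc (-d) d ×ˢ Icc 0 1))
    (hFF' : ∀ δ ∈ Ioo (-d) d, ∀ t ∈ Icc (0 : ℝ) 1, HasDerivAt (fun δ => F δ t) (F' δ t) δ) :
    HasDerivAt (fun δ => ∫ t in (0 : ℝ)..1, F δ t) (∫ t in (0 : ℝ)..1, F' 0 t) 0 := by
  obtain ⟨C, hC⟩ := (isCompact_Icc.prod isCompact_Icc).exists_bound_of_continuousOn hF'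
  have h0 : (0 : ℝ) ∈ Ioo (-d) d := ⟨by linarith, hd⟩
  have hsub : uIoc (0 : ℝ) 1 ⊆ Icc 0 1 := by
    rw [uIoc_of_le zero_le_one]; exact Ioc_subset_Icc_self
  have hF'0 : ContinuousOn (F' 0) (Icc 0 1) :=
    hF'.comp (f := fun t => ((0 : ℝ), t)) (by fun_prop) fun t ht => ⟨Ioo_subset_Icc_self h0, ht⟩
  refine (intervalIntegral.hasDerivAt_integral_of_dominated_loc_of_deriv_le
    (s := Ioo (-d) d) (bound := fun _ => C) (Ioo_mem_nhds h0.1 h0.2) ?_ ?_ ?_ ?_ ?_ ?_).2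
  · filter_upwards [Ioo_mem_nhds h0.1 h0.2] with δ hδ
    exact ((hF δ hδ).mono hsub).aestronglyMeasurable measurableSet_uIoc
  · exact ((hF 0 h0).mono (by rw [uIcc_of_le zero_le_one])).intervalIntegrable
  · exact (hF'0.mono hsub).aestronglyMeasurable measurableSet_uIoc
  · exact Eventually.of_forall fun t ht δ hδ => hC (δ, t) ⟨Ioo_subset_Icc_self hδ, hsub ht⟩
  · simp
  · exact Eventually.of_forall fun t ht δ hδ => hFF' δ hδ t (hsub ht)

theorem continuousOn_coord {X : Type*} [TopologicalSpace X] {f : X → Plane} {U : Set X} (i : Fin 2)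
    (hf : ContinuousOn f U) : ContinuousOn (fun z => f z i) U :=
  (EuclideanSpace.proj i : Plane →L[ℝ] ℝ).continuous.comp_continuousOn hf

theorem continuousOn_energyDensityDeriv (ε : ℝ) {X : Type*} [TopologicalSpace X]
    {v a w b : X → Plane} {U : Set X} (hv : ContinuousOn v U) (ha : ContinuousOn a U)
    (hw : ContinuousOn w U) (hb : ContinuousOn b U) (h : ∀ z ∈ U, v z ≠ 0) :
    ContinuousOn (fun z => energyDensityDeriv ε (v z) (a z) (w z) (b z)) U := by
  have hn : ∀ z ∈ U, ‖v z‖ ≠ 0 := fun z hz => norm_ne_zero_iff.2 (h z hz)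
  have hD := ((continuousOn_coord 0 hv).mul (continuousOn_coord 1 ha)).sub
    ((continuousOn_coord 1 hv).mul (continuousOn_coord 0 ha))
  have hD' := (((continuousOn_coord 0 hw).mul (continuousOn_coord 1 ha)).add
    ((continuousOn_coord 0 hv).mul (continuousOn_coord 1 hb))).sub
    (((continuousOn_coord 1 hw).mul (continuousOn_coord 0 ha)).add
    ((continuousOn_coord 1 hv).mul (continuousOn_coord 0 hb)))
  have hN := (((continuousOn_coord 0 hv).mul (continuousOn_coord 0 hw)).add
    ((continuousOn_coord 1 hv).mul (continuousOn_coord 1 hw))).div hv.norm hn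
  exact (continuousOn_const.mul ((((continuousOn_const.mul hD).mul hD').div (hv.norm.pow 5)
    fun z hz => pow_ne_zero 5 (hn z hz)).sub (((continuousOn_const.mul (hD.pow 2)).mul hN).div
    (hv.norm.pow 6) fun z hz => pow_ne_zero 6 (hn z hz)))).add hN

/-- Vanishing first variation of the energy at a minimizer, for compactly supported variations. -/
theorem IsMinimizer.integral_energyDensityDeriv {ε θ₀ θ₁ l : ℝ} {γ : ℝ → Plane}
    (hγ : IsMinimizer ε θ₀ θ₁ l γ) {g : ℝ → ℝ} (hg : ContDiff ℝ ∞ g) (hg0 : g 0 = 0) (hg1 : g 1 = 0)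
    (hg0' : deriv g 0 = 0) (hg1' : deriv g 1 = 0) (e : Plane) :
    ∫ t in (0 : ℝ)..1, energyDensityDeriv ε (velocity γ t) (acceleration γ t)
      (deriv g t • e) (deriv (deriv g) t • e) = 0 := by
  obtain ⟨⟨hs, hL, hn, h0, hv0, h1, hv1⟩, -⟩ := id hγ
  set L := length γ
  have hgs : ContDiff ℝ ∞ (deriv g) := (contDiff_infty_iff_deriv.1 hg).2
  have hgs' : ContDiff ℝ ∞ (deriv (deriv g)) := (contDiff_infty_iff_deriv.1 hgs).2
  obtain ⟨C, hC⟩ := (isCompact_Icc (a := (0 : ℝ)) (b := 1)).exists_bound_of_continuousOn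
    (hgs.smul (contDiff_const (c := e))).continuous.continuousOn
  have hC0 : 0 ≤ C := (norm_nonneg _).trans (hC 0 (by simp))
  have hdpos : 0 < L / (2 * (C + 1)) := by positivity
  -- With C a bound for |g' e|, parameters |δ| ≤ d change the velocity by at most d C < L, so the
  -- varied curves stay regular.
  set d := L / (2 * (C + 1)) with hd
  have hreg : ∀ δ ∈ Icc (-d) d, ∀ t ∈ Icc (0 : ℝ) 1, velocity γ t + δ • deriv g t • e ≠ 0 := by
    intro δ hδ t ht hz
    have h2 : ‖velocity γ t‖ = |δ| * ‖deriv g t • e‖ := by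
      rw [← Real.norm_eq_abs, ← norm_smul, ← norm_neg (δ • _), ← eq_neg_of_add_eq_zero_left hz]
    have h3 : |δ| * ‖deriv g t • e‖ ≤ d * C :=
      mul_le_mul (abs_le.2 hδ) (hC t ht) (norm_nonneg _) hdpos.le
    have h4 : d * C < L := by
      rw [hd, div_mul_eq_mul_div, div_lt_iff₀ (by positivity)]
      nlinarith
    rw [hn t ht] at h2
    linarith
  let σ : ℝ → ℝ → Plane := fun δ t => γ t + δ • g t • e
  have hσ : ∀ δ, ContDiffOn ℝ ∞ (σ δ) (Icc 0 1) := fun δ =>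
    hs.add ((hg.smul contDiff_const).const_smul δ).contDiffOn
  have hσv : ∀ δ, ∀ t ∈ Icc (0 : ℝ) 1, velocity (σ δ) t = velocity γ t + δ • deriv g t • e := by
    intro δ t ht
    refine velocity_eq ht ((hasDerivWithinAt_velocity hs ht).add ?_)
    exact (((hg.differentiable (by simp) t).hasDerivAt.smul_const e).const_smul δ).hasDerivWithinAt
  have hσa : ∀ δ, ∀ t ∈ Icc (0 : ℝ) 1,
      acceleration (σ δ) t = acceleration γ t + δ • deriv (deriv g) t • e := by
    intro δ t ht
    refine acceleration_eq ht (hσv δ) ((hasDerivWithinAt_acceleration hs ht).add ?_)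
    exact (((hgs.differentiable (by simp) t).hasDerivAt.smul_const e).const_smul δ).hasDerivWithinAt
  have hE : ∀ δ ∈ Icc (-d) d, energy ε (σ δ) = ∫ t in (0 : ℝ)..1, energyDensity ε
      (velocity γ t + δ • deriv g t • e) (acceleration γ t + δ • deriv (deriv g) t • e) := by
    intro δ hδ
    rw [energy_eq_integral ε (hσ δ) fun t ht => hσv δ t ht ▸ hreg δ hδ t ht]
    refine intervalIntegral.integral_congr fun t ht => ?_
    rw [uIcc_of_le zero_le_one] at ht
    simp only [hσv δ t ht, hσa δ t ht]
  have hcv := (contDiffOn_plane.1 (contDiffOn_velocity hs))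
  have hca := (contDiffOn_plane.1 (contDiffOn_acceleration hs))
  set S : Set (ℝ × ℝ) := Icc (-d) d ×ˢ Icc 0 1
  have hmaps : MapsTo (Prod.snd : ℝ × ℝ → ℝ) S (Icc 0 1) := fun z hz => hz.2
  have hpv : ContinuousOn (fun z : ℝ × ℝ => velocity γ z.2 + z.1 • deriv g z.2 • e) S :=
    ((contDiffOn_velocity hs).continuousOn.comp continuousOn_snd hmaps).add
      (continuous_fst.smul ((hgs.continuous.comp continuous_snd).smul
        continuous_const)).continuousOn
  have hpa : ContinuousOn
      (fun z : ℝ × ℝ => acceleration γ z.2 + z.1 • deriv (deriv g) z.2 • e) S :=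
    ((contDiffOn_acceleration hs).continuousOn.comp continuousOn_snd hmaps).add
      (continuous_fst.smul ((hgs'.continuous.comp continuous_snd).smul
        continuous_const)).continuousOn
  have hpw : ContinuousOn (fun z : ℝ × ℝ => deriv g z.2 • e) S :=
    ((hgs.continuous.comp continuous_snd).smul continuous_const).continuousOn
  have hpb : ContinuousOn (fun z : ℝ × ℝ => deriv (deriv g) z.2 • e) S :=
    ((hgs'.continuous.comp continuous_snd).smul continuous_const).continuousOn
  have hnz : ∀ z ∈ S, ‖velocity γ z.2 + z.1 • deriv g z.2 • e‖ ≠ 0 := fun z hz =>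
    norm_ne_zero_iff.2 (hreg z.1 hz.1 z.2 hz.2)
  have hcont : ContinuousOn (fun z : ℝ × ℝ => energyDensity ε
      (velocity γ z.2 + z.1 • deriv g z.2 • e)
      (acceleration γ z.2 + z.1 • deriv (deriv g) z.2 • e)) S := by
    refine (continuousOn_const.mul (ContinuousOn.div ?_ (hpv.norm.pow 5) fun z hz =>
      pow_ne_zero 5 (hnz z hz))).add hpv.norm
    exact (((continuousOn_coord 0 hpv).mul (continuousOn_coord 1 hpa)).sub ((continuousOn_coord 1 hpv).mul (continuousOn_coord 0 hpa))).pow 2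
  have hcont' := continuousOn_energyDensityDeriv ε hpv hpa hpw hpb fun z hz =>
    hreg z.1 hz.1 z.2 hz.2
  have hder := hasDerivAt_integral_of_continuousOn hdpos
    (F := fun δ t => energyDensity ε (velocity γ t + δ • deriv g t • e)
      (acceleration γ t + δ • deriv (deriv g) t • e))
    (fun δ hδ => hcont.comp (f := fun t => (δ, t)) (by fun_prop)
      fun t ht => ⟨Ioo_subset_Icc_self hδ, ht⟩) hcont'
    (fun δ hδ t ht => hasDerivAt_energyDensity ε (hreg δ (Ioo_subset_Icc_self hδ) t ht))
  have hmin : IsLocalMin (fun δ : ℝ => ∫ t in (0 : ℝ)..1, energyDensity ε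
      (velocity γ t + δ • deriv g t • e) (acceleration γ t + δ • deriv (deriv g) t • e)) 0 := by
    filter_upwards [Icc_mem_nhds (neg_lt_zero.2 hdpos) hdpos] with δ hδ
    rw [← hE δ hδ, ← hE 0 ⟨by linarith, hdpos.le⟩]
    have hz : σ 0 = γ := by funext t; simp [σ]
    rw [hz]
    refine hγ.energy_le (hσ δ) (fun t ht => hσv δ t ht ▸ hreg δ hδ t ht) ?_ ?_ ?_ ?_
    · simp [σ, hg0, h0]
    · simp [σ, hg1, h1]
    · rw [hσv δ 0 (by simp), hg0', zero_smul, smul_zero, add_zero, hn 0 (by simp), hv0]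
    · rw [hσv δ 1 (by simp), hg1', zero_smul, smul_zero, add_zero, hn 1 (by simp), hv1]
  simpa using hmin.hasDerivAt_eq_zero hder

/-- Tangential angle description of an admissible curve in terms of the velocity. -/
theorem acceleration_of_angle {L : ℝ} {γ : ℝ → Plane} {ϑ : ℝ → ℝ}
    (hϑ : ContDiffOn ℝ ∞ ϑ (Icc 0 1))
    (hv : ∀ t ∈ Icc (0 : ℝ) 1, velocity γ t = L • dir (ϑ t)) {t : ℝ} (ht : t ∈ Icc (0 : ℝ) 1) :
    acceleration γ t = !₂[-(L * Real.sin (ϑ t) * derivWithin ϑ (Icc 0 1) t),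
      L * Real.cos (ϑ t) * derivWithin ϑ (Icc 0 1) t] := by
  have h := hasDerivWithinAt_of_smooth hϑ ht
  refine acceleration_eq ht hv (hasDerivWithinAt_plane.2 ⟨?_, ?_⟩)
  · refine (h.cos.const_mul L).congr_deriv ?_
    simp
    ring
  · refine (h.sin.const_mul L).congr_deriv ?_
    simp
    ring

/-- Fundamental lemma of the calculus of variations; continuity carries the conclusion from almost
everywhere to every point, endpoints included. -/
theorem eq_zero_of_integral_mul_eq_zero {f : ℝ → ℝ} (hf : ContinuousOn f (Icc 0 1))
    (h : ∀ g : ℝ → ℝ, ContDiff ℝ ∞ g → tsupport g ⊆ Ioo 0 1 →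
      ∫ t in (0 : ℝ)..1, g t * f t = 0) : ∀ t ∈ Icc (0 : ℝ) 1, f t = 0 := by
  have hae := isOpen_Ioo.ae_eq_zero_of_integral_contDiff_smul_eq_zero (μ := MeasureTheory.volume)
    (U := Ioo (0 : ℝ) 1) (f := f)
    ((hf.mono Ioo_subset_Icc_self).locallyIntegrableOn measurableSet_Ioo) fun g hg _ hsupp => by
      have h1 := h g hg hsupp
      rw [intervalIntegral.integral_of_le zero_le_one] at h1
      rw [← h1]
      refine (MeasureTheory.setIntegral_eq_integral_of_forall_compl_eq_zero fun t ht => ?_).symm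
      have : t ∉ tsupport g := fun h2 => ht (Ioo_subset_Ioc_self (hsupp h2))
      rw [image_eq_zero_of_notMem_tsupport this, zero_smul]
  have hae' : f =ᵐ[MeasureTheory.volume.restrict (Icc (0 : ℝ) 1)] fun _ => 0 := by
    rw [← MeasureTheory.Measure.restrict_congr_set MeasureTheory.Ioo_ae_eq_Icc]
    exact (MeasureTheory.ae_restrict_iff' measurableSet_Ioo).2 hae
  exact MeasureTheory.Measure.eqOn_Icc_of_ae_eq _ zero_ne_one hae' hf continuousOn_const

/-- Euler-Lagrange equations of a minimizer, in terms of the tangential angle: conservation of the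
vector multiplier `(p, q)`. -/
theorem IsMinimizer.exists_multiplier {ε θ₀ θ₁ l : ℝ} {γ : ℝ → Plane}
    (hγ : IsMinimizer ε θ₀ θ₁ l γ) {ϑ : ℝ → ℝ} (hϑ : ContDiffOn ℝ ∞ ϑ (Icc 0 1))
    (hv : ∀ t ∈ Icc (0 : ℝ) 1, velocity γ t = length γ • dir (ϑ t)) :
    ∃ p q : ℝ, ∀ t ∈ Icc (0 : ℝ) 1,
      (ε / length γ) ^ 2 * derivWithin ϑ (Icc 0 1) t ^ 2 =
        1 - p * Real.cos (ϑ t) - q * Real.sin (ϑ t) ∧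
      2 * (ε / length γ) ^ 2 * derivWithin (derivWithin ϑ (Icc 0 1)) (Icc 0 1) t =
        p * Real.sin (ϑ t) - q * Real.cos (ϑ t) := by
  have hL : 0 < length γ := hγ.1.2.1
  have hn := hγ.1.2.2.1
  set L := length γ
  set k := (ε / L) ^ 2 with hk
  set w := derivWithin ϑ (Icc 0 1)
  set w' := derivWithin w (Icc 0 1)
  have hw : ContDiffOn ℝ ∞ w (Icc 0 1) := contDiffOn_derivWithin_of_smooth hϑ
  have hw' : ContDiffOn ℝ ∞ w' (Icc 0 1) := contDiffOn_derivWithin_of_smooth hw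
  -- Translation invariance of the energy: variations g (α, β) in a fixed direction give a
  -- conservation law, linear in (α, β). Its values for (1, 0) and (0, 1) are p and q.
  have key : ∀ α β : ℝ, ∃ r : ℝ, ∀ t ∈ Icc (0 : ℝ) 1,
      (α * Real.cos (ϑ t) + β * Real.sin (ϑ t)) * (1 - k * w t ^ 2)
        - 2 * k * w' t * (β * Real.cos (ϑ t) - α * Real.sin (ϑ t)) = r := by
    intro α β
    have hc : ContDiffOn ℝ ∞ (fun t => α * Real.cos (ϑ t) + β * Real.sin (ϑ t)) (Icc 0 1) :=
      (contDiffOn_const.mul hϑ.cos).add (contDiffOn_const.mul hϑ.sin)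
    have hs : ContDiffOn ℝ ∞ (fun t => β * Real.cos (ϑ t) - α * Real.sin (ϑ t)) (Icc 0 1) :=
      (contDiffOn_const.mul hϑ.cos).sub (contDiffOn_const.mul hϑ.sin)
    set A : ℝ → ℝ := fun t => (α * Real.cos (ϑ t) + β * Real.sin (ϑ t)) * (1 - k * w t ^ 2)
        - 2 * k * w' t * (β * Real.cos (ϑ t) - α * Real.sin (ϑ t)) with hAdef
    have hA : ContDiffOn ℝ ∞ A (Icc 0 1) :=
      (hc.mul (contDiffOn_const.sub (contDiffOn_const.mul (hw.pow 2)))).sub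
        ((contDiffOn_const.mul hw').mul hs)
    have hA' := contDiffOn_derivWithin_of_smooth hA
    have hzero := eq_zero_of_integral_mul_eq_zero hA'.continuousOn fun g hg hsupp => by
      have hgs : ContDiff ℝ ∞ (deriv g) := (contDiff_infty_iff_deriv.1 hg).2
      have hgs' : ContDiff ℝ ∞ (deriv (deriv g)) := (contDiff_infty_iff_deriv.1 hgs).2
      have hout : ∀ t, t ∉ Ioo (0 : ℝ) 1 → g t = 0 ∧ deriv g t = 0 := fun t ht =>
        ⟨image_eq_zero_of_notMem_tsupport fun h => ht (hsupp h),
          image_eq_zero_of_notMem_tsupport fun h => ht (hsupp (tsupport_deriv_subset h))⟩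
      obtain ⟨hg0, hg0'⟩ := hout 0 (by simp)
      obtain ⟨hg1, hg1'⟩ := hout 1 (by simp)
      have hvar := hγ.integral_energyDensityDeriv hg hg0 hg1 hg0' hg1' !₂[α, β]
      -- The boundary term of the integration by parts: Q' is the first variation density plus g A'.
      -- As Q vanishes at both ends and the first variation is zero, ∫ g A' = 0.
      let Q : ℝ → ℝ := fun t => 2 * k * w t * (β * Real.cos (ϑ t) - α * Real.sin (ϑ t)) * deriv g t
        + g t * A t
      have hQ : ∀ t ∈ Icc (0 : ℝ) 1, HasDerivWithinAt Q
          (energyDensityDeriv ε (velocity γ t) (acceleration γ t)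
            (deriv g t • !₂[α, β]) (deriv (deriv g) t • !₂[α, β])
            + g t * derivWithin A (Icc 0 1) t) (Icc 0 1) t := by
        intro t ht
        have h1 := hasDerivWithinAt_of_smooth hϑ ht
        have h2 := hasDerivWithinAt_of_smooth hw ht
        have hg' := (hg.differentiable (by simp) t).hasDerivAt.hasDerivWithinAt (s := Icc 0 1)
        have hg'' := (hgs.differentiable (by simp) t).hasDerivAt.hasDerivWithinAt (s := Icc 0 1)
        have h3 := (((h2.const_mul (2 * k)).mul ((h1.cos.const_mul β).sub
          (h1.sin.const_mul α))).mul hg'').add (hg'.mul (hasDerivWithinAt_of_smooth hA ht))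
        refine h3.congr_deriv ?_
        have hcs := Real.cos_sq_add_sin_sq (ϑ t)
        have hnorm : ‖L • dir (ϑ t)‖ = L := by
          rw [norm_smul, norm_dir, Real.norm_of_nonneg hL.le, mul_one]
        rw [acceleration_of_angle hϑ hv ht, hv t ht, energyDensityDeriv, hnorm]
        have hAt : A t = (α * Real.cos (ϑ t) + β * Real.sin (ϑ t)) * (1 - k * w t ^ 2)
          - 2 * k * w' t * (β * Real.cos (ϑ t) - α * Real.sin (ϑ t)) := rfl
        have e1 : derivWithin ϑ (Icc 0 1) t = w t := rfl
        have e2 : derivWithin w (Icc 0 1) t = w' t := rfl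
        simp only [PiLp.smul_apply, dir_zero, dir_one, smul_eq_mul, Matrix.cons_val_zero,
          Matrix.cons_val_one, Pi.sub_apply, Pi.mul_apply, hAt, e1, e2]
        generalize derivWithin A (Icc 0 1) t = B
        rw [show L * Real.cos (ϑ t) * (L * Real.cos (ϑ t) * w t) -
          L * Real.sin (ϑ t) * -(L * Real.sin (ϑ t) * w t) = L ^ 2 * w t by
            linear_combination L ^ 2 * w t * hcs, hk]
        have hL' := hL.ne'
        field_simp
        ring
      have hcontA : ContinuousOn (fun t => g t * derivWithin A (Icc 0 1) t) (Icc 0 1) :=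
        hg.continuous.continuousOn.mul hA'.continuousOn
      have hcontE : ContinuousOn (fun t => energyDensityDeriv ε (velocity γ t) (acceleration γ t)
            (deriv g t • !₂[α, β]) (deriv (deriv g) t • !₂[α, β])) (Icc 0 1) := by
        refine continuousOn_energyDensityDeriv ε (contDiffOn_velocity hγ.1.1).continuousOn
          (contDiffOn_acceleration hγ.1.1).continuousOn
          (hgs.continuous.smul continuous_const).continuousOn
          (hgs'.continuous.smul continuous_const).continuousOn fun t ht => ?_
        rw [← norm_ne_zero_iff, hn t ht]
        exact hL.ne'
      have hint := intervalIntegral_eq_sub_Icc zero_le_one hQ (hcontE.add hcontA)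
      rw [intervalIntegral.integral_add, hvar, zero_add] at hint
      · rw [hint]; simp [Q, hg0, hg1, hg0', hg1']
      · exact (hcontE.mono (by rw [uIcc_of_le zero_le_one])).intervalIntegrable
      · exact (hcontA.mono (by rw [uIcc_of_le zero_le_one])).intervalIntegrable
    refine ⟨A 0, constant_unit fun t ht => ?_⟩
    have := hasDerivWithinAt_of_smooth hA ht
    rwa [hzero t ht] at this
  obtain ⟨p, hp⟩ := key 1 0
  obtain ⟨q, hq⟩ := key 0 1
  refine ⟨p, q, fun t ht => ?_⟩
  have h1 := hp t ht
  have h2 := hq t ht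
  have hcs := Real.cos_sq_add_sin_sq (ϑ t)
  rw [← h1, ← h2]
  constructor
  · linear_combination (1 - k * w t ^ 2) * hcs
  · linear_combination (- 2 * k * w' t) * hcs

/-! ### Rescaled elastica profiles of minimizers. -/

/-- Tangential angle `ϑ` and curvature `κ` of an elastica on `[0,T]` with multiplier `(p, q)`. -/
structure Profile (T p q : ℝ) (ϑ κ : ℝ → ℝ) : Prop where
  pos : 0 < T
  angle : ∀ s ∈ Icc 0 T, HasDerivWithinAt ϑ (κ s) (Icc 0 T) s
  curv : ∀ s ∈ Icc 0 T,
    HasDerivWithinAt κ ((p * Real.sin (ϑ s) - q * Real.cos (ϑ s)) / 2) (Icc 0 T) s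
  sq : ∀ s ∈ Icc 0 T, κ s ^ 2 = 1 - p * Real.cos (ϑ s) - q * Real.sin (ϑ s)

/-- Energy of a profile beyond the horizontal extent of the curve. -/
noncomputable def excess (T : ℝ) (ϑ κ : ℝ → ℝ) : ℝ :=
  ∫ s in (0 : ℝ)..T, (κ s ^ 2 + (1 - Real.cos (ϑ s)))

/-- At constant speed the arc length is t ↦ t L, which is injective, so the chosen inverse is s ↦
s/L. -/
theorem arcLengthParam_eq {γ : ℝ → Plane} (hL : 0 < length γ)
    (hn : ∀ t ∈ Icc (0 : ℝ) 1, ‖velocity γ t‖ = length γ) {s : ℝ} (hs : s ∈ Icc 0 (length γ)) :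
    arcLengthParam γ s = γ (s / length γ) := by
  have harc : ∀ t ∈ Icc (0 : ℝ) 1, arcLength γ t = t * length γ := fun t ht => by
    rw [arcLength, intervalIntegral.integral_congr (g := fun _ => length γ)]
    · simp
    · intro τ hτ
      rw [uIcc_of_le ht.1] at hτ
      exact hn τ ⟨hτ.1, hτ.2.trans ht.2⟩
  have hinj : InjOn (arcLength γ) (Icc 0 1) := fun a ha b hb hab => by
    rw [harc a ha, harc b hb] at hab
    exact mul_right_cancel₀ hL.ne' hab
  have hmem : s / length γ ∈ Icc (0 : ℝ) 1 :=
    ⟨div_nonneg hs.1 hL.le, (div_le_one hL).2 hs.2⟩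
  have h := hinj.leftInvOn_invFunOn hmem
  rw [harc _ hmem, div_mul_cancel₀ _ hL.ne'] at h
  rw [arcLengthParam, h]

theorem HasDerivWithinAt.comp_div {E : Type*} [NormedAddCommGroup E] [NormedSpace ℝ E] {f : ℝ → E}
    {f' : E} {T s : ℝ} (hT : 0 < T) (hf : HasDerivWithinAt f f' (Icc 0 1) (s / T)) :
    HasDerivWithinAt (fun s => f (s / T)) (T⁻¹ • f') (Icc 0 T) s := by
  have h : HasDerivWithinAt (fun s : ℝ => s / T) T⁻¹ (Icc 0 T) s := by
    simpa using (hasDerivAt_id s).div_const T |>.hasDerivWithinAt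
  have hm : MapsTo (fun s : ℝ => s / T) (Icc 0 T) (Icc 0 1) := fun x hx => ⟨div_nonneg hx.1 hT.le, (div_le_one hT).2 hx.2⟩
  exact hf.scomp s h hm

/-- In the variable s ∈ [0, L/ε] the factor (ε/L)² disappears from the Euler-Lagrange equations. The
energy formula holds because ∫ cos ϑ is the horizontal displacement l/ε, so subtracting it from the
length leaves ∫ (1 − cos ϑ). -/
theorem IsMinimizer.exists_profile {ε θ₀ θ₁ l : ℝ} {γ : ℝ → Plane} (hε : 0 < ε)
    (hγ : IsMinimizer ε θ₀ θ₁ l γ) :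
    ∃ (p q : ℝ) (ϑ κ : ℝ → ℝ), Profile (length γ / ε) p q ϑ κ ∧ ϑ 0 = θ₀ ∧
      dir (ϑ (length γ / ε)) = dir θ₁ ∧
      (∀ s ∈ Icc 0 (length γ / ε),
        HasDerivWithinAt (rescaled ε γ) (dir (ϑ s)) (Icc 0 (length γ / ε)) s) ∧
      rescaled ε γ 0 = 0 ∧ rescaled ε γ (length γ / ε) = !₂[l / ε, 0] ∧
      energy ε γ = l + ε * excess (length γ / ε) ϑ κ ∧
      ∀ s ∈ Icc 0 (length γ),
        derivWithin (arcLengthParam γ) (Icc 0 (length γ)) s = dir (ϑ (s / ε)) := by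
  obtain ⟨ϑ, hϑ, hϑ0, hv, hϑ1⟩ := exists_angle hγ.1
  obtain ⟨p, q, hpq⟩ := hγ.exists_multiplier hϑ hv
  obtain ⟨⟨hs, hL, hn, h0, -, h1, -⟩, -⟩ := hγ
  set L := length γ with hLdef
  set w := derivWithin ϑ (Icc 0 1)
  have hw : ContDiffOn ℝ ∞ w (Icc 0 1) := contDiffOn_derivWithin_of_smooth hϑ
  set T := L / ε with hT
  have hTpos : 0 < T := div_pos hL hε
  have hdiv : ∀ s ∈ Icc 0 T, s / T ∈ Icc (0 : ℝ) 1 := fun s hs =>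
    ⟨div_nonneg hs.1 hTpos.le, (div_le_one hTpos).2 hs.2⟩
  have hangle : ∀ s ∈ Icc 0 T, HasDerivWithinAt (fun s => ϑ (s / T)) (w (s / T) / T) (Icc 0 T) s :=
    fun s hs => ((hasDerivWithinAt_of_smooth hϑ (hdiv s hs)).comp_div hTpos).congr_deriv (by
      exact (div_eq_inv_mul _ _).symm)
  have hresc : EqOn (rescaled ε γ) (fun s => ε⁻¹ • γ (s / T)) (Icc 0 T) := fun s hs => by
    have : ε * s ∈ Icc 0 L := ⟨mul_nonneg hε.le hs.1, by
      have := (le_div_iff₀ hε).1 hs.2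
      linarith⟩
    rw [rescaled, arcLengthParam_eq hL hn this, ← hLdef, hT, mul_comm ε s, ← div_div_eq_mul_div]
  have hrd : ∀ s ∈ Icc 0 T,
      HasDerivWithinAt (rescaled ε γ) (dir (ϑ (s / T))) (Icc 0 T) s := fun s hs' => by
    have := ((hasDerivWithinAt_velocity hs (hdiv s hs')).comp_div hTpos).const_smul ε⁻¹
    refine (this.congr hresc (hresc hs')).congr_deriv ?_
    rw [hv _ (hdiv s hs'), smul_smul, smul_smul, hT]
    rw [show ε⁻¹ * (L / ε)⁻¹ * L = 1 by field_simp, one_smul]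
  have hr0 : rescaled ε γ 0 = 0 := by
    rw [hresc ⟨le_rfl, hTpos.le⟩]
    exact plane_ext (by simp [h0]) (by simp [h0])
  have hr1 : rescaled ε γ T = !₂[l / ε, 0] := by
    rw [hresc ⟨hTpos.le, le_rfl⟩]
    simp only [div_self hTpos.ne', h1]
    exact plane_ext (by simp; ring) (by simp)
  have hk : ∀ x : ℝ, (x / T) ^ 2 = (ε / L) ^ 2 * x ^ 2 := fun x => by rw [hT]; field_simp
  refine ⟨p, q, fun s => ϑ (s / T), fun s => w (s / T) / T, ⟨hTpos, hangle, fun s hs => ?_,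
    fun s hs => ?_⟩, by simp [hϑ0], by simp [div_self hTpos.ne', hϑ1], hrd, hr0, hr1, ?_, ?_⟩
  · have h2 := ((hasDerivWithinAt_of_smooth hw (hdiv s hs)).comp_div hTpos).div_const T
    refine h2.congr_deriv ?_
    rw [← (hpq _ (hdiv s hs)).2, smul_eq_mul, hT]
    field_simp
  · simp only [hk]
    exact (hpq _ (hdiv s hs)).1
  · have hcϑ : ContinuousOn (fun s => ϑ (s / T)) (Icc 0 T) := fun s hs =>
      (hangle s hs).continuousWithinAt
    have hccos : ContinuousOn (fun s => Real.cos (ϑ (s / T))) (Icc 0 T) :=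
      Real.continuous_cos.comp_continuousOn hcϑ
    have hcw : ContinuousOn (fun s => w (s / T)) (Icc 0 T) :=
      hw.continuousOn.comp (by fun_prop) hdiv
    have hcos : ∫ s in (0 : ℝ)..T, Real.cos (ϑ (s / T)) = l / ε := by
      have := intervalIntegral_eq_sub_Icc hTpos.le
        (fun s hs => (hasDerivWithinAt_plane.1 (hrd s hs)).1) hccos
      rw [hr0, hr1] at this
      simpa using this
    rw [← uIcc_of_le hTpos.le] at hccos hcw
    have hreg : ∀ t ∈ Icc (0 : ℝ) 1, velocity γ t ≠ 0 := fun t ht => by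
      rw [← norm_ne_zero_iff, hn t ht]; exact hL.ne'
    have hE : energy ε γ = ∫ t in (0 : ℝ)..1, L * ((w t / T) ^ 2 + 1) := by
      rw [energy_eq_integral ε hs hreg]
      refine intervalIntegral.integral_congr fun t ht => ?_
      rw [uIcc_of_le zero_le_one] at ht
      simp only [energyDensity]
      rw [hn t ht, hv t ht, acceleration_of_angle hϑ hv ht, hk]
      have hcs := Real.cos_sq_add_sin_sq (ϑ t)
      have e : derivWithin ϑ (Icc 0 1) t = w t := rfl
      simp only [PiLp.smul_apply, dir_zero, dir_one, smul_eq_mul, Matrix.cons_val_zero,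
          Matrix.cons_val_one, e]
      rw [show L * Real.cos (ϑ t) * (L * Real.cos (ϑ t) * w t) -
          L * Real.sin (ϑ t) * -(L * Real.sin (ϑ t) * w t) = L ^ 2 * w t by
            linear_combination L ^ 2 * w t * hcs]
      field_simp
    have hsub := intervalIntegral.integral_comp_div (a := 0) (b := T)
      (fun t => L * ((w t / T) ^ 2 + 1)) hTpos.ne'
    rw [zero_div, div_self hTpos.ne', ← hE, intervalIntegral.integral_const_mul, smul_eq_mul] at hsub
    have hE2 : energy ε γ = ε * ∫ s in (0 : ℝ)..T, ((w (s / T) / T) ^ 2 + 1) := by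
      have : T * energy ε γ = T * (ε * ∫ s in (0 : ℝ)..T, ((w (s / T) / T) ^ 2 + 1)) := by
        rw [← hsub, ← mul_assoc, hT, div_mul_cancel₀ _ hε.ne']
      exact mul_left_cancel₀ hTpos.ne' this
    have hE3 : ∫ s in (0 : ℝ)..T, ((w (s / T) / T) ^ 2 + 1) =
        excess T (fun s => ϑ (s / T)) (fun s => w (s / T) / T) + l / ε := by
      rw [excess, ← hcos, ← intervalIntegral.integral_add]
      · refine intervalIntegral.integral_congr fun s _ => ?_
        ring
      · exact (((hcw.div_const T).pow 2).add (continuousOn_const.sub hccos)).intervalIntegrable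
      · exact hccos.intervalIntegrable
    rw [hE2, hE3]
    field_simp
    ring
  · intro s hs'
    have heq : EqOn (arcLengthParam γ) (fun s => γ (s / L)) (Icc 0 L) := fun s hs =>
      arcLengthParam_eq hL hn hs
    have hm : s / L ∈ Icc (0 : ℝ) 1 := ⟨div_nonneg hs'.1 hL.le, (div_le_one hL).2 hs'.2⟩
    have := ((hasDerivWithinAt_velocity hs hm).comp_div hL).congr heq (heq hs')
    rw [this.derivWithin (uniqueDiffOn_Icc hL s hs'), hv _ hm, smul_smul, inv_mul_cancel₀ hL.ne',
      one_smul, hT]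
    congr 2
    field_simp

/-! ### A competitor with prescribed boundary layers. -/

/-- A smooth step from `0` to `1`, constant near `[0,1/3]` and near `[2/3,1]`. -/
noncomputable def step (t : ℝ) : ℝ := Real.smoothTransition (5 * t - 2)

theorem contDiff_step : ContDiff ℝ ∞ step := by
  unfold step
  exact Real.smoothTransition.contDiff.comp (by fun_prop)

theorem step_eventuallyEq_zero {t : ℝ} (ht : t < 2 / 5) : step =ᶠ[𝓝 t] fun _ => 0 := by
  filter_upwards [Iio_mem_nhds ht] with x hx
  exact Real.smoothTransition.zero_of_nonpos (by linarith [mem_Iio.1 hx])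

theorem step_eventuallyEq_one {t : ℝ} (ht : 3 / 5 < t) : step =ᶠ[𝓝 t] fun _ => 1 := by
  filter_upwards [Ioi_mem_nhds ht] with x hx
  exact Real.smoothTransition.one_of_one_le (by linarith [mem_Ioi.1 hx])

theorem deriv_step_eq_zero {t : ℝ} (ht : t < 2 / 5 ∨ 3 / 5 < t) :
    deriv step t = 0 ∧ deriv (deriv step) t = 0 := by
  rcases ht with ht | ht
  · have h := (step_eventuallyEq_zero ht).deriv
    have h2 := h.deriv
    exact ⟨by simpa using h.eq_of_nhds, by simpa using h2.eq_of_nhds⟩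
  · have h := (step_eventuallyEq_one ht).deriv
    have h2 := h.deriv
    exact ⟨by simpa using h.eq_of_nhds, by simpa using h2.eq_of_nhds⟩

theorem exists_bound_deriv_step : ∃ K : ℝ, 0 ≤ K ∧ ∀ t ∈ Icc (0 : ℝ) 1,
    deriv step t ^ 2 ≤ K ∧ deriv (deriv step) t ^ 2 ≤ K := by
  have h1 : ContDiff ℝ ∞ (deriv step) := (contDiff_infty_iff_deriv.1 contDiff_step).2
  have h2 : ContDiff ℝ ∞ (deriv (deriv step)) := (contDiff_infty_iff_deriv.1 h1).2
  obtain ⟨K1, hK1⟩ := (isCompact_Icc (a := (0 : ℝ)) (b := 1)).exists_bound_of_continuousOn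
    (h1.continuous.pow 2).continuousOn
  obtain ⟨K2, hK2⟩ := (isCompact_Icc (a := (0 : ℝ)) (b := 1)).exists_bound_of_continuousOn
    (h2.continuous.pow 2).continuousOn
  refine ⟨max K1 K2, ((norm_nonneg _).trans (hK1 0 (by simp))).trans (le_max_left _ _),
    fun t ht => ⟨?_, ?_⟩⟩
  · exact ((le_abs_self _).trans (hK1 t ht)).trans (le_max_left _ _)
  · exact ((le_abs_self _).trans (hK2 t ht)).trans (le_max_right _ _)

/-- Energy of a boundary layer with tangential angle `A`. -/
noncomputable def layerDensity (A : ℝ → ℝ) (t : ℝ) : ℝ := deriv A t ^ 2 + (1 - Real.cos (A t))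

theorem deriv_eq_zero_of_tail {A : ℝ → ℝ} {M : ℝ} (hA : ∀ t, M ≤ t → A t = 0) {t : ℝ}
    (ht : M < t) : deriv A t = 0 := by
  have h : A =ᶠ[𝓝 t] fun _ => 0 := by
    filter_upwards [Ioi_mem_nhds ht] with x hx using hA x (le_of_lt hx)
  simpa using h.deriv.eq_of_nhds

theorem layerDensity_eq_zero {A : ℝ → ℝ} {M : ℝ} (hA : ∀ t, M ≤ t → A t = 0) {t : ℝ}
    (ht : M < t) : layerDensity A t = 0 := by
  rw [layerDensity, deriv_eq_zero_of_tail hA ht, hA t ht.le]; simp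

theorem continuous_layerDensity {A : ℝ → ℝ} (hA : ContDiff ℝ ∞ A) :
    Continuous (layerDensity A) := by
  have h1 : ContDiff ℝ ∞ (deriv A) := (contDiff_infty_iff_deriv.1 hA).2
  exact (h1.continuous.pow 2).add (continuous_const.sub (Real.continuous_cos.comp hA.continuous))

theorem integral_tail {f : ℝ → ℝ} (hf : Continuous f) {M T : ℝ} (hMT : M ≤ T)
    (h : ∀ t, M < t → f t = 0) :
    ∫ t in (0 : ℝ)..T, f t = ∫ t in (0 : ℝ)..M, f t := by
  rw [← intervalIntegral.integral_add_adjacent_intervals (hf.intervalIntegrable 0 M)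
    (hf.intervalIntegrable M T)]
  rw [intervalIntegral.integral_congr_ae (a := M) (b := T) (g := fun _ => 0)]
  · simp
  · refine Eventually.of_forall fun t ht => ?_
    rw [uIoc_of_le hMT] at ht
    exact h t ht.1

theorem integral_add_of_continuous {f g : ℝ → ℝ} (hf : Continuous f) (hg : Continuous g)
    (a b : ℝ) : ∫ t in a..b, (f t + g t) = (∫ t in a..b, f t) + ∫ t in a..b, g t :=
  intervalIntegral.integral_add (hf.intervalIntegrable _ _) (hg.intervalIntegrable _ _)

section Competitor

variable (A B : ℝ → ℝ) (T β : ℝ)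

/-- Velocity of the competitor: layers `A` and `B` at the ends, of vertical displacement `β` in the
middle. -/
noncomputable def compVel (t : ℝ) : Plane :=
  !₂[Real.cos (A t) + Real.cos (B (T - t)) - 1,
    Real.sin (A t) + Real.sin (B (T - t)) + β / T * deriv step (t / T)]

/-- Derivative of the velocity of the competitor. -/
noncomputable def compAcc (t : ℝ) : Plane :=
  !₂[-Real.sin (A t) * deriv A t + Real.sin (B (T - t)) * deriv B (T - t),
    Real.cos (A t) * deriv A t - Real.cos (B (T - t)) * deriv B (T - t)
      + β / T ^ 2 * deriv (deriv step) (t / T)]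

variable {A B T β}

theorem contDiff_compVel (hA : ContDiff ℝ ∞ A) (hB : ContDiff ℝ ∞ B) :
    ContDiff ℝ ∞ (compVel A B T β) := by
  have h1 : ContDiff ℝ ∞ (deriv step) := (contDiff_infty_iff_deriv.1 contDiff_step).2
  have hB' : ContDiff ℝ ∞ fun t => B (T - t) := hB.comp (contDiff_const.sub contDiff_id)
  have hS : ContDiff ℝ ∞ fun t => deriv step (t / T) := h1.comp (contDiff_id.div_const T)
  refine contDiff_plane.2 ⟨?_, ?_⟩
  · exact (hA.cos.add hB'.cos).sub contDiff_const
  · exact (hA.sin.add hB'.sin).add (contDiff_const.mul hS)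

theorem hasDerivAt_compVel (hA : ContDiff ℝ ∞ A) (hB : ContDiff ℝ ∞ B) (t : ℝ) :
    HasDerivAt (compVel A B T β) (compAcc A B T β t) t := by
  have h1 : ContDiff ℝ ∞ (deriv step) := (contDiff_infty_iff_deriv.1 contDiff_step).2
  have hA' := (hA.differentiable (by simp) t).hasDerivAt
  have hB' : HasDerivAt (fun t => B (T - t)) (-deriv B (T - t)) t := by
    have := (hB.differentiable (by simp) (T - t)).hasDerivAt.comp t ((hasDerivAt_id t).const_sub T)
    rw [mul_neg_one] at this
    exact this
  have hS : HasDerivAt (fun t => deriv step (t / T)) (deriv (deriv step) (t / T) * (1 / T)) t :=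
    HasDerivAt.comp t (h₂ := deriv step) (h := fun t => t / T)
      (h1.differentiable (by simp) (t / T)).hasDerivAt ((hasDerivAt_id t).div_const T)
  refine hasDerivAt_plane.2 ⟨?_, ?_⟩
  · refine ((hA'.cos.add hB'.cos).sub_const 1).congr_deriv ?_
    simp [compAcc]
  · refine ((hA'.sin.add hB'.sin).add (hS.const_mul (β / T))).congr_deriv ?_
    simp [compAcc]
    ring

theorem energyDensity_unit {v a : Plane} (hv : ‖v‖ = 1) :
    energyDensity 1 v a = (v 0 * a 1 - v 1 * a 0) ^ 2 + 1 := by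
  simp [energyDensity, hv]

/-- Since T > 3M, each layer lives in its own outer third and the vertical step in the middle third.
In the outer thirds the curve has unit speed and the energy density exceeds the horizontal velocity
exactly by the layer density. In the middle the velocity is (1, y) with y = O(β/T), and both √(1 +
y²) − 1 and the bending are O(β²/T²). -/
theorem compVel_bound {M K : ℝ} (hM : 1 ≤ M) (hT : 3 * M < T)
    (hA0 : ∀ t, M ≤ t → A t = 0) (hB0 : ∀ t, M ≤ t → B t = 0)
    (hK : ∀ t ∈ Icc (0 : ℝ) 1, deriv step t ^ 2 ≤ K ∧ deriv (deriv step) t ^ 2 ≤ K)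
    {t : ℝ} (ht : t ∈ Icc 0 T) :
    compVel A B T β t ≠ 0 ∧ energyDensity 1 (compVel A B T β t) (compAcc A B T β t) ≤
      compVel A B T β t 0 + layerDensity A t + layerDensity B (T - t)
        + 2 * β ^ 2 * K / T ^ 2 := by
  have hTpos : 0 < T := by linarith
  have hK0 : 0 ≤ K := (sq_nonneg _).trans (hK 0 (by simp)).1
  have hR : 0 ≤ 2 * β ^ 2 * K / T ^ 2 := by positivity
  rcases le_total t (T / 3) with h1 | h1
  · have hBz : B (T - t) = 0 := hB0 _ (by linarith)
    have hBz' : deriv B (T - t) = 0 := deriv_eq_zero_of_tail hB0 (by linarith)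
    have hS := deriv_step_eq_zero (t := t / T) (.inl (by rw [div_lt_iff₀ hTpos]; linarith))
    have hv : compVel A B T β t = dir (A t) :=
      plane_ext (by simp [compVel, hBz]) (by simp [compVel, hBz, hS.1])
    have hn : ‖compVel A B T β t‖ = 1 := by rw [hv, norm_dir]
    refine ⟨by rw [← norm_ne_zero_iff, hn]; exact one_ne_zero, ?_⟩
    rw [energyDensity_unit hn, hv, layerDensity, layerDensity, hBz, hBz']
    simp only [compAcc, hBz, hBz', hS.2, dir_zero, dir_one, PiLp.toLp_apply, Matrix.cons_val_zero,
      Matrix.cons_val_one, Real.cos_zero]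
    have hcs := Real.cos_sq_add_sin_sq (A t)
    have : (Real.cos (A t) * (Real.cos (A t) * deriv A t - 1 * 0 + β / T ^ 2 * 0) -
        Real.sin (A t) * (-Real.sin (A t) * deriv A t + Real.sin 0 * 0)) = deriv A t := by
      linear_combination deriv A t * hcs
    rw [this]
    linarith
  rcases le_total t (2 * T / 3) with h2 | h2
  · have hAz : A t = 0 := hA0 _ (by linarith)
    have hAz' : deriv A t = 0 := deriv_eq_zero_of_tail hA0 (by linarith)
    have hBz : B (T - t) = 0 := hB0 _ (by linarith)
    have hBz' : deriv B (T - t) = 0 := deriv_eq_zero_of_tail hB0 (by linarith)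
    have hv : compVel A B T β t = !₂[1, β / T * deriv step (t / T)] := by
      simp [compVel, hAz, hBz]
    have ha : compAcc A B T β t = !₂[0, β / T ^ 2 * deriv (deriv step) (t / T)] := by
      simp [compAcc, hAz, hBz, hAz', hBz']
    obtain ⟨hK1, hK2⟩ := hK (t / T) ⟨div_nonneg ht.1 hTpos.le, (div_le_one hTpos).2 ht.2⟩
    set y := β / T * deriv step (t / T)
    set z := β / T ^ 2 * deriv (deriv step) (t / T)
    have hy : y ^ 2 ≤ β ^ 2 * K / T ^ 2 := by
      rw [mul_pow, div_pow, div_mul_eq_mul_div]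
      gcongr
    have hz : z ^ 2 ≤ β ^ 2 * K / T ^ 2 := by
      rw [mul_pow, div_pow, div_mul_eq_mul_div]
      have hT1 : T ^ 2 ≤ (T ^ 2) ^ 2 := by
        have : 1 ≤ T ^ 2 := one_le_pow₀ (by linarith)
        nlinarith
      exact div_le_div₀ (by positivity) (by gcongr) (by positivity) hT1
    rw [hv, ha]
    have hsq : ‖(!₂[1, y] : Plane)‖ ^ 2 = 1 + y ^ 2 := by rw [plane_norm_sq]; simp
    have hn0 := norm_nonneg (!₂[1, y] : Plane)
    have hn1 : 1 ≤ ‖(!₂[1, y] : Plane)‖ := by nlinarith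
    have hn2 : ‖(!₂[1, y] : Plane)‖ ≤ 1 + y ^ 2 := by nlinarith
    refine ⟨by rw [← norm_pos_iff]; linarith, ?_⟩
    rw [energyDensity, layerDensity, layerDensity, hAz, hBz, hAz', hBz']
    simp only [Matrix.cons_val_zero, Matrix.cons_val_one, Real.cos_zero]
    have h5 : (1 * z - y * 0) ^ 2 / ‖(!₂[1, y] : Plane)‖ ^ 5 ≤ z ^ 2 := by
      rw [one_mul, mul_zero, sub_zero]
      exact div_le_self (sq_nonneg z) (one_le_pow₀ hn1)
    have : 2 * β ^ 2 * K / T ^ 2 = 2 * (β ^ 2 * K / T ^ 2) := by ring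
    linarith
  · have hAz : A t = 0 := hA0 _ (by linarith)
    have hAz' : deriv A t = 0 := deriv_eq_zero_of_tail hA0 (by linarith)
    have hS := deriv_step_eq_zero (t := t / T) (.inr (by rw [lt_div_iff₀ hTpos]; linarith))
    have hv : compVel A B T β t = dir (B (T - t)) :=
      plane_ext (by simp [compVel, hAz]) (by simp [compVel, hAz, hS.1])
    have hn : ‖compVel A B T β t‖ = 1 := by rw [hv, norm_dir]
    refine ⟨by rw [← norm_ne_zero_iff, hn]; exact one_ne_zero, ?_⟩
    rw [energyDensity_unit hn, hv, layerDensity, layerDensity, hAz, hAz']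
    simp only [compAcc, hAz, hAz', hS.2, dir_zero, dir_one, PiLp.toLp_apply, Matrix.cons_val_zero,
      Matrix.cons_val_one, Real.cos_zero]
    set b := B (T - t)
    set b' := deriv B (T - t)
    have hcs := Real.cos_sq_add_sin_sq b
    have : (Real.cos b * (1 * 0 - Real.cos b * b' + β / T ^ 2 * 0) -
        Real.sin b * (-Real.sin 0 * 0 + Real.sin b * b')) = -b' := by
      linear_combination -b' * hcs
    rw [this, neg_sq]
    linarith

end Competitor

theorem energyDensity_scale {ε T : ℝ} (hε : 0 < ε) (hT : 0 < T) {v a : Plane} (hv : v ≠ 0) :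
    energyDensity ε ((ε * T) • v) ((ε * T ^ 2) • a) = ε * T * energyDensity 1 v a := by
  have hn := (norm_pos_iff.2 hv).ne'
  simp only [energyDensity, norm_smul, PiLp.smul_apply, smul_eq_mul]
  rw [Real.norm_of_nonneg (by positivity)]
  field_simp

/-- Energy comparison with a curve having prescribed boundary layers. -/
theorem IsMinimizer.energy_le_layers : ∃ K : ℝ, 0 ≤ K ∧ ∀ {ε θ₀ θ₁ l M : ℝ} {γ : ℝ → Plane}
    {A B : ℝ → ℝ}, 0 < ε → IsMinimizer ε θ₀ θ₁ l γ → ContDiff ℝ ∞ A → ContDiff ℝ ∞ B →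
    A 0 = θ₀ → B 0 = θ₁ → 1 ≤ M → (∀ t, M ≤ t → A t = 0) → (∀ t, M ≤ t → B t = 0) →
    3 * M < l / ε → energy ε γ ≤ l + ε * ((∫ t in (0 : ℝ)..M, layerDensity A t)
      + (∫ t in (0 : ℝ)..M, layerDensity B t) + K * M ^ 2 / (l / ε)) := by
  obtain ⟨K, hK0, hK⟩ := exists_bound_deriv_step
  refine ⟨8 * K, by positivity, fun {ε θ₀ θ₁ l M γ A B} hε hγ hA hB hA0 hB0 hM hAM hBM hl => ?_⟩
  have hcA : Continuous fun t => Real.cos (A t) - 1 :=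
    (Real.continuous_cos.comp hA.continuous).sub continuous_const
  have hcB : Continuous fun t => Real.cos (B t) - 1 :=
    (Real.continuous_cos.comp hB.continuous).sub continuous_const
  have hsA : Continuous fun t => Real.sin (A t) := Real.continuous_sin.comp hA.continuous
  have hsB : Continuous fun t => Real.sin (B t) := Real.continuous_sin.comp hB.continuous
  have hM0 : 0 ≤ M := by linarith
  have hX : ∀ {C : ℝ → ℝ}, ContDiff ℝ ∞ C → ∫ t in (0 : ℝ)..M, (Real.cos (C t) - 1) ≤ 0 := by
    intro C hC
    rw [intervalIntegral.integral_of_le hM0]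
    exact MeasureTheory.integral_nonpos fun t => sub_nonpos.2 (Real.cos_le_one (C t))
  have hY : ∀ {C : ℝ → ℝ}, |∫ t in (0 : ℝ)..M, Real.sin (C t)| ≤ M := by
    intro C
    have := intervalIntegral.norm_integral_le_of_norm_le_const (a := 0) (b := M)
      (f := fun t => Real.sin (C t)) (C := 1) fun t _ => Real.abs_sin_le_one _
    simpa [abs_of_nonneg hM0] using this
  set XA := ∫ t in (0 : ℝ)..M, (Real.cos (A t) - 1) with hXA
  set XB := ∫ t in (0 : ℝ)..M, (Real.cos (B t) - 1) with hXB
  set YA := ∫ t in (0 : ℝ)..M, Real.sin (A t) with hYA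
  set YB := ∫ t in (0 : ℝ)..M, Real.sin (B t) with hYB
  -- The parameter length T makes up for the horizontal displacement lost in the layers, and β
  -- cancels their vertical displacement.
  set T := l / ε - XA - XB with hTdef
  set β := -(YA + YB) with hβdef
  have hTl : l / ε ≤ T := by
    have h1 := hX hA
    have h2 := hX hB
    rw [hTdef]
    linarith
  have hTM : 3 * M < T := hl.trans_le hTl
  have hTpos : 0 < T := by linarith
  have hβ : β ^ 2 ≤ 4 * M ^ 2 := by
    have h1 := abs_le.1 (hY (C := A))
    have h2 := abs_le.1 (hY (C := B))
    rw [hβdef, neg_sq]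
    have : |YA + YB| ≤ 2 * M := abs_le.2 ⟨by linarith [h1.1, h2.1], by linarith [h1.2, h2.2]⟩
    nlinarith [sq_abs (YA + YB), abs_nonneg (YA + YB)]
  set w := compVel A B T β with hw
  set w' := compAcc A B T β with hw'
  have hws : ContDiff ℝ ∞ w := contDiff_compVel hA hB
  have hww' : ∀ t, HasDerivAt w (w' t) t := hasDerivAt_compVel hA hB
  have hw's : Continuous w' := by
    have : w' = deriv w := by funext t; exact (hww' t).deriv.symm
    rw [this]
    exact (contDiff_infty_iff_deriv.1 hws).2.continuous
  have hc0 : ∀ {f : ℝ → Plane} (i : Fin 2), Continuous f → Continuous fun t => f t i :=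
    fun i hf => (EuclideanSpace.proj i : Plane →L[ℝ] ℝ).continuous.comp hf
  have hbound := fun t (ht : t ∈ Icc 0 T) => compVel_bound (β := β) hM hTM hAM hBM hK ht
  let x : ℝ → Plane := fun t => !₂[∫ τ in (0 : ℝ)..t, w τ 0, ∫ τ in (0 : ℝ)..t, w τ 1]
  have hx : ∀ t, HasDerivAt x (w t) t := fun t => hasDerivAt_plane.2
    ⟨((hc0 0 hws.continuous).integral_hasStrictDerivAt 0 t).hasDerivAt,
      ((hc0 1 hws.continuous).integral_hasStrictDerivAt 0 t).hasDerivAt⟩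
  have hxs : ContDiff ℝ ∞ x := by
    refine contDiff_infty_iff_deriv.2 ⟨fun t => (hx t).differentiableAt, ?_⟩
    have : deriv x = w := by funext t; exact (hx t).deriv
    rwa [this]
  have hx1 : x T = !₂[l / ε, 0] := by
    have hAint : ∫ t in (0 : ℝ)..T, (Real.cos (A t) - 1) = XA :=
      integral_tail hcA (by linarith) fun t ht => by simp [hAM t ht.le]
    have hBint : ∫ t in (0 : ℝ)..T, (Real.cos (B (T - t)) - 1) = XB := by
      rw [intervalIntegral.integral_comp_sub_left (fun t => Real.cos (B t) - 1) T, sub_self,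
        sub_zero]
      exact integral_tail hcB (by linarith) fun t ht => by simp [hBM t ht.le]
    have hAint' : ∫ t in (0 : ℝ)..T, Real.sin (A t) = YA :=
      integral_tail hsA (by linarith) fun t ht => by simp [hAM t ht.le]
    have hBint' : ∫ t in (0 : ℝ)..T, Real.sin (B (T - t)) = YB := by
      rw [intervalIntegral.integral_comp_sub_left (fun t => Real.sin (B t)) T, sub_self, sub_zero]
      exact integral_tail hsB (by linarith) fun t ht => by simp [hBM t ht.le]
    have hstep : ∫ t in (0 : ℝ)..T, β / T * deriv step (t / T) = β := by
      rw [intervalIntegral.integral_const_mul,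
        intervalIntegral.integral_comp_div (fun t => deriv step t) hTpos.ne', zero_div,
        div_self hTpos.ne', intervalIntegral.integral_deriv_eq_sub
          (fun t _ => contDiff_step.differentiable (by simp) t)
          ((contDiff_infty_iff_deriv.1 contDiff_step).2.continuous.intervalIntegrable _ _)]
      have e1 : step 1 = 1 := (step_eventuallyEq_one (t := 1) (by norm_num)).eq_of_nhds
      have e0 : step 0 = 0 := (step_eventuallyEq_zero (t := 0) (by norm_num)).eq_of_nhds
      rw [e1, e0, smul_eq_mul]
      field_simp
      ring
    have hrev : Continuous fun t : ℝ => T - t := continuous_const.sub continuous_id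
    have hSc : Continuous fun t => β / T * deriv step (t / T) :=
      continuous_const.mul ((contDiff_infty_iff_deriv.1 contDiff_step).2.continuous.comp
        (continuous_id.div_const T))
    have hE0 : ∫ t in (0 : ℝ)..T, w t 0 = l / ε := by
      have : ∀ t, w t 0 = 1 + (Real.cos (A t) - 1) + (Real.cos (B (T - t)) - 1) := fun t => by
        simp [hw, compVel]; ring
      simp only [this]
      rw [integral_add_of_continuous (f := fun t => 1 + (Real.cos (A t) - 1))
        (continuous_const.add hcA) (g := fun t => Real.cos (B (T - t)) - 1) (hcB.comp hrev),
        integral_add_of_continuous continuous_const hcA, hAint, hBint,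
        intervalIntegral.integral_const, smul_eq_mul]
      linarith
    have hE1 : ∫ t in (0 : ℝ)..T, w t 1 = 0 := by
      have : ∀ t, w t 1 = Real.sin (A t) + Real.sin (B (T - t)) + β / T * deriv step (t / T) :=
        fun t => by simp [hw, compVel]
      simp only [this]
      rw [integral_add_of_continuous (f := fun t => Real.sin (A t) + Real.sin (B (T - t)))
        (hsA.add (hsB.comp hrev)) hSc,
        integral_add_of_continuous hsA (g := fun t => Real.sin (B (T - t))) (hsB.comp hrev), hAint', hBint', hstep, hβdef]
      ring
    simp only [x, hE0, hE1]
  let σ : ℝ → Plane := fun t => ε • x (T * t)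
  have hσ : ContDiff ℝ ∞ σ := (hxs.comp (contDiff_const.mul contDiff_id)).const_smul ε
  have hmulT : ∀ t : ℝ, HasDerivAt (fun t => T * t) T t := fun t => by
    simpa using (hasDerivAt_id t).const_mul T
  have hσv : ∀ t ∈ Icc (0 : ℝ) 1, velocity σ t = (ε * T) • w (T * t) := fun t ht => by
    refine velocity_eq ht ?_
    have := ((hx (T * t)).scomp t (hmulT t)).const_smul ε
    rw [smul_smul] at this
    exact this.hasDerivWithinAt
  have hσa : ∀ t ∈ Icc (0 : ℝ) 1, acceleration σ t = (ε * T ^ 2) • w' (T * t) := fun t ht => by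
    refine acceleration_eq ht hσv ?_
    have := ((hww' (T * t)).scomp t (hmulT t)).const_smul (ε * T)
    rw [smul_smul, mul_assoc, ← sq] at this
    exact this.hasDerivWithinAt
  have hmul : ∀ t ∈ Icc (0 : ℝ) 1, T * t ∈ Icc 0 T := fun t ht =>
    ⟨mul_nonneg hTpos.le ht.1, mul_le_of_le_one_right hTpos.le ht.2⟩
  have hεT : 0 < ε * T := mul_pos hε hTpos
  have hreg : ∀ t ∈ Icc (0 : ℝ) 1, velocity σ t ≠ 0 := fun t ht => by
    rw [hσv t ht]
    exact smul_ne_zero hεT.ne' (hbound _ (hmul t ht)).1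
  have hdir : ∀ θ : ℝ, ‖(ε * T) • dir θ‖ = ε * T := fun θ => by
    rw [norm_smul, norm_dir, mul_one, Real.norm_of_nonneg hεT.le]
  have hle : energy ε γ ≤ energy ε σ := by
    refine hγ.energy_le hσ.contDiffOn hreg ?_ ?_ ?_ ?_
    · exact plane_ext (by simp [σ, x]) (by simp [σ, x])
    · simp only [σ, mul_one, hx1]
      exact plane_ext (by simp; field_simp) (by simp)
    · have : w (T * 0) = dir θ₀ := by
        have hS := deriv_step_eq_zero (t := 0) (.inl (by norm_num))
        exact plane_ext (by simp [hw, compVel, hA0, hBM T (by linarith)])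
          (by simp [hw, compVel, hA0, hBM T (by linarith), hS.1])
      rw [hσv 0 (by simp), this, hdir]
    · have : w (T * 1) = dir θ₁ := by
        have hS := deriv_step_eq_zero (t := 1) (.inr (by norm_num))
        exact plane_ext (by simp [hw, compVel, hB0, hAM T (by linarith)])
          (by simp [hw, compVel, hB0, hAM T (by linarith), hS.1, div_self hTpos.ne'])
      rw [hσv 1 (by simp), this, hdir]
  have hEσ : energy ε σ = ε * ∫ t in (0 : ℝ)..T, energyDensity 1 (w t) (w' t) := by
    have e1 : energy ε σ = ∫ t in (0 : ℝ)..1,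
        ε * T * energyDensity 1 (w (T * t)) (w' (T * t)) := by
      rw [energy_eq_integral ε hσ.contDiffOn hreg]
      refine intervalIntegral.integral_congr fun t ht => ?_
      rw [uIcc_of_le zero_le_one] at ht
      simp only [hσv t ht, hσa t ht]
      exact energyDensity_scale hε hTpos (hbound _ (hmul t ht)).1
    rw [e1, intervalIntegral.integral_const_mul,
      intervalIntegral.integral_comp_mul_left (fun t => energyDensity 1 (w t) (w' t)) hTpos.ne',
      mul_zero, mul_one, smul_eq_mul]
    field_simp
  have hlA := continuous_layerDensity hA
  have hlB := continuous_layerDensity hB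
  have hlB' : Continuous fun t => layerDensity B (T - t) :=
    hlB.comp (continuous_const.sub continuous_id)
  have hcE : ContinuousOn (fun t => energyDensity 1 (w t) (w' t)) (Icc 0 T) := by
    have h0 := hc0 0 hws.continuous
    have h1 := hc0 1 hws.continuous
    have h2 := hc0 0 hw's
    have h3 := hc0 1 hw's
    have h4 := hws.continuous.norm
    refine (continuousOn_const.mul (ContinuousOn.div ?_ (h4.pow 5).continuousOn fun t ht =>
      pow_ne_zero 5 (norm_ne_zero_iff.2 (hbound t ht).1))).add h4.continuousOn
    exact (((h0.mul h3).sub (h1.mul h2)).pow 2).continuousOn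
  have hmono : ∫ t in (0 : ℝ)..T, energyDensity 1 (w t) (w' t) ≤
      ∫ t in (0 : ℝ)..T, (w t 0 + layerDensity A t + layerDensity B (T - t)
        + 2 * β ^ 2 * K / T ^ 2) := by
    refine intervalIntegral.integral_mono_on hTpos.le ?_ ?_ fun t ht => (hbound t ht).2
    · rw [← uIcc_of_le hTpos.le] at hcE
      exact hcE.intervalIntegrable
    · exact ((((hc0 0 hws.continuous).add hlA).add hlB').add
        continuous_const).intervalIntegrable _ _
  have hsum : ∫ t in (0 : ℝ)..T, (w t 0 + layerDensity A t + layerDensity B (T - t)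
        + 2 * β ^ 2 * K / T ^ 2) = l / ε + (∫ t in (0 : ℝ)..M, layerDensity A t)
        + (∫ t in (0 : ℝ)..M, layerDensity B t) + 2 * β ^ 2 * K / T := by
    have h0 := hc0 0 hws.continuous
    rw [integral_add_of_continuous
        (f := fun t => w t 0 + layerDensity A t + layerDensity B (T - t))
        ((h0.add hlA).add hlB') continuous_const,
      integral_add_of_continuous (f := fun t => w t 0 + layerDensity A t) (h0.add hlA) hlB',
      integral_add_of_continuous h0 hlA,
      intervalIntegral.integral_comp_sub_left (fun t => layerDensity B t) T, sub_self, sub_zero,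
      integral_tail hlA (by linarith : M ≤ T) fun t ht => layerDensity_eq_zero hAM ht,
      integral_tail hlB (by linarith : M ≤ T) fun t ht => layerDensity_eq_zero hBM ht]
    have : ∫ t in (0 : ℝ)..T, w t 0 = l / ε := by
      have := congrArg (fun v : Plane => v 0) hx1
      simpa [x] using this
    rw [this, intervalIntegral.integral_const, sub_zero, smul_eq_mul]
    field_simp
  -- The factor 8 comes from β² ≤ 4M²; the step costs O(1/T) in total, which is negligible as ε → 0.
  have hrest : 2 * β ^ 2 * K / T ≤ 8 * K * M ^ 2 / (l / ε) := by
    have hlε : 0 < l / ε := by linarith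
    exact div_le_div₀ (by positivity) (by nlinarith) hlε hTl
  calc energy ε γ ≤ ε * ∫ t in (0 : ℝ)..T, energyDensity 1 (w t) (w' t) := hle.trans_eq hEσ
    _ ≤ ε * (l / ε + (∫ t in (0 : ℝ)..M, layerDensity A t)
        + (∫ t in (0 : ℝ)..M, layerDensity B t) + 8 * K * M ^ 2 / (l / ε)) :=
      mul_le_mul_of_nonneg_left (by linarith) hε.le
    _ = _ := by
      have : ε * (l / ε) = l := by field_simp
      linear_combination this

/-! ### Optimal layers and the sharp energy bound. -/

theorem one_sub_cos_four_arctan (z : ℝ) :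
    1 - Real.cos (4 * Real.arctan z) = 8 * z ^ 2 / (1 + z ^ 2) ^ 2 := by
  have h := Real.cos_sq_arctan z
  have hz : (1 : ℝ) + z ^ 2 ≠ 0 := by positivity
  rw [show 4 * Real.arctan z = 2 * (2 * Real.arctan z) by ring, Real.cos_two_mul, Real.cos_two_mul, h]
  field_simp
  ring

theorem sin_half_four_arctan (z : ℝ) :
    Real.sin (4 * Real.arctan z / 2) = 2 * z / (1 + z ^ 2) := by
  have hz : (1 : ℝ) + z ^ 2 ≠ 0 := by positivity
  have h := Real.cos_sq_arctan z
  have hc : Real.cos (Real.arctan z) ≠ 0 := (Real.cos_arctan_pos z).ne'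
  rw [show 4 * Real.arctan z / 2 = 2 * Real.arctan z by ring, Real.sin_two_mul]
  have hs : Real.sin (Real.arctan z) = z * Real.cos (Real.arctan z) := by
    have := Real.tan_mul_cos hc
    rwa [Real.tan_arctan, eq_comm] at this
  rw [hs, show 2 * (z * Real.cos (Real.arctan z)) * Real.cos (Real.arctan z) =
    2 * z * Real.cos (Real.arctan z) ^ 2 by ring, h]
  field_simp

theorem hasDerivAt_four_arctan {q : ℝ → ℝ} {q' a s : ℝ} (hq : HasDerivAt q q' s) :
    HasDerivAt (fun s => 4 * Real.arctan (a * q s)) (4 * a * q' / (1 + (a * q s) ^ 2)) s := by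
  refine ((hq.const_mul a).arctan.const_mul 4).congr_deriv ?_
  field_simp

theorem layerDensity_four_arctan {q : ℝ → ℝ} {q' a s : ℝ} (hq : HasDerivAt q q' s) :
    layerDensity (fun s => 4 * Real.arctan (a * q s)) s =
      a ^ 2 * (16 * q' ^ 2 + 8 * q s ^ 2) / (1 + (a * q s) ^ 2) ^ 2 := by
  have hz : (1 : ℝ) + (a * q s) ^ 2 ≠ 0 := by positivity
  rw [layerDensity, (hasDerivAt_four_arctan hq).deriv, one_sub_cos_four_arctan]
  field_simp
  ring

theorem exists_bound_deriv_smoothTransition :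
    ∃ K : ℝ, 0 ≤ K ∧ ∀ t, |deriv Real.smoothTransition t| ≤ K := by
  have h1 : ContDiff ℝ ∞ Real.smoothTransition := Real.smoothTransition.contDiff
  obtain ⟨K, hK⟩ := (isCompact_Icc (a := (0 : ℝ)) (b := 1)).exists_bound_of_continuousOn
    (contDiff_infty_iff_deriv.1 h1).2.continuous.continuousOn
  have hK0 : 0 ≤ K := (norm_nonneg _).trans (hK 0 (by simp))
  refine ⟨K, hK0, fun t => ?_⟩
  by_cases ht : t ∈ Icc (0 : ℝ) 1
  · exact hK t ht
  have hz : deriv Real.smoothTransition t = 0 := by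
    rw [mem_Icc, not_and_or, not_le, not_le] at ht
    rcases ht with ht | ht
    · have : Real.smoothTransition =ᶠ[𝓝 t] fun _ => 0 := by
        filter_upwards [Iio_mem_nhds ht] with x hx
          using Real.smoothTransition.zero_of_nonpos (le_of_lt hx)
      simpa using this.deriv.eq_of_nhds
    · have : Real.smoothTransition =ᶠ[𝓝 t] fun _ => 1 := by
        filter_upwards [Ioi_mem_nhds ht] with x hx
          using Real.smoothTransition.one_of_one_le (le_of_lt hx)
      simpa using this.deriv.eq_of_nhds
  rw [hz, abs_zero]
  exact hK0

/-- The decaying exponential `e^{-s/√2}`. -/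
noncomputable def decay (s : ℝ) : ℝ := Real.exp (-(s / √2))

theorem decay_pos (s : ℝ) : 0 < decay s := Real.exp_pos _

theorem decay_zero : decay 0 = 1 := by simp [decay]

theorem contDiff_decay : ContDiff ℝ ∞ decay := by
  unfold decay
  exact Real.contDiff_exp.comp (contDiff_id.div_const _).neg

theorem hasDerivAt_decay (s : ℝ) : HasDerivAt decay (-(decay s / √2)) s := by
  have := (((hasDerivAt_id s).div_const (√2)).neg).exp
  refine this.congr_deriv ?_
  simp [decay]
  ring

theorem decay_antitone : Antitone decay := fun a b h => by
  unfold decay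
  gcongr

theorem tendsto_decay : Tendsto decay atTop (𝓝 0) :=
  Real.tendsto_exp_neg_atTop_nhds_zero.comp (tendsto_id.atTop_div_const (by positivity))

/-- Almost optimal compactly supported boundary layers. -/
theorem exists_layer {δ : ℝ} (hδ : 0 < δ) : ∃ M : ℝ, 1 ≤ M ∧ ∃ q : ℝ → ℝ, ContDiff ℝ ∞ q ∧ q 0 = 1 ∧
    (∀ s, M ≤ s → q s = 0) ∧ ∀ a : ℝ, |a| ≤ 1 →
      ∫ s in (0 : ℝ)..M, layerDensity (fun s => 4 * Real.arctan (a * q s)) s ≤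
        8 * √2 * (a ^ 2 / (1 + a ^ 2)) + δ := by
  obtain ⟨K, hK0, hK⟩ := exists_bound_deriv_smoothTransition
  set C := 16 * (K + 1) ^ 2 + 8 with hC
  have hCpos : 0 < C := by positivity
  have h2 : 0 < √2 := by positivity
  have h22 : √2 ^ 2 = 2 := Real.sq_sqrt (by norm_num)
  have h21 : 1 ≤ √2 := Real.one_le_sqrt.2 (by norm_num)
  have hlim : Tendsto (fun M => C * √2 * decay (M - 1)) atTop (𝓝 (C * √2 * 0)) :=
    (tendsto_decay.comp (tendsto_atTop_add_const_right _ (-1) tendsto_id)).const_mul _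
  rw [mul_zero] at hlim
  -- The cut-off error is at most C √2 e^{−(M−1)/√2}. Neither C nor M depends on `a`, which keeps
  -- the construction uniform in the boundary angle.
  obtain ⟨M, hMδ, hM⟩ := ((hlim.eventually (gt_mem_nhds hδ)).and (eventually_ge_atTop 1)).exists
  have hsT : ContDiff ℝ ∞ Real.smoothTransition := Real.smoothTransition.contDiff
  refine ⟨M, hM, fun s => decay s * Real.smoothTransition (M - s), ?_, ?_, ?_, ?_⟩
  · exact contDiff_decay.mul (hsT.comp (contDiff_const.sub contDiff_id))
  · beta_reduce
    rw [decay_zero, Real.smoothTransition.one_of_one_le (by linarith), mul_one]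
  · intro s hs
    beta_reduce
    rw [Real.smoothTransition.zero_of_nonpos (by linarith), mul_zero]
  intro a ha
  have ha2 : a ^ 2 ≤ 1 := by rw [← sq_abs]; exact pow_le_one₀ (abs_nonneg a) ha
  set q : ℝ → ℝ := fun s => decay s * Real.smoothTransition (M - s) with hq
  have hqs : ContDiff ℝ ∞ q := contDiff_decay.mul (hsT.comp (contDiff_const.sub contDiff_id))
  -- The first term is the exact density of the uncut layer; the second dominates the density where
  -- the cut-off acts, s ≥ M − 1. `G` is an explicit antiderivative of `g`.
  let g : ℝ → ℝ := fun s => 16 * a ^ 2 * decay s ^ 2 / (1 + (a * decay s) ^ 2) ^ 2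
    + C * decay (M - 1) * decay s
  let G : ℝ → ℝ := fun s => 8 * √2 / (1 + (a * decay s) ^ 2) - C * decay (M - 1) * √2 * decay s
  have hz : ∀ s, (1 : ℝ) + (a * decay s) ^ 2 ≠ 0 := fun s => by positivity
  have hG : ∀ s, HasDerivAt G (g s) s := fun s => by
    have hd := hasDerivAt_decay s
    have h1 := ((((hd.const_mul a).pow 2).const_add 1).fun_inv (hz s)).const_mul (8 * √2)
    have h3 := h1.sub (hd.const_mul (C * decay (M - 1) * √2))
    have h4 : G = (fun s => 8 * √2 * (1 + (a * decay s) ^ 2)⁻¹) -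
      fun s => C * decay (M - 1) * √2 * decay s := by
      funext s; simp [G, div_eq_mul_inv]
    rw [h4]
    refine h3.congr_deriv ?_
    have := hz s
    simp only [g, Pi.pow_apply]
    field_simp
    push_cast
    ring
  have hgc : Continuous g := by
    have := contDiff_decay.continuous
    refine ((continuous_const.mul (this.pow 2)).div
      ((continuous_const.add ((continuous_const.mul this).pow 2)).pow 2) fun s =>
        pow_ne_zero 2 (hz s)).add (continuous_const.mul this)
  have hχ : ∀ s, HasDerivAt (fun s => Real.smoothTransition (M - s))
      (-deriv Real.smoothTransition (M - s)) s := fun s => by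
    have := HasDerivAt.comp s (h₂ := Real.smoothTransition) (h := fun s => M - s)
      (hsT.differentiable (by simp) (M - s)).hasDerivAt ((hasDerivAt_id s).const_sub M)
    rw [mul_neg_one] at this
    exact this
  have hq' : ∀ s, HasDerivAt q (-(decay s / √2) * Real.smoothTransition (M - s)
      + decay s * -deriv Real.smoothTransition (M - s)) s := fun s =>
    (hasDerivAt_decay s).mul (hχ s)
  have hle : ∀ s, layerDensity (fun s => 4 * Real.arctan (a * q s)) s ≤ g s := by
    intro s
    have hdpos := decay_pos s
    rcases lt_or_ge s (M - 1) with hs | hs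
    · have hev : q =ᶠ[𝓝 s] decay := by
        filter_upwards [Iio_mem_nhds hs] with x hx
        simp only [hq]
        rw [Real.smoothTransition.one_of_one_le (by linarith [mem_Iio.1 hx]), mul_one]
      rw [layerDensity_four_arctan ((hasDerivAt_decay s).congr_of_eventuallyEq hev), hev.eq_of_nhds]
      have h3 : 0 ≤ C * decay (M - 1) * decay s := by
        have := decay_pos (M - 1); positivity
      have h4 : a ^ 2 * (16 * (-(decay s / √2)) ^ 2 + 8 * decay s ^ 2) =
          16 * a ^ 2 * decay s ^ 2 := by
        rw [neg_sq, div_pow, h22]; ring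
      simp only [g, h4]
      linarith
    · rw [layerDensity_four_arctan (hq' s)]
      set χ := Real.smoothTransition (M - s)
      set χ' := deriv Real.smoothTransition (M - s)
      have hχ0 : 0 ≤ χ := Real.smoothTransition.nonneg _
      have hχ1 : χ ≤ 1 := Real.smoothTransition.le_one _
      have hqs' : q s = decay s * χ := rfl
      have hq1 : q s ^ 2 ≤ decay s ^ 2 := by
        rw [hqs', mul_pow]
        exact mul_le_of_le_one_right (sq_nonneg _) (pow_le_one₀ hχ0 hχ1)
      have hq2 : (-(decay s / √2) * χ + decay s * -χ') ^ 2 ≤ decay s ^ 2 * (K + 1) ^ 2 := by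
        rw [show -(decay s / √2) * χ + decay s * -χ' = decay s * -(χ / √2 + χ') by ring, mul_pow,
          neg_sq]
        refine mul_le_mul_of_nonneg_left ?_ (sq_nonneg _)
        have h5 : χ / √2 ≤ 1 := (div_le_one h2).2 (hχ1.trans h21)
        have h6 : 0 ≤ χ / √2 := by positivity
        have h7 := abs_le.1 (hK (M - s))
        exact sq_le_sq' (by linarith [h7.1]) (by linarith [h7.2])
      have h8 : a ^ 2 * (16 * (-(decay s / √2) * χ + decay s * -χ') ^ 2 + 8 * q s ^ 2)
          / (1 + (a * q s) ^ 2) ^ 2 ≤ C * decay s ^ 2 := by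
        have hden : 1 ≤ (1 + (a * q s) ^ 2) ^ 2 := one_le_pow₀ (by nlinarith [sq_nonneg (a * q s)])
        refine (div_le_self (by positivity) hden).trans ?_
        refine (mul_le_of_le_one_left (by positivity) ha2).trans ?_
        rw [hC]
        linarith
      have h9 : decay s ^ 2 ≤ decay (M - 1) * decay s := by
        rw [sq]; exact mul_le_mul_of_nonneg_right (decay_antitone hs) hdpos.le
      have h10 : 0 ≤ 16 * a ^ 2 * decay s ^ 2 / (1 + (a * decay s) ^ 2) ^ 2 := by positivity
      calc _ ≤ C * decay s ^ 2 := h8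
        _ ≤ C * (decay (M - 1) * decay s) := mul_le_mul_of_nonneg_left h9 hCpos.le
        _ ≤ g s := by simp only [g]; linarith
  have hlc : Continuous (layerDensity fun s => 4 * Real.arctan (a * q s)) :=
    continuous_layerDensity (contDiff_const.mul (contDiff_const.mul hqs).arctan)
  have hM0 : (0 : ℝ) ≤ M := by linarith
  calc _ ≤ ∫ s in (0 : ℝ)..M, g s := intervalIntegral.integral_mono_on hM0
        (hlc.intervalIntegrable _ _) (hgc.intervalIntegrable _ _) fun s _ => hle s
    _ = G M - G 0 := intervalIntegral.integral_eq_sub_of_hasDerivAt (fun s _ => hG s)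
        (hgc.intervalIntegrable _ _)
    _ ≤ _ := by
      have hp1 : 0 < decay (M - 1) := decay_pos _
      have hp2 : 0 < decay M := decay_pos _
      have e1 : 8 * √2 / (1 + (a * decay M) ^ 2) ≤ 8 * √2 :=
        div_le_self (by positivity) (by nlinarith [sq_nonneg (a * decay M)])
      have e2 : 8 * √2 * (a ^ 2 / (1 + a ^ 2)) = 8 * √2 - 8 * √2 / (1 + a ^ 2) := by
        have : (1 : ℝ) + a ^ 2 ≠ 0 := by positivity
        field_simp
        ring
      have e3 : 0 ≤ C * decay (M - 1) * √2 * decay M := by positivity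
      simp only [G, decay_zero, mul_one]
      rw [e2]
      have e4 : C * √2 * decay (M - 1) = C * decay (M - 1) * √2 := by ring
      linarith

theorem abs_tan_quarter_le {θ : ℝ} (hθ : θ ∈ Icc (-Real.pi) Real.pi) : |Real.tan (θ / 4)| ≤ 1 := by
  have hpi := Real.pi_pos
  have h : ∀ x ∈ Icc 0 Real.pi, Real.tan (x / 4) ≤ 1 := fun x hx => by
    rw [← Real.tan_pi_div_four]
    exact Real.strictMonoOn_tan.monotoneOn ⟨by linarith [hx.1], by linarith [hx.2]⟩
      ⟨by linarith, by linarith⟩ (by linarith [hx.2])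
  have h0 : ∀ x ∈ Icc 0 Real.pi, 0 ≤ Real.tan (x / 4) := fun x hx =>
    Real.tan_nonneg_of_nonneg_of_le_pi_div_two (by linarith [hx.1]) (by linarith [hx.2])
  rcases le_total 0 θ with h1 | h1
  · rw [abs_of_nonneg (h0 θ ⟨h1, hθ.2⟩)]
    exact h θ ⟨h1, hθ.2⟩
  · rw [← abs_neg, ← Real.tan_neg, ← neg_div, abs_of_nonneg (h0 (-θ) ⟨by linarith, by linarith [hθ.1]⟩)]
    exact h (-θ) ⟨by linarith, by linarith [hθ.1]⟩

/-- With a = tan(θ/4) the quotient is sin²(θ/4), so the cost of the explicit layer equals the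
Modica-Mortola lower bound. -/
theorem layer_cost {θ : ℝ} (hθ : θ ∈ Icc (-Real.pi) Real.pi) :
    8 * √2 * (Real.tan (θ / 4) ^ 2 / (1 + Real.tan (θ / 4) ^ 2)) =
      4 * √2 * (1 - Real.cos (θ / 2)) := by
  have hpi := Real.pi_pos
  have hc : Real.cos (θ / 4) ≠ 0 :=
    (Real.cos_pos_of_mem_Ioo ⟨by linarith [hθ.1], by linarith [hθ.2]⟩).ne'
  rw [Real.tan_sq_div_one_add_tan_sq hc, Real.sin_sq, show θ / 2 = 2 * (θ / 4) by ring,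
    Real.cos_two_mul]
  ring

theorem four_arctan_tan {θ : ℝ} (hθ : θ ∈ Ioo (-(2 * Real.pi)) (2 * Real.pi)) :
    4 * Real.arctan (Real.tan (θ / 4)) = θ := by
  rw [Real.arctan_tan (by linarith [hθ.1]) (by linarith [hθ.2])]
  ring

/-- Sharp upper bound for the excess energy of minimizers. -/
theorem exists_energy_bound {δ : ℝ} (hδ : 0 < δ) : ∃ R : ℝ, ∀ {ε θ₀ θ₁ l : ℝ} {γ : ℝ → Plane},
    0 < ε → θ₀ ∈ Icc (-Real.pi) Real.pi → θ₁ ∈ Icc (-Real.pi) Real.pi → IsMinimizer ε θ₀ θ₁ l γ →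
    R ≤ l / ε →
    energy ε γ ≤ l + ε * (4 * √2 * (2 - Real.cos (θ₀ / 2) - Real.cos (θ₁ / 2)) + δ) := by
  obtain ⟨K, hK0, hK⟩ := IsMinimizer.energy_le_layers
  obtain ⟨M, hM, q, hq, hq0, hqM, hqa⟩ := exists_layer (δ := δ / 3) (by positivity)
  -- The first entry makes room for the two layers; the second makes the cost of the vertical step
  -- at most δ/3. The other two thirds of δ are spent on the layers.
  refine ⟨max (3 * M + 1) (K * M ^ 2 / (δ / 3)), fun {ε θ₀ θ₁ l γ} hε h0 h1 hγ hR => ?_⟩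
  have hpi := Real.pi_pos
  have hsm : ∀ a : ℝ, ContDiff ℝ ∞ fun s => 4 * Real.arctan (a * q s) := fun a =>
    contDiff_const.mul (contDiff_const.mul hq).arctan
  have hin : ∀ θ ∈ Icc (-Real.pi) Real.pi, 4 * Real.arctan (Real.tan (θ / 4) * q 0) = θ :=
    fun θ hθ => by
      rw [hq0, mul_one, four_arctan_tan ⟨by linarith [hθ.1], by linarith [hθ.2]⟩]
  have hend : ∀ a : ℝ, ∀ t, M ≤ t → 4 * Real.arctan (a * q t) = 0 := fun a t ht => by
    simp [hqM t ht]
  have hR1 : 3 * M + 1 ≤ l / ε := (le_max_left _ _).trans hR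
  have hR2 : K * M ^ 2 / (δ / 3) ≤ l / ε := (le_max_right _ _).trans hR
  have hlpos : 0 < l / ε := by linarith
  have hmain := hK hε hγ (hsm (Real.tan (θ₀ / 4))) (hsm (Real.tan (θ₁ / 4))) (hin θ₀ h0) (hin θ₁ h1)
    hM (hend _) (hend _) (by linarith)
  have e0 := hqa _ (abs_tan_quarter_le h0)
  have e1 := hqa _ (abs_tan_quarter_le h1)
  rw [layer_cost h0] at e0
  rw [layer_cost h1] at e1
  have e2 : K * M ^ 2 / (l / ε) ≤ δ / 3 := by
    rw [div_le_iff₀ (by positivity)] at hR2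
    rw [div_le_iff₀ hlpos]
    linarith
  refine hmain.trans (add_le_add_right (mul_le_mul_of_nonneg_left ?_ hε.le) l)
  linarith

/-! ### Existence and uniqueness of the borderline elastica. -/

/-- Tangential angle of the borderline elastica. -/
noncomputable def borderAngle (θ s : ℝ) : ℝ := 4 * Real.arctan (Real.tan (θ / 4) * decay s)

/-- Curvature of the borderline elastica. -/
noncomputable def borderCurv (θ s : ℝ) : ℝ := -(√2 * Real.sin (borderAngle θ s / 2))

/-- The borderline elastica. -/
noncomputable def borderCurve (θ s : ℝ) : Plane :=
  !₂[∫ τ in (0 : ℝ)..s, Real.cos (borderAngle θ τ), ∫ τ in (0 : ℝ)..s, Real.sin (borderAngle θ τ)]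

theorem sqrt_two_sq : √2 * √2 = (2 : ℝ) := Real.mul_self_sqrt (by norm_num)

theorem hasDerivAt_borderAngle (θ s : ℝ) : HasDerivAt (borderAngle θ) (borderCurv θ s) s := by
  refine (hasDerivAt_four_arctan (hasDerivAt_decay s)).congr_deriv ?_
  rw [borderCurv, borderAngle, sin_half_four_arctan]
  have : (1 : ℝ) + (Real.tan (θ / 4) * decay s) ^ 2 ≠ 0 := by positivity
  have h2 : √2 ≠ 0 := by positivity
  field_simp
  linear_combination 2 * (Real.tan (θ / 4) * decay s) * sqrt_two_sq

theorem sin_half_mul_cos_half (x : ℝ) : 2 * (Real.sin (x / 2) * Real.cos (x / 2)) = Real.sin x := by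
  rw [← mul_assoc, ← Real.sin_two_mul]; ring_nf

theorem two_mul_sin_half_sq (x : ℝ) : 2 * Real.sin (x / 2) ^ 2 = 1 - Real.cos x := by
  have h := Real.cos_two_mul (x / 2)
  rw [mul_div_cancel₀ x two_ne_zero] at h
  have := Real.sin_sq_add_cos_sq (x / 2)
  linarith

theorem hasDerivAt_borderCurv (θ s : ℝ) :
    HasDerivAt (borderCurv θ) (Real.sin (borderAngle θ s) / 2) s := by
  refine ((((hasDerivAt_borderAngle θ s).div_const 2).sin.const_mul (√2)).neg).congr_deriv ?_
  rw [borderCurv, ← sin_half_mul_cos_half (borderAngle θ s)]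
  linear_combination Real.sin (borderAngle θ s / 2) * Real.cos (borderAngle θ s / 2) / 2 * sqrt_two_sq

theorem borderCurv_sq (θ s : ℝ) : borderCurv θ s ^ 2 = 1 - Real.cos (borderAngle θ s) := by
  rw [borderCurv, ← two_mul_sin_half_sq]
  linear_combination Real.sin (borderAngle θ s / 2) ^ 2 * sqrt_two_sq

theorem contDiff_borderAngle (θ : ℝ) : ContDiff ℝ ∞ (borderAngle θ) :=
  contDiff_const.mul (contDiff_const.mul contDiff_decay).arctan

/-- The range is larger than [−π, π] because solutions turning the long way round are described by
starting angles θ ∓ 2π. -/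
theorem borderAngle_zero {θ : ℝ} (hθ : θ ∈ Ioo (-(2 * Real.pi)) (2 * Real.pi)) :
    borderAngle θ 0 = θ := by
  rw [borderAngle, decay_zero, mul_one, four_arctan_tan hθ]

theorem tendsto_borderAngle (θ : ℝ) : Tendsto (borderAngle θ) atTop (𝓝 0) := by
  have h := (Real.continuous_arctan.tendsto _).comp (tendsto_decay.const_mul (Real.tan (θ / 4)))
  have h4 := h.const_mul 4
  rw [mul_zero, Real.arctan_zero, mul_zero] at h4
  exact h4

theorem abs_sin_half_borderAngle_le {θ : ℝ} (hθ : θ ∈ Icc (-Real.pi) Real.pi) (s : ℝ) :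
    |Real.sin (borderAngle θ s / 2)| ≤ 2 * decay s := by
  have ha := abs_tan_quarter_le hθ
  have hd := decay_pos s
  rw [borderAngle, sin_half_four_arctan, abs_div, abs_mul, abs_mul, abs_of_pos hd,
    abs_of_pos (by norm_num : (0 : ℝ) < 2),
    abs_of_pos (by positivity : 0 < 1 + (Real.tan (θ / 4) * decay s) ^ 2)]
  refine (div_le_self (by positivity) (by nlinarith [sq_nonneg (Real.tan (θ / 4) * decay s)])).trans ?_
  nlinarith

theorem hasDerivAt_borderCurve (θ s : ℝ) :
    HasDerivAt (borderCurve θ) (dir (borderAngle θ s)) s := by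
  have h := (contDiff_borderAngle θ).continuous
  exact hasDerivAt_plane.2
    ⟨((Real.continuous_cos.comp h).integral_hasStrictDerivAt 0 s).hasDerivAt,
      ((Real.continuous_sin.comp h).integral_hasStrictDerivAt 0 s).hasDerivAt⟩

theorem borderCurve_zero (θ : ℝ) : borderCurve θ 0 = 0 :=
  plane_ext (by simp [borderCurve]) (by simp [borderCurve])

theorem isBorderlineElastica_borderCurve {θ : ℝ} (hθ : θ ∈ Icc (-Real.pi) Real.pi) :
    IsBorderlineElastica θ (borderCurve θ) := by
  have hpi := Real.pi_pos
  have hd : ∀ s ∈ Ici (0 : ℝ), derivWithin (borderCurve θ) (Ici 0) s = dir (borderAngle θ s) :=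
    fun s hs => (hasDerivAt_borderCurve θ s).hasDerivWithinAt.derivWithin (uniqueDiffOn_Ici 0 s hs)
  have hsm : ContDiff ℝ ∞ (borderCurve θ) := by
    refine contDiff_infty_iff_deriv.2 ⟨fun s => (hasDerivAt_borderCurve θ s).differentiableAt, ?_⟩
    have : deriv (borderCurve θ) = dir ∘ borderAngle θ :=
      funext fun s => (hasDerivAt_borderCurve θ s).deriv
    rw [this]
    exact contDiff_dir.comp (contDiff_borderAngle θ)
  refine ⟨hsm.contDiffOn, fun s hs => by rw [hd s hs, norm_dir], ?_, borderAngle θ,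
    ⟨(contDiff_borderAngle θ).contDiffOn, fun s hs => ?_⟩,
    borderAngle_zero ⟨by linarith [hθ.1], by linarith [hθ.2]⟩, tendsto_borderAngle θ, fun s _ => ?_⟩
  · rw [borderCurve_zero]; exact plane_ext (by simp) (by simp)
  · rw [hd s hs, norm_dir, one_smul]
  · rw [(hasDerivAt_borderAngle θ s).deriv, borderCurv_sq]

/-- An angle function decaying to `0` along the separatrix equation satisfies the signed first order
equation. -/
theorem deriv_eq_of_separatrix {ϑ : ℝ → ℝ} (hs : ContDiffOn ℝ ∞ ϑ (Ici 0))
    (hlim : Tendsto ϑ atTop (𝓝 0)) (hode : ∀ s ∈ Ioi (0 : ℝ), deriv ϑ s ^ 2 = 1 - Real.cos (ϑ s)) :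
    ∀ s ∈ Ioi (0 : ℝ), deriv ϑ s = -(√2 * Real.sin (ϑ s / 2)) := by
  have hs' : ContDiffOn ℝ ∞ ϑ (Ioi 0) := hs.mono Ioi_subset_Ici_self
  have hκ : ContinuousOn (deriv ϑ) (Ioi 0) := hs'.continuousOn_deriv_of_isOpen isOpen_Ioi (by simp)
  have hd : ∀ s ∈ Ioi (0 : ℝ), HasDerivAt ϑ (deriv ϑ s) s := fun s h =>
    ((hs'.differentiableOn (by simp) s h).differentiableAt (Ioi_mem_nhds h)).hasDerivAt
  have hsq : ∀ s ∈ Ioi (0 : ℝ), deriv ϑ s ^ 2 = 2 * Real.sin (ϑ s / 2) ^ 2 := fun s h => by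
    rw [hode s h, two_mul_sin_half_sq]
  have hsin : ContinuousOn (fun s => Real.sin (ϑ s / 2)) (Ioi 0) :=
    Real.continuous_sin.comp_continuousOn (hs'.continuousOn.div_const 2)
  -- Either sin(ϑ/2) vanishes somewhere, and then everywhere by a Gronwall argument, or it never
  -- vanishes and the sign of ϑ' sin(ϑ/2) is constant.
  by_cases hz : ∃ s₀ ∈ Ioi (0 : ℝ), Real.sin (ϑ s₀ / 2) = 0
  · obtain ⟨s₀, hs₀, hz⟩ := hz
    have hh : ∀ s ∈ Ioi (0 : ℝ), HasDerivAt (fun s => Real.sin (ϑ s / 2) ^ 2)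
        (Real.sin (ϑ s / 2) * Real.cos (ϑ s / 2) * deriv ϑ s) s := fun s h => by
      refine (((hd s h).div_const 2).sin.pow 2).congr_deriv ?_
      push_cast
      ring
    have hb : ∀ s ∈ Ioi (0 : ℝ), |Real.sin (ϑ s / 2) * Real.cos (ϑ s / 2) * deriv ϑ s| ≤
        2 * Real.sin (ϑ s / 2) ^ 2 := fun s h => by
      have h1 : |deriv ϑ s| ≤ 2 * |Real.sin (ϑ s / 2)| := by
        refine abs_le_of_sq_le_sq' ?_ (by positivity) |> abs_le.2
        rw [hsq s h, mul_pow, sq_abs]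
        nlinarith [sq_nonneg (Real.sin (ϑ s / 2))]
      rw [abs_mul, abs_mul]
      calc _ ≤ |Real.sin (ϑ s / 2)| * 1 * (2 * |Real.sin (ϑ s / 2)|) := by
            gcongr
            exact Real.abs_cos_le_one _
        _ = 2 * |Real.sin (ϑ s / 2)| ^ 2 := by ring
        _ = _ := by rw [sq_abs]
    have hexp : ∀ k s : ℝ, HasDerivAt (fun s => Real.exp (k * s)) (Real.exp (k * s) * k) s :=
      fun k s => by simpa using ((hasDerivAt_id s).const_mul k).exp
    have hmono : ∀ k : ℝ, ∀ s ∈ Ioi (0 : ℝ),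
        HasDerivAt (fun s => Real.sin (ϑ s / 2) ^ 2 * Real.exp (k * s))
          ((Real.sin (ϑ s / 2) * Real.cos (ϑ s / 2) * deriv ϑ s + k * Real.sin (ϑ s / 2) ^ 2)
            * Real.exp (k * s)) s := fun k s h => by
      refine ((hh s h).mul (hexp k s)).congr_deriv ?_
      ring
    have hcont : ∀ k : ℝ, ContinuousOn (fun s => Real.sin (ϑ s / 2) ^ 2 * Real.exp (k * s)) (Ioi 0) :=
      fun k s h => (hmono k s h).continuousAt.continuousWithinAt
    -- Exponential weights turn |(sin²(ϑ/2))'| ≤ 2 sin²(ϑ/2) into monotonicity: this one carries the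
    -- zero at `s₀` to the left, the next one to the right.
    have hup : MonotoneOn (fun s => Real.sin (ϑ s / 2) ^ 2 * Real.exp (2 * s)) (Ioi 0) := by
      refine monotoneOn_of_deriv_nonneg (convex_Ioi 0) (hcont 2) ?_ ?_
      · rw [interior_Ioi]
        exact fun s h => (hmono 2 s h).differentiableAt.differentiableWithinAt
      · rw [interior_Ioi]
        intro s h
        rw [(hmono 2 s h).deriv]
        exact mul_nonneg (by linarith [(abs_le.1 (hb s h)).1]) (Real.exp_pos _).le
    have hdown : AntitoneOn (fun s => Real.sin (ϑ s / 2) ^ 2 * Real.exp (-2 * s)) (Ioi 0) := by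
      refine antitoneOn_of_deriv_nonpos (convex_Ioi 0) (hcont (-2)) ?_ ?_
      · rw [interior_Ioi]
        exact fun s h => (hmono (-2) s h).differentiableAt.differentiableWithinAt
      · rw [interior_Ioi]
        intro s h
        rw [(hmono (-2) s h).deriv]
        exact mul_nonpos_of_nonpos_of_nonneg (by linarith [(abs_le.1 (hb s h)).2])
          (Real.exp_pos _).le
    intro s h
    have hzero : Real.sin (ϑ s / 2) ^ 2 ≤ 0 := by
      rcases le_total s s₀ with h1 | h1
      · have := hup h hs₀ h1
        simp only [hz] at this
        nlinarith [Real.exp_pos (2 * s)]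
      · have := hdown hs₀ h h1
        simp only [hz] at this
        nlinarith [Real.exp_pos (-2 * s)]
    have h0 : Real.sin (ϑ s / 2) = 0 := by nlinarith
    have h3 := hsq s h
    rw [h0] at h3 ⊢
    have : deriv ϑ s = 0 := by nlinarith
    rw [this]; simp
  · push Not at hz
    have hprod : ContinuousOn (fun s => deriv ϑ s * Real.sin (ϑ s / 2)) (Ioi 0) := hκ.mul hsin
    have hne : ∀ s ∈ Ioi (0 : ℝ), deriv ϑ s * Real.sin (ϑ s / 2) ≠ 0 := fun s h => by
      refine mul_ne_zero (fun h0 => hz s h ?_) (hz s h)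
      have := hsq s h
      rw [h0] at this
      nlinarith
    -- If the product were positive at one point, it would be positive everywhere by the
    -- intermediate value theorem. Then cos(ϑ/2) would strictly decrease to its limit 1, hence
    -- exceed 1.
    have hneg : ∀ s ∈ Ioi (0 : ℝ), deriv ϑ s * Real.sin (ϑ s / 2) < 0 := by
      by_contra! hcon
      obtain ⟨s₁, hs₁, h1⟩ := hcon
      have hpos : ∀ s ∈ Ioi (0 : ℝ), 0 < deriv ϑ s * Real.sin (ϑ s / 2) := by
        intro s h
        by_contra! h2
        obtain ⟨x, hx, hx0⟩ := isPreconnected_Ioi.intermediate_value h hs₁ hprod ⟨h2, h1⟩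
        exact hne x hx hx0
      have hG : ∀ s ∈ Ioi (0 : ℝ), HasDerivAt (fun s => Real.cos (ϑ s / 2))
          (-(deriv ϑ s * Real.sin (ϑ s / 2) / 2)) s := fun s h => by
        refine ((hd s h).div_const 2).cos.congr_deriv ?_
        ring
      have hanti : StrictAntiOn (fun s => Real.cos (ϑ s / 2)) (Ioi 0) := by
        refine strictAntiOn_of_deriv_neg (convex_Ioi 0)
          (fun s h => (hG s h).continuousAt.continuousWithinAt) fun s h => ?_
        rw [interior_Ioi] at h
        rw [(hG s h).deriv]
        linarith [hpos s h]
      have hl : Tendsto (fun s => Real.cos (ϑ s / 2)) atTop (𝓝 1) := by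
        have := (Real.continuous_cos.tendsto _).comp (hlim.div_const 2)
        rw [zero_div, Real.cos_zero] at this
        exact this
      have h2 : (1 : ℝ) ≤ Real.cos (ϑ 2 / 2) := by
        refine le_of_tendsto hl ?_
        filter_upwards [eventually_ge_atTop 2] with s h
        exact hanti.antitoneOn (by norm_num) (lt_of_lt_of_le (by norm_num) h) h
      have h3 := hanti (show (1 : ℝ) ∈ Ioi 0 by norm_num) (show (2 : ℝ) ∈ Ioi 0 by norm_num)
        (by norm_num)
      have h4 := Real.cos_le_one (ϑ 1 / 2)
      simp only at h3
      linarith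
    intro s h
    have h1 := hsq s h
    have h2 : (deriv ϑ s - √2 * Real.sin (ϑ s / 2)) * (deriv ϑ s + √2 * Real.sin (ϑ s / 2)) = 0 := by
      linear_combination h1 - Real.sin (ϑ s / 2) ^ 2 * sqrt_two_sq
    rcases mul_eq_zero.1 h2 with h3 | h3
    · have h4 := hneg s h
      rw [sub_eq_zero.1 h3, mul_assoc, ← sq] at h4
      exact absurd h4 (not_lt.2 (by positivity))
    · linarith

theorem lipschitzWith_separatrix : LipschitzWith 1 fun y : ℝ => -(√2 * Real.sin (y / 2)) := by
  have hd : ∀ y : ℝ, HasDerivAt (fun y : ℝ => -(√2 * Real.sin (y / 2)))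
      (-(√2 * (Real.cos (y / 2) * (1 / 2)))) y := fun y =>
    (((hasDerivAt_id y).div_const 2).sin.const_mul _).neg
  refine lipschitzWith_of_nnnorm_deriv_le (fun y => (hd y).differentiableAt) fun y => ?_
  rw [(hd y).deriv, ← NNReal.coe_le_coe, coe_nnnorm, norm_neg, norm_mul, norm_mul]
  simp only [Real.norm_eq_abs, NNReal.coe_one]
  have h1 := Real.abs_cos_le_one (y / 2)
  have h2 : |√2| ≤ 2 := by
    rw [abs_of_nonneg (Real.sqrt_nonneg _)]
    exact Real.sqrt_le_iff.2 ⟨by norm_num, by norm_num⟩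
  rw [abs_of_pos (by norm_num : (0 : ℝ) < 1 / 2)]
  nlinarith [abs_nonneg (√2), abs_nonneg (Real.cos (y / 2))]

/-- The squared equation alone has no uniqueness; the decay at infinity selects a sign, and the
resulting first order equation is Lipschitz. Continuity of the one-sided derivative extends it to s
= 0. -/
theorem eq_borderAngle {θ : ℝ} (hθ : θ ∈ Icc (-Real.pi) Real.pi) {ϑ : ℝ → ℝ}
    (hs : ContDiffOn ℝ ∞ ϑ (Ici 0)) (h0 : ϑ 0 = θ) (hlim : Tendsto ϑ atTop (𝓝 0))
    (hode : ∀ s ∈ Ioi (0 : ℝ), deriv ϑ s ^ 2 = 1 - Real.cos (ϑ s)) :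
    EqOn ϑ (borderAngle θ) (Ici 0) := by
  have hpi := Real.pi_pos
  have hu : UniqueDiffOn ℝ (Ici (0 : ℝ)) := uniqueDiffOn_Ici 0
  have hκ : ContinuousOn (derivWithin ϑ (Ici 0)) (Ici 0) := hs.continuousOn_derivWithin hu (by simp)
  have heq : EqOn (derivWithin ϑ (Ici 0)) (fun s => -(√2 * Real.sin (ϑ s / 2))) (Ici 0) := by
    refine EqOn.of_subset_closure (s := Ioi 0) (fun s h => ?_) hκ ?_ Ioi_subset_Ici_self ?_
    · rw [derivWithin_of_mem_nhds (Ici_mem_nhds h)]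
      exact deriv_eq_of_separatrix hs hlim hode s h
    · exact (continuousOn_const.mul
        (Real.continuous_sin.comp_continuousOn (hs.continuousOn.div_const 2))).neg
    · rw [closure_Ioi]
  intro s h
  have hd : ∀ t ∈ Ico 0 s, HasDerivWithinAt ϑ (-(√2 * Real.sin (ϑ t / 2))) (Ici t) t := by
    intro t ht
    have h1 := heq ht.1
    beta_reduce at h1
    rw [← h1]
    exact (hs.differentiableOn (by simp) t ht.1).hasDerivWithinAt.mono (Ici_subset_Ici.2 ht.1)
  refine ODE_solution_unique_of_mem_Icc_right (a := 0) (b := s) (K := 1) (s := fun _ => univ)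
    (v := fun _ y => -(√2 * Real.sin (y / 2))) (f := ϑ) (g := borderAngle θ)
    (fun t _ => lipschitzWith_separatrix.lipschitzOnWith) (hs.continuousOn.mono Icc_subset_Ici_self)
    hd (fun _ _ => trivial) (contDiff_borderAngle θ).continuous.continuousOn
    (fun t _ => (hasDerivAt_borderAngle θ t).hasDerivWithinAt) (fun _ _ => trivial) ?_ ⟨h, le_rfl⟩
  rw [h0, borderAngle_zero ⟨by linarith [hθ.1], by linarith [hθ.2]⟩]

theorem IsBorderlineElastica.eqOn_borderCurve {θ : ℝ} (hθ : θ ∈ Icc (-Real.pi) Real.pi)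
    {η : ℝ → Plane} (hη : IsBorderlineElastica θ η) : EqOn η (borderCurve θ) (Ici 0) := by
  obtain ⟨hs, hn, h0, ϑ, ⟨hϑ, hdir⟩, hϑ0, hlim, hode⟩ := hη
  have heq := eq_borderAngle hθ hϑ hϑ0 hlim hode
  have hd : ∀ t ∈ Ici (0 : ℝ), HasDerivWithinAt η (dir (borderAngle θ t)) (Ici 0) t := by
    intro t ht
    rw [← heq ht, ← one_smul ℝ (dir (ϑ t)), ← hn t ht, ← hdir t ht]
    exact (hs.differentiableOn (by simp) t ht).hasDerivWithinAt
  intro s h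
  have hcont : ContinuousOn (fun t => η t - borderCurve θ t) (Icc 0 s) := fun t ht =>
    (((hd t ht.1).sub (hasDerivAt_borderCurve θ t).hasDerivWithinAt).continuousWithinAt).mono
      Icc_subset_Ici_self
  have := constant_of_has_deriv_right_zero hcont (fun t ht => by
    have h1 := ((hd t ht.1).mono (Ici_subset_Ici.2 ht.1)).sub
      (hasDerivAt_borderCurve θ t).hasDerivWithinAt
    rw [sub_self] at h1
    exact h1) s ⟨h, le_rfl⟩
  rw [borderCurve_zero, h0] at this
  have hz : (!₂[0, 0] : Plane) = 0 := plane_ext (by simp) (by simp)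
  rw [hz, sub_zero, sub_eq_zero] at this
  exact this

/-! ### Convergence of all derivatives along flows. -/

theorem tendstoUniformlyOn_comp {E V : Type*} [UniformSpace E] [UniformSpace V] {g : E → V}
    (hg : Continuous g) {ι : Type*} {F : Filter ι} {Z : ι → ℝ → E} {Z₀ : ℝ → E} {c : ℝ} (hZ₀ : ContinuousOn Z₀ (Icc 0 c))
    (h : TendstoUniformlyOn Z Z₀ F (Icc 0 c)) :
    TendstoUniformlyOn (fun i => g ∘ Z i) (g ∘ Z₀) F (Icc 0 c) := by
  intro u hu
  have h1 := (isCompact_Icc.image_of_continuousOn hZ₀).uniformContinuousAt_of_continuousAt g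
    (fun a _ => hg.continuousAt) hu
  filter_upwards [h _ h1] with i hi t ht
  exact hi t ht (mem_image_of_mem _ ht)

section FlowConvergence

variable {E V : Type*} [NormedAddCommGroup E] [NormedSpace ℝ E] [NormedAddCommGroup V]
  [NormedSpace ℝ V]

theorem HasDerivWithinAt.Ici_of_Icc {y : ℝ → E} {y' : E} {c t : ℝ}
    (h : HasDerivWithinAt y y' (Icc 0 c) t) (ht : t ∈ Ico 0 c) : HasDerivWithinAt y y' (Ici t) t :=
  h.mono_of_mem_nhdsWithin (mem_of_superset (Icc_mem_nhdsGE ht.2) (Icc_subset_Icc_left ht.1))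

/-- The trajectories stay in one closed ball, on which the smooth field is Lipschitz, so Gronwall's
inequality transports the convergence of the initial values. -/
theorem tendstoUniformlyOn_of_ode [ProperSpace E] {f : E → E} (hf : ContDiff ℝ ∞ f) {ι : Type*}
    {F : Filter ι} {Z : ι → ℝ → E} {Z₀ : ℝ → E} {c R : ℝ}
    (hZ : ∀ᶠ i in F, ∀ t ∈ Icc 0 c,
      HasDerivWithinAt (Z i) (f (Z i t)) (Icc 0 c) t ∧ ‖Z i t‖ ≤ R)
    (hZ₀ : ∀ t ∈ Icc 0 c, HasDerivWithinAt Z₀ (f (Z₀ t)) (Icc 0 c) t ∧ ‖Z₀ t‖ ≤ R)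
    (h0 : Tendsto (fun i => Z i 0) F (𝓝 (Z₀ 0))) : TendstoUniformlyOn Z Z₀ F (Icc 0 c) := by
  obtain ⟨K, hK⟩ := hf.contDiffOn.exists_lipschitzOnWith (by simp) (convex_closedBall (0 : E) R)
    (isCompact_closedBall 0 R)
  rw [Metric.tendstoUniformlyOn_iff]
  intro ε hε
  have hlim : Tendsto (fun i => dist (Z i 0) (Z₀ 0) * Real.exp (K * c)) F (𝓝 0) := by
    simpa using (tendsto_iff_dist_tendsto_zero.1 h0).mul_const (Real.exp (K * c))
  filter_upwards [hZ, hlim.eventually (gt_mem_nhds hε)] with i hi hlt t ht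
  have := dist_le_of_trajectories_ODE_of_mem (v := fun _ => f) (s := fun _ => Metric.closedBall 0 R)
    (K := K) (a := 0) (b := c) (f := Z i) (g := Z₀) (fun _ _ => hK)
    (fun t ht => (hi t ht).1.continuousWithinAt)
    (fun t ht => HasDerivWithinAt.Ici_of_Icc (hi t (Ico_subset_Icc_self ht)).1 ht)
    (fun t ht => mem_closedBall_zero_iff.2 (hi t (Ico_subset_Icc_self ht)).2)
    (fun t ht => (hZ₀ t ht).1.continuousWithinAt)
    (fun t ht => HasDerivWithinAt.Ici_of_Icc (hZ₀ t (Ico_subset_Icc_self ht)).1 ht)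
    (fun t ht => mem_closedBall_zero_iff.2 (hZ₀ t (Ico_subset_Icc_self ht)).2) le_rfl t ht
  rw [dist_comm]
  refine (this.trans ?_).trans_lt hlt
  gcongr
  linarith [ht.2]

/-- Derivative of an observable along the flow of `f`. -/
noncomputable def flowDeriv (f : E → E) (g : E → V) (z : E) : V := fderiv ℝ g z (f z)

theorem contDiff_flowDeriv {f : E → E} {g : E → V} (hf : ContDiff ℝ ∞ f) (hg : ContDiff ℝ ∞ g) :
    ContDiff ℝ ∞ (flowDeriv f g) :=
  (hg.fderiv_right (m := ∞) (by simp)).clm_apply hf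

theorem contDiff_flowDeriv_iterate {f : E → E} {g : E → V} (hf : ContDiff ℝ ∞ f)
    (hg : ContDiff ℝ ∞ g) (k : ℕ) : ContDiff ℝ ∞ ((flowDeriv f)^[k] g) := by
  induction k generalizing g with
  | zero => exact hg
  | succ k ih => exact ih (contDiff_flowDeriv hf hg)

/-- Time derivatives along a trajectory are again smooth functions of the state. Uniform convergence
of the states therefore gives convergence of derivatives of every order. -/
theorem iteratedDerivWithin_flow {f : E → E} {g : E → V} (hf : ContDiff ℝ ∞ f)
    (hg : ContDiff ℝ ∞ g) {c : ℝ} (hc : 0 < c) {y : ℝ → E}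
    (hy : ∀ t ∈ Icc 0 c, HasDerivWithinAt y (f (y t)) (Icc 0 c) t) (k : ℕ) :
    EqOn (iteratedDerivWithin k (g ∘ y) (Icc 0 c)) ((flowDeriv f)^[k] g ∘ y) (Icc 0 c) := by
  induction k generalizing g with
  | zero => intro t _; simp
  | succ k ih =>
    rw [iteratedDerivWithin_succ']
    have h : EqOn (derivWithin (g ∘ y) (Icc 0 c)) (flowDeriv f g ∘ y) (Icc 0 c) := fun t ht =>
      ((hg.differentiable (by simp) (y t)).hasFDerivAt.comp_hasDerivWithinAt t
        (hy t ht)).derivWithin (uniqueDiffOn_Icc hc t ht)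
    exact (iteratedDerivWithin_congr h).trans (ih (contDiff_flowDeriv hf hg))

theorem tendstoUniformlyOn_iteratedDerivWithin [ProperSpace E] {f : E → E} (hf : ContDiff ℝ ∞ f)
    {g : E → V} (hg : ContDiff ℝ ∞ g) {ι : Type*} {F : Filter ι} {Z : ι → ℝ → E} {Z₀ : ℝ → E}
    {c R : ℝ} (hc : 0 < c)
    (hZ : ∀ᶠ i in F, ∀ t ∈ Icc 0 c,
      HasDerivWithinAt (Z i) (f (Z i t)) (Icc 0 c) t ∧ ‖Z i t‖ ≤ R)
    (hZ₀ : ∀ t ∈ Icc 0 c, HasDerivWithinAt Z₀ (f (Z₀ t)) (Icc 0 c) t ∧ ‖Z₀ t‖ ≤ R)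
    (h0 : Tendsto (fun i => Z i 0) F (𝓝 (Z₀ 0))) (k : ℕ) :
    TendstoUniformlyOn (fun i => iteratedDerivWithin k (g ∘ Z i) (Icc 0 c))
      (iteratedDerivWithin k (g ∘ Z₀) (Icc 0 c)) F (Icc 0 c) := by
  have h := tendstoUniformlyOn_comp (contDiff_flowDeriv_iterate hf hg k).continuous
    (fun t ht => (hZ₀ t ht).1.continuousWithinAt) (tendstoUniformlyOn_of_ode hf hZ hZ₀ h0)
  refine (h.congr ?_).congr_right
    (iteratedDerivWithin_flow hf hg hc (fun t ht => (hZ₀ t ht).1) k).symm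
  filter_upwards [hZ] with i hi
  exact (iteratedDerivWithin_flow hf hg hc (fun t ht => (hi t ht).1) k).symm

end FlowConvergence

/-- State space of the elastica equation: position, tangential angle, curvature, multiplier. -/
abbrev ElasticaState : Type := Plane × ℝ × ℝ × ℝ × ℝ

/-- The elastica equation as an autonomous vector field. -/
noncomputable def elasticaField (z : ElasticaState) : ElasticaState :=
  (dir z.2.1, z.2.2.1, (z.2.2.2.1 * Real.sin z.2.1 - z.2.2.2.2 * Real.cos z.2.1) / 2, 0, 0)

theorem contDiff_elasticaField : ContDiff ℝ ∞ elasticaField := by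
  have h : ContDiff ℝ ∞ fun z : ElasticaState => z.2.1 := contDiff_fst.comp contDiff_snd
  have h2 : ContDiff ℝ ∞ fun z : ElasticaState => z.2.2 := contDiff_snd.comp contDiff_snd
  have h3 : ContDiff ℝ ∞ fun z : ElasticaState => z.2.2.2 := contDiff_snd.comp h2
  exact (contDiff_dir.comp h).prodMk ((contDiff_fst.comp h2).prodMk
    (((((contDiff_fst.comp h3).mul h.sin).sub ((contDiff_snd.comp h3).mul h.cos)).div_const 2).prodMk
      contDiff_const))

/-! ### Lower energy bound and multiplier estimate. -/

section Profile

variable {T p q : ℝ} {ϑ κ : ℝ → ℝ}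

theorem Profile.continuousOn_angle (h : Profile T p q ϑ κ) : ContinuousOn ϑ (Icc 0 T) :=
  fun s hs => (h.angle s hs).continuousWithinAt

theorem Profile.continuousOn_curv (h : Profile T p q ϑ κ) : ContinuousOn κ (Icc 0 T) :=
  fun s hs => (h.curv s hs).continuousWithinAt

theorem Profile.continuousOn_density (h : Profile T p q ϑ κ) :
    ContinuousOn (fun s => κ s ^ 2 + (1 - Real.cos (ϑ s))) (Icc 0 T) :=
  (h.continuousOn_curv.pow 2).add
    (continuousOn_const.sub (Real.continuous_cos.comp_continuousOn h.continuousOn_angle))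

theorem density_nonneg (ϑ κ : ℝ → ℝ) (s : ℝ) : 0 ≤ κ s ^ 2 + (1 - Real.cos (ϑ s)) :=
  add_nonneg (sq_nonneg _) (sub_nonneg.2 (Real.cos_le_one _))

theorem Profile.intervalIntegrable (h : Profile T p q ϑ κ) {f : ℝ → ℝ}
    (hf : ContinuousOn f (Icc 0 T)) {a b : ℝ} (ha : a ∈ Icc 0 T) (hb : b ∈ Icc 0 T) :
    IntervalIntegrable f MeasureTheory.volume a b :=
  (hf.mono (by
    rw [← uIcc_of_le h.pos.le] at ha hb ⊢
    exact uIcc_subset_uIcc ha hb)).intervalIntegrable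

/-- Modica-Mortola inequality on a subinterval. -/
theorem Profile.variation_le (h : Profile T p q ϑ κ) {a b : ℝ} (ha : 0 ≤ a) (hab : a ≤ b)
    (hb : b ≤ T) : 4 * √2 * |Real.cos (ϑ b / 2) - Real.cos (ϑ a / 2)| ≤
      ∫ s in a..b, (κ s ^ 2 + (1 - Real.cos (ϑ s))) := by
  have hsub : Icc a b ⊆ Icc 0 T := Icc_subset_Icc ha hb
  have hd : ∀ s ∈ Icc a b, HasDerivWithinAt (fun s => Real.cos (ϑ s / 2))
      (-Real.sin (ϑ s / 2) * (κ s / 2)) (Icc a b) s := fun s hs =>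
    (((h.angle s (hsub hs)).mono hsub).div_const 2).cos
  have hc : ContinuousOn (fun s => -Real.sin (ϑ s / 2) * (κ s / 2)) (Icc a b) :=
    ((Real.continuous_sin.comp_continuousOn (h.continuousOn_angle.div_const 2)).neg.mul
      (h.continuousOn_curv.div_const 2)).mono hsub
  have h2 : (0 : ℝ) ≤ 4 * √2 := by positivity
  rw [← intervalIntegral_eq_sub_Icc hab hd hc, ← abs_of_nonneg h2, ← abs_mul,
    ← intervalIntegral.integral_const_mul]
  refine (intervalIntegral.abs_integral_le_integral_abs hab).trans
    (intervalIntegral.integral_mono_on hab ?_ ?_ fun s hs => ?_)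
  · rw [← uIcc_of_le hab] at hc
    exact (continuousOn_const.mul hc).abs.intervalIntegrable
  · exact h.intervalIntegrable h.continuousOn_density ⟨ha, hab.trans hb⟩ ⟨ha.trans hab, hb⟩
  -- This is 2|κ b| ≤ κ² + b² with b = √2 sin(ϑ/2); the two signs are the two squares below.
  · rw [← two_mul_sin_half_sq, abs_le]
    have e : 4 * √2 * (-Real.sin (ϑ s / 2) * (κ s / 2)) =
        -(2 * (κ s * (√2 * Real.sin (ϑ s / 2)))) := by ring
    have e2 : 2 * Real.sin (ϑ s / 2) ^ 2 = (√2 * Real.sin (ϑ s / 2)) ^ 2 := by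
      linear_combination -Real.sin (ϑ s / 2) ^ 2 * sqrt_two_sq
    rw [e, e2]
    constructor
    · nlinarith [sq_nonneg (κ s - √2 * Real.sin (ϑ s / 2))]
    · nlinarith [sq_nonneg (κ s + √2 * Real.sin (ϑ s / 2))]

theorem Profile.integral_add (h : Profile T p q ϑ κ) {a b c : ℝ} (ha : a ∈ Icc 0 T)
    (hb : b ∈ Icc 0 T) (hc : c ∈ Icc 0 T) :
    (∫ s in a..b, (κ s ^ 2 + (1 - Real.cos (ϑ s)))) + (∫ s in b..c, (κ s ^ 2 + (1 - Real.cos (ϑ s))))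
      = ∫ s in a..c, (κ s ^ 2 + (1 - Real.cos (ϑ s))) :=
  intervalIntegral.integral_add_adjacent_intervals (h.intervalIntegrable h.continuousOn_density ha hb)
    (h.intervalIntegrable h.continuousOn_density hb hc)

/-- Three intermediate times serve the applications: the end of the initial layer, an arbitrary
time, and a time at which the curve is nearly horizontal. -/
theorem Profile.variation_le_three (h : Profile T p q ϑ κ) {a b c : ℝ} (ha : 0 ≤ a) (hab : a ≤ b)
    (hbc : b ≤ c) (hc : c ≤ T) :
    4 * √2 * (|Real.cos (ϑ a / 2) - Real.cos (ϑ 0 / 2)| + |Real.cos (ϑ b / 2) - Real.cos (ϑ a / 2)|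
      + |Real.cos (ϑ c / 2) - Real.cos (ϑ b / 2)| + |Real.cos (ϑ T / 2) - Real.cos (ϑ c / 2)|)
      ≤ excess T ϑ κ := by
  have h1 := h.variation_le le_rfl ha (by linarith)
  have h2 := h.variation_le ha hab (by linarith)
  have h3 := h.variation_le (by linarith) hbc hc
  have h4 := h.variation_le (by linarith) hc le_rfl
  have m0 : (0 : ℝ) ∈ Icc 0 T := ⟨le_rfl, h.pos.le⟩
  have mT : T ∈ Icc 0 T := ⟨h.pos.le, le_rfl⟩
  have ma : a ∈ Icc 0 T := ⟨ha, by linarith⟩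
  have mb : b ∈ Icc 0 T := ⟨by linarith, by linarith⟩
  have mc : c ∈ Icc 0 T := ⟨by linarith, hc⟩
  rw [excess, ← h.integral_add m0 mc mT, ← h.integral_add m0 mb mc, ← h.integral_add m0 ma mb]
  linarith

/-- Some point in the second half is almost horizontal. -/
theorem Profile.exists_flat (h : Profile T p q ϑ κ) {η : ℝ} (hT : excess T ϑ κ < T * η) :
    ∃ b ∈ Icc (T / 2) T, 1 - η ≤ |Real.cos (ϑ b / 2)| := by
  by_contra! hcon
  have hT2 : T / 2 ∈ Icc 0 T := ⟨by linarith [h.pos], by linarith [h.pos]⟩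
  have mT : T ∈ Icc 0 T := ⟨h.pos.le, le_rfl⟩
  have h0 : (0 : ℝ) ∈ Icc 0 T := ⟨le_rfl, h.pos.le⟩
  -- If |cos(ϑ/2)| < 1 − η, then 1 − cos ϑ = 2(1 − cos²(ϑ/2)) ≥ 2η; over the second half this
  -- already adds up to T η.
  have h1 : ∫ s in (T / 2)..T, 2 * η ≤ ∫ s in (T / 2)..T, (κ s ^ 2 + (1 - Real.cos (ϑ s))) := by
    refine intervalIntegral.integral_mono_on hT2.2 (by simp)
      (h.intervalIntegrable h.continuousOn_density hT2 mT) fun s hs => ?_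
    have h3 := hcon s hs
    have h4 := Real.cos_two_mul (ϑ s / 2)
    rw [mul_div_cancel₀ (ϑ s) two_ne_zero] at h4
    have h5 := Real.abs_cos_le_one (ϑ s / 2)
    have h6 := sq_abs (Real.cos (ϑ s / 2))
    nlinarith [sq_nonneg (κ s), abs_nonneg (Real.cos (ϑ s / 2))]
  have h2 : 0 ≤ ∫ s in (0 : ℝ)..(T / 2), (κ s ^ 2 + (1 - Real.cos (ϑ s))) :=
    intervalIntegral.integral_nonneg hT2.1 fun s _ => density_nonneg ϑ κ s
  rw [excess, ← h.integral_add h0 hT2 mT] at hT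
  rw [intervalIntegral.integral_const, smul_eq_mul] at h1
  linarith

/-- The multiplier is controlled by the excess energy. -/
theorem Profile.multiplier_le (h : Profile T p q ϑ κ) {x : ℝ → Plane} {X : ℝ}
    (hx : ∀ s ∈ Icc 0 T, HasDerivWithinAt x (dir (ϑ s)) (Icc 0 T) s) (h0 : x 0 = 0)
    (hX : x T = !₂[X, 0]) :
    (|p - 1| + |q|) * (T - 8) ≤ 7 * excess T ϑ κ + 16 := by
  have m0 : (0 : ℝ) ∈ Icc 0 T := ⟨le_rfl, h.pos.le⟩
  have mT : T ∈ Icc 0 T := ⟨h.pos.le, le_rfl⟩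
  have hcos := Real.continuous_cos.comp_continuousOn h.continuousOn_angle
  have hsin := Real.continuous_sin.comp_continuousOn h.continuousOn_angle
  have hκ2 : ContinuousOn (fun s => κ s ^ 2) (Icc 0 T) := h.continuousOn_curv.pow 2
  have hcosd : ContinuousOn (fun s => 1 - Real.cos (ϑ s)) (Icc 0 T) := continuousOn_const.sub hcos
  -- The conservation law gives κ² ≤ 2 + |p − 1| + |q|, which is at most the square of the right
  -- side.
  have hm : ∀ s ∈ Icc 0 T, |κ s| ≤ 2 + (|p - 1| + |q|) := by
    intro s hs
    have h1 := h.sq s hs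
    have h2 : -(p * Real.cos (ϑ s)) ≤ 1 + |p - 1| := by
      have : |p * Real.cos (ϑ s)| ≤ |p| := by
        rw [abs_mul]; exact mul_le_of_le_one_right (abs_nonneg _) (Real.abs_cos_le_one _)
      have h3 : |p| ≤ |p - 1| + 1 := by
        have := abs_add_le (p - 1) 1
        simpa using this
      linarith [neg_abs_le (p * Real.cos (ϑ s))]
    have h3 : -(q * Real.sin (ϑ s)) ≤ |q| := by
      have : |q * Real.sin (ϑ s)| ≤ |q| := by
        rw [abs_mul]; exact mul_le_of_le_one_right (abs_nonneg _) (Real.abs_sin_le_one _)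
      linarith [neg_abs_le (q * Real.sin (ϑ s))]
    refine abs_le_of_sq_le_sq' ?_ (by positivity) |> abs_le.2
    nlinarith [abs_nonneg (p - 1), abs_nonneg q]
  set y := |p - 1| + |q| with hy
  have hE1 : (∫ s in (0 : ℝ)..T, κ s ^ 2) + (∫ s in (0 : ℝ)..T, (1 - Real.cos (ϑ s))) =
      excess T ϑ κ := (intervalIntegral.integral_add (h.intervalIntegrable hκ2 m0 mT)
        (h.intervalIntegrable hcosd m0 mT)).symm
  have hE2 : 0 ≤ ∫ s in (0 : ℝ)..T, κ s ^ 2 :=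
    intervalIntegral.integral_nonneg h.pos.le fun s _ => sq_nonneg _
  have hE3 : 0 ≤ ∫ s in (0 : ℝ)..T, (1 - Real.cos (ϑ s)) :=
    intervalIntegral.integral_nonneg h.pos.le fun s _ => sub_nonneg.2 (Real.cos_le_one _)
  have hXT : T - X = ∫ s in (0 : ℝ)..T, (1 - Real.cos (ϑ s)) := by
    have h1 := intervalIntegral_eq_sub_Icc h.pos.le
      (fun s hs => (hasDerivWithinAt_plane.1 (hx s hs)).1) hcos
    rw [hX, h0] at h1
    simp only [dir_zero, Matrix.cons_val_zero, PiLp.zero_apply, sub_zero] at h1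
    rw [intervalIntegral.integral_sub (g := fun s => Real.cos (ϑ s)) (by simp)
      (h.intervalIntegrable hcos m0 mT), h1]
    simp
  have hbd : ∀ g : ℝ → ℝ, ContinuousOn g (Icc 0 T) → (∀ s, |g s| ≤ 1) →
      |∫ s in (0 : ℝ)..T, 3 * κ s ^ 2 * g s| ≤ 3 * ∫ s in (0 : ℝ)..T, κ s ^ 2 := by
    intro g hg hg1
    rw [← intervalIntegral.integral_const_mul]
    have hc : ContinuousOn (fun s => 3 * κ s ^ 2 * g s) (Icc 0 T) :=
      (continuousOn_const.mul hκ2).mul hg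
    refine (intervalIntegral.abs_integral_le_integral_abs h.pos.le).trans
      (intervalIntegral.integral_mono_on h.pos.le (h.intervalIntegrable hc.abs m0 mT)
        (h.intervalIntegrable (continuousOn_const.mul hκ2) m0 mT) fun s _ => ?_)
    rw [abs_mul, abs_of_nonneg (by positivity : 0 ≤ 3 * κ s ^ 2)]
    exact mul_le_of_le_one_right (by positivity) (hg1 s)
  have hend : ∀ (g : ℝ → ℝ), (∀ x, |g x| ≤ 1) → ∀ s ∈ Icc 0 T, |2 * (κ s * g (ϑ s))| ≤ 2 * (2 + y) := by
    intro g hg s hs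
    rw [abs_mul, abs_mul, abs_of_pos (by norm_num : (0 : ℝ) < 2)]
    have := hm s hs
    have h1 := mul_le_of_le_one_right (abs_nonneg (κ s)) (hg (ϑ s))
    linarith
  -- Integrating (2κ sin ϑ − p s + x₀)' = 3κ² cos ϑ, where x₀ is the horizontal coordinate,
  -- expresses (p − 1)T through boundary terms, T − X and ∫ κ² cos ϑ. The bound for q uses −2κ cos ϑ
  -- − q s + x₁ with the vertical coordinate x₁.
  have hp : |p - 1| * T ≤ 4 * excess T ϑ κ + 4 * (2 + y) := by
    have hH : ∀ s ∈ Icc 0 T, HasDerivWithinAt (fun s => 2 * (κ s * Real.sin (ϑ s)) - p * s + x s 0)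
        (3 * κ s ^ 2 * Real.cos (ϑ s)) (Icc 0 T) s := by
      intro s hs
      have h1 := (((((h.curv s hs).mul (h.angle s hs).sin).const_mul 2).sub
        ((hasDerivWithinAt_id s _).const_mul p)).add (hasDerivWithinAt_plane.1 (hx s hs)).1)
      refine h1.congr_deriv ?_
      rw [dir_zero]
      linear_combination p * Real.sin_sq_add_cos_sq (ϑ s) - Real.cos (ϑ s) * h.sq s hs
    have h1 := intervalIntegral_eq_sub_Icc h.pos.le hH ((continuousOn_const.mul hκ2).mul hcos)
    have h2 := abs_le.1 (hbd (fun s => Real.cos (ϑ s)) hcos fun s => Real.abs_cos_le_one _)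
    have h3 := abs_le.1 (hend Real.sin Real.abs_sin_le_one T mT)
    have h4 := abs_le.1 (hend Real.sin Real.abs_sin_le_one 0 m0)
    rw [h1, hX, h0] at h2
    simp only [PiLp.zero_apply, Matrix.cons_val_zero, mul_zero] at h2
    rw [← abs_of_pos h.pos, ← abs_mul, abs_of_pos h.pos, abs_le]
    constructor <;> linarith [h2.1, h2.2, h3.1, h3.2, h4.1, h4.2]
  have hq : |q| * T ≤ 3 * excess T ϑ κ + 4 * (2 + y) := by
    have hH : ∀ s ∈ Icc 0 T, HasDerivWithinAt (fun s => -(2 * (κ s * Real.cos (ϑ s))) - q * s + x s 1)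
        (3 * κ s ^ 2 * Real.sin (ϑ s)) (Icc 0 T) s := by
      intro s hs
      have h1 := (((((h.curv s hs).mul (h.angle s hs).cos).const_mul 2).neg.sub
        ((hasDerivWithinAt_id s _).const_mul q)).add (hasDerivWithinAt_plane.1 (hx s hs)).2)
      refine h1.congr_deriv ?_
      rw [dir_one]
      linear_combination q * Real.sin_sq_add_cos_sq (ϑ s) - Real.sin (ϑ s) * h.sq s hs
    have h1 := intervalIntegral_eq_sub_Icc h.pos.le hH ((continuousOn_const.mul hκ2).mul hsin)
    have h2 := abs_le.1 (hbd (fun s => Real.sin (ϑ s)) hsin fun s => Real.abs_sin_le_one _)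
    have h3 := abs_le.1 (hend Real.cos Real.abs_cos_le_one T mT)
    have h4 := abs_le.1 (hend Real.cos Real.abs_cos_le_one 0 m0)
    rw [h1, hX, h0] at h2
    simp only [PiLp.zero_apply, Matrix.cons_val_one, Matrix.cons_val_fin_one, mul_zero] at h2
    rw [← abs_of_pos h.pos, ← abs_mul, abs_of_pos h.pos, abs_le]
    constructor <;> linarith [h2.1, h2.2, h3.1, h3.2, h4.1, h4.2]
  -- Adding both bounds puts 8(|p − 1| + |q|) on the right; absorbing it produces T − 8.
  rw [hy] at hp hq ⊢
  linarith

/-- For a curve x this is the profile of x(T) − x(T − s), reversed and reflected at a point: the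
tangent is not flipped, so the multiplier is the same, while the curvature changes sign. -/
theorem Profile.reverse (h : Profile T p q ϑ κ) (k : ℤ) :
    Profile T p q (fun s => ϑ (T - s) - k * (2 * Real.pi)) (fun s => -κ (T - s)) := by
  have hm : MapsTo (fun s => T - s) (Icc 0 T) (Icc 0 T) := fun s hs =>
    ⟨by linarith [hs.2], by linarith [hs.1]⟩
  have hr : ∀ s, HasDerivWithinAt (fun s => T - s) (-1) (Icc 0 T) s := fun s =>
    ((hasDerivAt_id s).const_sub T).hasDerivWithinAt
  refine ⟨h.pos, fun s hs => ?_, fun s hs => ?_, fun s hs => ?_⟩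
  · refine (((h.angle _ (hm hs)).scomp s (hr s) hm).sub_const _).congr_deriv ?_
    simp
  · refine ((h.curv _ (hm hs)).scomp s (hr s) hm).neg.congr_deriv ?_
    simp [Real.sin_sub_int_mul_two_pi, Real.cos_sub_int_mul_two_pi]
  · simp only [Real.sin_sub_int_mul_two_pi, Real.cos_sub_int_mul_two_pi, neg_sq]
    exact h.sq _ (hm hs)

theorem excess_reverse (T : ℝ) (ϑ κ : ℝ → ℝ) (k : ℤ) :
    excess T (fun s => ϑ (T - s) - k * (2 * Real.pi)) (fun s => -κ (T - s)) = excess T ϑ κ := by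
  simp only [excess, Real.cos_sub_int_mul_two_pi, neg_sq]
  rw [intervalIntegral.integral_comp_sub_left (fun s => κ s ^ 2 + (1 - Real.cos (ϑ s))) T, sub_self,
    sub_zero]

end Profile

/-! ### Asymptotics of families of profiles with boundary layers. -/

theorem abs_cos_add_int_mul_pi (x : ℝ) (n : ℤ) : |Real.cos (x + n * Real.pi)| = |Real.cos x| := by
  rw [Real.cos_add_int_mul_pi, abs_mul, abs_neg_one_zpow, one_mul]

theorem abs_sin_add_int_mul_pi (x : ℝ) (n : ℤ) : |Real.sin (x + n * Real.pi)| = |Real.sin x| := by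
  rw [Real.sin_add_int_mul_pi, abs_mul, abs_neg_one_zpow, one_mul]

/-- A family of elastica profiles with the asymptotics of minimizers: the length tends to infinity,
the multiplier to that of the borderline elastica, the initial angle to `θ`, and the excess energy is
asymptotically at most that of two optimal boundary layers. -/
structure LayerFamily {ι : Type*} (F : Filter ι) (T p q : ι → ℝ) (ϑ κ : ι → ℝ → ℝ) (θ : ℝ) :
    Prop where
  profile : ∀ᶠ i in F, Profile (T i) (p i) (q i) (ϑ i) (κ i)
  length_lim : Tendsto T F atTop
  fst_lim : Tendsto p F (𝓝 1)
  snd_lim : Tendsto q F (𝓝 0)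
  angle_lim : Tendsto (fun i => ϑ i 0) F (𝓝 θ)
  excess_le : ∀ δ > 0, ∀ᶠ i in F, excess (T i) (ϑ i) (κ i) ≤
    4 * √2 * (2 - |Real.cos (ϑ i 0 / 2)| - |Real.cos (ϑ i (T i) / 2)|) + δ

namespace LayerFamily

variable {ι : Type*} {F : Filter ι} {T p q : ι → ℝ} {ϑ κ : ι → ℝ → ℝ} {θ : ℝ}

theorem mono (h : LayerFamily F T p q ϑ κ θ) {F' : Filter ι} (hF : F' ≤ F) :
    LayerFamily F' T p q ϑ κ θ :=
  ⟨h.profile.filter_mono hF, h.length_lim.mono_left hF, h.fst_lim.mono_left hF,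
    h.snd_lim.mono_left hF, h.angle_lim.mono_left hF, fun δ hδ => (h.excess_le δ hδ).filter_mono hF⟩

theorem curv_bound (h : LayerFamily F T p q ϑ κ θ) :
    ∀ᶠ i in F, |p i| ≤ 2 ∧ |q i| ≤ 1 ∧ ∀ s ∈ Icc 0 (T i), |κ i s| ≤ 2 := by
  have h1 : ∀ᶠ i in F, |p i| < 2 := h.fst_lim.abs.eventually (gt_mem_nhds (by norm_num))
  have h2 : ∀ᶠ i in F, |q i| < 1 := h.snd_lim.abs.eventually (gt_mem_nhds (by norm_num))
  filter_upwards [h.profile, h1, h2] with i hi hp hq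
  refine ⟨hp.le, hq.le, fun s hs => ?_⟩
  have h3 : |p i * Real.cos (ϑ i s)| ≤ |p i| := by
    rw [abs_mul]; exact mul_le_of_le_one_right (abs_nonneg _) (Real.abs_cos_le_one _)
  have h4 : |q i * Real.sin (ϑ i s)| ≤ |q i| := by
    rw [abs_mul]; exact mul_le_of_le_one_right (abs_nonneg _) (Real.abs_sin_le_one _)
  have h5 := hi.sq s hs
  refine abs_le_of_sq_le_sq' ?_ (by norm_num) |> abs_le.2
  linarith [neg_abs_le (p i * Real.cos (ϑ i s)), neg_abs_le (q i * Real.sin (ϑ i s))]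

theorem norm_state_le {x : Plane} {a b c d R : ℝ} (hx : ‖x‖ ≤ R) (ha : |a| ≤ R) (hb : |b| ≤ R)
    (hc : |c| ≤ R) (hd : |d| ≤ R) : ‖((x, a, b, c, d) : ElasticaState)‖ ≤ R := by
  simp only [Prod.norm_def, Real.norm_eq_abs, max_le_iff]
  exact ⟨hx, ha, hb, hc, hd⟩

theorem hasDerivWithinAt_state {x : ℝ → Plane} {a b : ℝ → ℝ} {c d : ℝ} {D : Set ℝ} {s : ℝ}
    (hx : HasDerivWithinAt x (dir (a s)) D s) (ha : HasDerivWithinAt a (b s) D s)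
    (hb : HasDerivWithinAt b ((c * Real.sin (a s) - d * Real.cos (a s)) / 2) D s) :
    HasDerivWithinAt (fun s => ((x s, a s, b s, c, d) : ElasticaState))
      (elasticaField (x s, a s, b s, c, d)) D s :=
  hx.prodMk (ha.prodMk (hb.prodMk ((hasDerivWithinAt_const s D c).prodMk
    (hasDerivWithinAt_const s D d))))

/-- Convergence to the borderline elastica once the initial curvature converges. -/
theorem tendsto_borderline (h : LayerFamily F T p q ϑ κ θ) {θ' : ℝ} (k : ℤ)
    (hθ' : θ' ∈ Ioo (-(2 * Real.pi)) (2 * Real.pi)) (hk : θ = θ' + k * (2 * Real.pi))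
    (hκ : Tendsto (fun i => κ i 0) F (𝓝 (borderCurv θ' 0))) {x : ι → ℝ → Plane}
    (hx : ∀ᶠ i in F, x i 0 = 0 ∧
      ∀ s ∈ Icc 0 (T i), HasDerivWithinAt (x i) (dir (ϑ i s)) (Icc 0 (T i)) s) :
    TendstoSmoothLoc x T F (borderCurve θ') ∧
      ∀ s : ℝ, 0 ≤ s → Tendsto (fun i => ϑ i s) F (𝓝 (borderAngle θ' s + k * (2 * Real.pi))) := by
  -- With the multiplier carried as constant components, continuous dependence on parameters becomes
  -- continuous dependence on initial values.
  let Z : ι → ℝ → ElasticaState := fun i s => (x i s, ϑ i s, κ i s, p i, q i)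
  let Z₀ : ℝ → ElasticaState := fun s =>
    (borderCurve θ' s, borderAngle θ' s + k * (2 * Real.pi), borderCurv θ' s, 1, 0)
  have hdirk : ∀ y : ℝ, dir (y + k * (2 * Real.pi)) = dir y := fun y =>
    plane_ext (Real.cos_add_int_mul_two_pi y k) (Real.sin_add_int_mul_two_pi y k)
  have hZ₀d : ∀ s, HasDerivAt Z₀ (elasticaField (Z₀ s)) s := fun s => by
    rw [← hasDerivWithinAt_univ]
    refine hasDerivWithinAt_state ?_ ?_ ?_
    · rw [hdirk]; exact (hasDerivAt_borderCurve θ' s).hasDerivWithinAt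
    · exact ((hasDerivAt_borderAngle θ' s).add_const _).hasDerivWithinAt
    · rw [Real.sin_add_int_mul_two_pi, one_mul, zero_mul, sub_zero]
      exact (hasDerivAt_borderCurv θ' s).hasDerivWithinAt
  have hZ₀c : Continuous Z₀ := continuous_iff_continuousAt.2 fun s => (hZ₀d s).continuousAt
  have hlim : Tendsto (fun i => Z i 0) F (𝓝 (Z₀ 0)) := by
    have e : Z₀ 0 = (0, θ, borderCurv θ' 0, 1, 0) := by
      simp only [Z₀, borderCurve_zero, borderAngle_zero hθ', ← hk]
    rw [e]
    refine Tendsto.prodMk_nhds ?_ (h.angle_lim.prodMk_nhds (hκ.prodMk_nhds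
      (h.fst_lim.prodMk_nhds h.snd_lim)))
    exact tendsto_const_nhds.congr' (hx.mono fun i hi => hi.1.symm)
  have key : ∀ c : ℝ, 0 < c → (∀ᶠ i in F, c ≤ T i ∧ ∀ s ∈ Icc 0 c,
      HasDerivWithinAt (Z i) (elasticaField (Z i s)) (Icc 0 c) s) ∧
      ∃ R : ℝ, (∀ᶠ i in F, ∀ s ∈ Icc 0 c,
        HasDerivWithinAt (Z i) (elasticaField (Z i s)) (Icc 0 c) s ∧ ‖Z i s‖ ≤ R) ∧
        ∀ s ∈ Icc 0 c, HasDerivWithinAt Z₀ (elasticaField (Z₀ s)) (Icc 0 c) s ∧ ‖Z₀ s‖ ≤ R := by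
    intro c hc
    have h1 : ∀ᶠ i in F, c ≤ T i ∧ ∀ s ∈ Icc 0 c,
        HasDerivWithinAt (Z i) (elasticaField (Z i s)) (Icc 0 c) s := by
      filter_upwards [h.profile, hx, h.length_lim.eventually_ge_atTop c] with i hi hxi hT
      have hsub : Icc 0 c ⊆ Icc 0 (T i) := Icc_subset_Icc_right hT
      exact ⟨hT, fun s hs => hasDerivWithinAt_state ((hxi.2 s (hsub hs)).mono hsub)
        ((hi.angle s (hsub hs)).mono hsub) ((hi.curv s (hsub hs)).mono hsub)⟩
    obtain ⟨R₀, hR₀⟩ := (isCompact_Icc (a := (0 : ℝ)) (b := c)).exists_bound_of_continuousOn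
      hZ₀c.continuousOn
    have hang : ∀ᶠ i in F, |ϑ i 0| < |θ| + 1 :=
      h.angle_lim.abs.eventually (gt_mem_nhds (by linarith))
    -- On [0, c] unit speed bounds the position by c, |κ| ≤ 2 bounds the angle by |θ| + 1 + 2c, and
    -- the remaining components are at most 2; R₀ bounds the limit trajectory.
    refine ⟨h1, max R₀ (|θ| + 1 + 2 * c + 2), ?_, fun s hs => ⟨(hZ₀d s).hasDerivWithinAt,
      (hR₀ s hs).trans (le_max_left _ _)⟩⟩
    filter_upwards [h1, h.profile, hx, h.curv_bound, hang] with i hi1 hi hxi hb hai s hs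
    refine ⟨hi1.2 s hs, le_trans ?_ (le_max_right _ _)⟩
    have hsub : Icc 0 c ⊆ Icc 0 (T i) := Icc_subset_Icc_right hi1.1
    have h0 : (0 : ℝ) ∈ Icc 0 c := ⟨le_rfl, hc.le⟩
    have hx1 := (convex_Icc 0 c).norm_image_sub_le_of_norm_hasDerivWithin_le (C := 1)
      (fun t ht => (hxi.2 t (hsub ht)).mono hsub) (fun t ht => by rw [norm_dir]) h0 hs
    have ha1 := (convex_Icc 0 c).norm_image_sub_le_of_norm_hasDerivWithin_le (C := 2)
      (fun t ht => (hi.angle t (hsub ht)).mono hsub) (fun t ht => hb.2.2 t (hsub ht)) h0 hs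
    rw [hxi.1, sub_zero, sub_zero, Real.norm_of_nonneg hs.1] at hx1
    rw [sub_zero, Real.norm_of_nonneg hs.1, Real.norm_eq_abs] at ha1
    have ha2 := abs_add_le (ϑ i s - ϑ i 0) (ϑ i 0)
    rw [sub_add_cancel] at ha2
    have hθ0 := abs_nonneg θ
    have := hs.2
    exact norm_state_le (by linarith) (by linarith) (by linarith [hb.2.2 s (hsub hs)])
      (by linarith [hb.1]) (by linarith [hb.2.1])
  have hfield := contDiff_elasticaField
  constructor
  · intro c hc
    obtain ⟨h1, R, h2, h3⟩ := key c hc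
    have hcd : ∀ {y : ℝ → ElasticaState}, (∀ s ∈ Icc 0 c,
        HasDerivWithinAt y (elasticaField (y s)) (Icc 0 c) s) →
        ContDiffOn ℝ ∞ (fun s => (y s).1) (Icc 0 c) := fun hy =>
      contDiff_fst.comp_contDiffOn (contDiffOn_of_ode hfield.contDiffOn (uniqueDiffOn_Icc hc)
        (mapsTo_univ _ _) hy)
    exact ⟨h1.mono fun i hi => ⟨hi.1, hcd hi.2⟩, hcd fun s hs => (h3 s hs).1, fun k =>
      tendstoUniformlyOn_iteratedDerivWithin hfield (g := Prod.fst) contDiff_fst hc h2 h3 hlim k⟩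
  · intro s hs
    obtain ⟨-, R, h2, h3⟩ := key (s + 1) (by linarith)
    have h4 := (tendstoUniformlyOn_of_ode hfield h2 h3 hlim).tendsto_at
      (show s ∈ Icc 0 (s + 1) from ⟨hs, by linarith⟩)
    exact (continuous_fst.tendsto _).comp ((continuous_snd.tendsto _).comp h4)

/-- The angle does not depend on a curve being given; one is manufactured by integrating `dir`. -/
theorem tendsto_angle [F.NeBot] (h : LayerFamily F T p q ϑ κ θ) {θ' : ℝ} (k : ℤ)
    (hθ' : θ' ∈ Ioo (-(2 * Real.pi)) (2 * Real.pi)) (hk : θ = θ' + k * (2 * Real.pi))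
    (hκ : Tendsto (fun i => κ i 0) F (𝓝 (borderCurv θ' 0))) {s : ℝ} (hs : 0 ≤ s) :
    Tendsto (fun i => ϑ i s) F (𝓝 (borderAngle θ' s + k * (2 * Real.pi))) := by
  have hex : ∀ᶠ i in F, ∃ y : ℝ → Plane, y 0 = 0 ∧
      ∀ s ∈ Icc 0 (T i), HasDerivWithinAt y (dir (ϑ i s)) (Icc 0 (T i)) s := by
    filter_upwards [h.profile] with i hi
    exact exists_primitive_unit hi.pos.le
      ((contDiff_dir (n := ∞)).continuous.comp_continuousOn hi.continuousOn_angle) 0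
  obtain ⟨x, hx⟩ := hex.choice
  exact (h.tendsto_borderline k hθ' hk hκ hx).2 s hs

/-- In the limit (p, q) → (1, 0) the conservation law at s = 0 reads w² = 1 − cos θ = 2 sin²(θ/2).
-/
theorem sq_of_tendsto_curv [F.NeBot] (h : LayerFamily F T p q ϑ κ θ) {w : ℝ}
    (hw : Tendsto (fun i => κ i 0) F (𝓝 w)) :
    w = -(√2 * Real.sin (θ / 2)) ∨ w = √2 * Real.sin (θ / 2) := by
  have h1 : Tendsto (fun i => κ i 0 ^ 2) F (𝓝 (w ^ 2)) := hw.pow 2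
  have hcos := (Real.continuous_cos.tendsto _).comp h.angle_lim
  have hsin := (Real.continuous_sin.tendsto _).comp h.angle_lim
  have h2 := (((h.fst_lim.mul hcos).const_sub 1).sub (h.snd_lim.mul hsin))
  have h3 : (fun i => κ i 0 ^ 2) =ᶠ[F]
      fun i => 1 - p i * Real.cos (ϑ i 0) - q i * Real.sin (ϑ i 0) := by
    filter_upwards [h.profile] with i hi
    exact hi.sq 0 ⟨le_rfl, hi.pos.le⟩
  have h4 := tendsto_nhds_unique (h1.congr' h3) h2
  have h5 : (w + √2 * Real.sin (θ / 2)) * (w - √2 * Real.sin (θ / 2)) = 0 := by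
    linear_combination h4 - two_mul_sin_half_sq θ - Real.sin (θ / 2) ^ 2 * sqrt_two_sq
  rcases mul_eq_zero.1 h5 with h6 | h6
  · left; linarith
  · right; linarith

theorem exists_flat (h : LayerFamily F T p q ϑ κ θ) {η : ℝ} (hη : 0 < η) :
    ∀ᶠ i in F, ∃ b ∈ Icc (T i / 2) (T i), 1 - η ≤ |Real.cos (ϑ i b / 2)| := by
  have h2 : (0 : ℝ) < √2 := by positivity
  filter_upwards [h.profile, h.excess_le 1 one_pos,
    h.length_lim.eventually_gt_atTop ((8 * √2 + 1) / η)] with i hi he hT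
  refine hi.exists_flat ?_
  rw [div_lt_iff₀ hη] at hT
  have := abs_nonneg (Real.cos (ϑ i 0 / 2))
  have := abs_nonneg (Real.cos (ϑ i (T i) / 2))
  nlinarith

theorem cos_half_add (y : ℝ) (k : ℤ) :
    |Real.cos ((y + k * (2 * Real.pi)) / 2)| = |Real.cos (y / 2)| := by
  rw [show (y + k * (2 * Real.pi)) / 2 = y / 2 + k * Real.pi by ring, abs_cos_add_int_mul_pi]

/-- The initial curvature has the sign turning the curve to the horizontal direction along the
shorter way. -/
theorem curv_lim_eq [F.NeBot] (h : LayerFamily F T p q ϑ κ θ) (hθ : |θ| < Real.pi) {w : ℝ}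
    (hw : Tendsto (fun i => κ i 0) F (𝓝 w)) : w = -(√2 * Real.sin (θ / 2)) := by
  have hpi := Real.pi_pos
  have h2 : (0 : ℝ) < √2 := by positivity
  have hθ' := abs_lt.1 hθ
  rcases h.sq_of_tendsto_curv hw with h1 | h1
  · exact h1
  rcases eq_or_ne θ 0 with h0 | h0
  · rw [h1, h0]; simp
  exfalso
  -- With k the sign of θ, the wrong curvature is that of the borderline elastica started at θ −
  -- 2πk, so the angle would converge to 2πk and cos(ϑ/2) to −1.
  obtain ⟨k, hk, hk2⟩ : ∃ k : ℤ, (k = 1 ∨ k = -1) ∧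
      θ - k * (2 * Real.pi) ∈ Ioo (-(2 * Real.pi)) (2 * Real.pi) := by
    rcases lt_or_gt_of_ne h0 with hn | hp
    · exact ⟨-1, .inr rfl, by push_cast; constructor <;> linarith [hθ'.1]⟩
    · exact ⟨1, .inl rfl, by push_cast; constructor <;> linarith [hθ'.2]⟩
  have hhalf : ∀ y : ℝ, Real.cos ((y + k * (2 * Real.pi)) / 2) = -Real.cos (y / 2) ∧
      Real.sin ((y - k * (2 * Real.pi)) / 2) = -Real.sin (y / 2) := by
    intro y
    rcases hk with rfl | rfl
    · constructor
      · rw [← Real.cos_add_pi]; congr 1; push_cast; ring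
      · rw [← Real.sin_sub_pi]; congr 1; push_cast; ring
    · constructor
      · rw [← Real.cos_sub_pi]; congr 1; push_cast; ring
      · rw [← Real.sin_add_pi]; congr 1; push_cast; ring
  set θ' := θ - k * (2 * Real.pi) with hθ'def
  have hκ : Tendsto (fun i => κ i 0) F (𝓝 (borderCurv θ' 0)) := by
    have : borderCurv θ' 0 = w := by
      rw [borderCurv, borderAngle_zero hk2, h1, (hhalf θ).2, mul_neg, neg_neg]
    rwa [this]
  set G := Real.cos (θ / 2) with hG
  have hGpos : 0 < G := Real.cos_pos_of_mem_Ioo ⟨by linarith [hθ'.1], by linarith [hθ'.2]⟩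
  have hblim : Tendsto (fun s => Real.cos (borderAngle θ' s / 2)) atTop (𝓝 1) := by
    have := (Real.continuous_cos.tendsto _).comp ((tendsto_borderAngle θ').div_const 2)
    rw [zero_div, Real.cos_zero] at this
    exact this
  obtain ⟨R, hR, hR0⟩ := ((hblim.eventually (lt_mem_nhds (by linarith : 1 - G / 4 < 1))).and
    (eventually_ge_atTop 0)).exists
  have hcR : Tendsto (fun i => Real.cos (ϑ i R / 2)) F (𝓝 (-Real.cos (borderAngle θ' R / 2))) := by
    rw [← (hhalf _).1]
    exact (Real.continuous_cos.tendsto _).comp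
      ((h.tendsto_angle k hk2 (by rw [hθ'def]; ring) hκ hR0).div_const 2)
  have hc0 : Tendsto (fun i => Real.cos (ϑ i 0 / 2)) F (𝓝 G) :=
    (Real.continuous_cos.tendsto _).comp (h.angle_lim.div_const 2)
  -- At time R the value of cos(ϑ/2) is below −(1 − G/4), and at `b` its modulus is at least 1 −
  -- G/4. Comparing the variation through R and `b` with the upper bound leaves 2 cos(ϑ(0)/2) ≤
  -- 3G/4, against cos(ϑ(0)/2) > 3G/4 > 0.
  obtain ⟨i, hi, he, hT, ⟨b, hb, hbG⟩, hiR, hi0⟩ := (h.profile.and ((h.excess_le (√2 * G)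
    (by positivity)).and ((h.length_lim.eventually_ge_atTop (2 * R)).and ((h.exists_flat
    (η := G / 4) (by positivity)).and ((hcR.eventually (gt_mem_nhds
    (by linarith : -Real.cos (borderAngle θ' R / 2) < -(1 - G / 4)))).and
    (hc0.eventually (lt_mem_nhds (by linarith : 3 * G / 4 < G)))))))).exists
  have hv := hi.variation_le_three (a := R) (b := R) (c := b) hR0 le_rfl (by linarith [hb.1]) hb.2
  have e1 := neg_abs_le (Real.cos (ϑ i R / 2) - Real.cos (ϑ i 0 / 2))
  have e2 := abs_nonneg (Real.cos (ϑ i R / 2) - Real.cos (ϑ i R / 2))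
  have e3 := abs_nonneg (Real.cos (ϑ i b / 2) - Real.cos (ϑ i R / 2))
  have e4 := abs_sub_abs_le_abs_sub (Real.cos (ϑ i b / 2)) (Real.cos (ϑ i (T i) / 2))
  rw [abs_sub_comm (Real.cos (ϑ i b / 2))] at e4
  have e5 := le_abs_self (Real.cos (ϑ i 0 / 2))
  nlinarith

/-- Along ultrafilters the initial curvature converges to that of a borderline elastica. -/
theorem exists_curv_lim {U : Ultrafilter ι} (h : LayerFamily (U : Filter ι) T p q ϑ κ θ)
    (hθ : θ ∈ Icc (-Real.pi) Real.pi) : ∃ w, Tendsto (fun i => κ i 0) U (𝓝 w) ∧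
      (w = -(√2 * Real.sin (θ / 2)) ∨ |θ| = Real.pi ∧ w = √2 * Real.sin (θ / 2)) := by
  have hb : ∀ᶠ i in (U : Filter ι), κ i 0 ∈ Icc (-2 : ℝ) 2 := by
    filter_upwards [h.profile, h.curv_bound] with i hi hbi
    exact abs_le.1 (hbi.2.2 0 ⟨le_rfl, hi.pos.le⟩)
  obtain ⟨w, -, hw⟩ := (isCompact_Icc (a := (-2 : ℝ)) (b := 2)).ultrafilter_le_nhds
    (U.map fun i => κ i 0) (le_principal_iff.2 hb)
  refine ⟨w, hw, ?_⟩
  rcases (abs_le.2 hθ).lt_or_eq with h1 | h1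
  · exact .inl (h.curv_lim_eq h1 hw)
  · exact (h.sq_of_tendsto_curv hw).imp id fun h2 => ⟨h1, h2⟩

/-- Boundedness gives a limit along every finer ultrafilter, and the energy argument shows that all
these limits agree. -/
theorem tendsto_curv (h : LayerFamily F T p q ϑ κ θ) (hθ : |θ| < Real.pi) :
    Tendsto (fun i => κ i 0) F (𝓝 (-(√2 * Real.sin (θ / 2)))) := by
  rw [tendsto_iff_ultrafilter]
  intro U hU
  obtain ⟨w, hw, -⟩ := (h.mono hU).exists_curv_lim (abs_le.1 hθ.le)
  rwa [← (h.mono hU).curv_lim_eq hθ hw]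

theorem borderCurv_eq {θ' : ℝ} (hθ' : θ' ∈ Icc (-Real.pi) Real.pi) :
    borderCurv θ' 0 = -(√2 * Real.sin (θ' / 2)) := by
  have hpi := Real.pi_pos
  rw [borderCurv, borderAngle_zero ⟨by linarith [hθ'.1], by linarith [hθ'.2]⟩]

/-- Two ways of turning at angle `±π`: replace the angle by its opposite. -/
theorem exists_shift (hθ : |θ| = Real.pi) {w : ℝ}
    (hw : w = -(√2 * Real.sin (θ / 2)) ∨ w = √2 * Real.sin (θ / 2)) :
    ∃ (θ' : ℝ) (k : ℤ), (θ' = Real.pi ∨ θ' = -Real.pi) ∧ θ = θ' + k * (2 * Real.pi) ∧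
      w = borderCurv θ' 0 := by
  have hpi := Real.pi_pos
  have hmem : θ ∈ Icc (-Real.pi) Real.pi := abs_le.1 hθ.le
  have hcase : θ = Real.pi ∨ θ = -Real.pi := eq_or_eq_neg_of_abs_eq hθ
  rcases hw with h1 | h1
  · exact ⟨θ, 0, hcase, by simp, by rw [borderCurv_eq hmem, h1]⟩
  · refine ⟨-θ, if θ = Real.pi then 1 else -1, ?_, ?_, ?_⟩
    · rcases hcase with h2 | h2
      · right; rw [h2]
      · left; rw [h2, neg_neg]
    · rcases hcase with h2 | h2
      · rw [if_pos h2, h2]; push_cast; ring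
      · rw [if_neg (by linarith), h2]; push_cast; ring
    · rw [borderCurv_eq ⟨by linarith [hmem.2], by linarith [hmem.1]⟩, h1, neg_div, Real.sin_neg]
      ring

/-- Working along ultrafilters makes the initial curvature converge even at |θ| = π, where the
family itself may oscillate between two limits; both satisfy the same bound. -/
theorem eventually_sin_half_le (h : LayerFamily F T p q ϑ κ θ) (hθ : θ ∈ Icc (-Real.pi) Real.pi)
    {c δ : ℝ} (hc : 0 ≤ c) (hδ : 0 < δ) :
    ∀ᶠ i in F, |Real.sin (ϑ i c / 2)| < 2 * decay c + δ := by
  have hpi := Real.pi_pos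
  refine mem_iff_ultrafilter.2 fun U hU => ?_
  have hU' := h.mono hU
  obtain ⟨w, hw, hw'⟩ := hU'.exists_curv_lim hθ
  obtain ⟨θ', k, hθ', hk, hwk⟩ : ∃ (θ' : ℝ) (k : ℤ), θ' ∈ Icc (-Real.pi) Real.pi ∧
      θ = θ' + k * (2 * Real.pi) ∧ w = borderCurv θ' 0 := by
    rcases hw' with h1 | ⟨h1, h2⟩
    · exact ⟨θ, 0, hθ, by simp, by rw [borderCurv_eq hθ, h1]⟩
    · obtain ⟨θ', k, h3, h4, h5⟩ := exists_shift h1 (.inr h2)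
      refine ⟨θ', k, ?_, h4, h5⟩
      rcases h3 with rfl | rfl
      · exact ⟨by linarith, le_rfl⟩
      · exact ⟨le_rfl, by linarith⟩
  rw [hwk] at hw
  have hlim := hU'.tendsto_angle k ⟨by linarith [hθ'.1], by linarith [hθ'.2]⟩ hk hw hc
  have hs := ((Real.continuous_sin.tendsto _).comp (hlim.div_const 2)).abs
  refine hs.eventually (gt_mem_nhds ?_)
  rw [show (borderAngle θ' c + k * (2 * Real.pi)) / 2 = borderAngle θ' c / 2 + k * Real.pi by ring,
    abs_sin_add_int_mul_pi]
  linarith [abs_sin_half_borderAngle_le hθ' c]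

/-- Uniform estimate for the tangential angle in the first half. -/
theorem eventually_sin_half_le_of_mem (h : LayerFamily F T p q ϑ κ θ)
    (hθ : θ ∈ Icc (-Real.pi) Real.pi) {c δ : ℝ} (hc : 0 ≤ c) (hδ : 0 < δ) :
    ∀ᶠ i in F, ∀ s ∈ Icc c (T i / 2), |Real.sin (ϑ i s / 2)| ≤ 2 * decay c + δ := by
  have h2 : (1 : ℝ) ≤ √2 := Real.one_le_sqrt.2 (by norm_num)
  -- Chosen so that a loss of 4η = δ²/4 in sin² still fits: (2d + δ/2)² + δ²/4 ≤ (2d + δ)² for d ≥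
  -- 0.
  set η := δ ^ 2 / 16 with hη
  have hηpos : 0 < η := by positivity
  filter_upwards [h.profile, h.excess_le (4 * η) (by positivity), h.exists_flat hηpos,
    h.eventually_sin_half_le hθ hc (δ := δ / 2) (by positivity)] with i hi he hflat hsc s hs
  obtain ⟨b, hb, hbG⟩ := hflat
  -- A dip of |cos(ϑ/2)| at `s` between the values at `c` and `b` would be paid for on the way down
  -- and up again; the energy leaves only O(η) for it.
  have hv := hi.variation_le_three (a := c) (b := s) (c := b) hc hs.1 (hs.2.trans hb.1) hb.2
  set g0 := Real.cos (ϑ i 0 / 2)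
  set gc := Real.cos (ϑ i c / 2)
  set gs := Real.cos (ϑ i s / 2)
  set gb := Real.cos (ϑ i b / 2)
  set gT := Real.cos (ϑ i (T i) / 2)
  have e1 := abs_sub_abs_le_abs_sub gc g0
  have e2 := abs_sub_abs_le_abs_sub gc gs
  have e3 := abs_sub_abs_le_abs_sub gb gs
  have e4 := abs_sub_abs_le_abs_sub gb gT
  rw [abs_sub_comm gc gs] at e2
  rw [abs_sub_comm gb gT] at e4
  have e5 : |gc - g0| + |gs - gc| + |gb - gs| + |gT - gb| ≤ 2 - |g0| - |gT| + η := by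
    have : 4 * √2 * (|gc - g0| + |gs - gc| + |gb - gs| + |gT - gb|) ≤
        4 * √2 * (2 - |g0| - |gT| + η) := by nlinarith
    exact le_of_mul_le_mul_left this (by positivity)
  have e6 : |gc| - 2 * η ≤ |gs| := by linarith
  have hgc : gc ^ 2 = 1 - Real.sin (ϑ i c / 2) ^ 2 := Real.cos_sq' _
  have hgs : gs ^ 2 = 1 - Real.sin (ϑ i s / 2) ^ 2 := Real.cos_sq' _
  have e7 : gc ^ 2 - 4 * η ≤ gs ^ 2 := by
    have h3 := Real.abs_cos_le_one (ϑ i c / 2)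
    rw [← sq_abs gc, ← sq_abs gs]
    have h4 := abs_nonneg gs
    rcases le_total (|gc|) (2 * η) with h5 | h5
    · nlinarith [abs_nonneg gc, sq_nonneg |gs|]
    · nlinarith
  have hd := decay_pos c
  have e8 : Real.sin (ϑ i c / 2) ^ 2 ≤ (2 * decay c + δ / 2) ^ 2 := by
    rw [← sq_abs]
    exact pow_le_pow_left₀ (abs_nonneg _) hsc.le 2
  refine abs_le_of_sq_le_sq' ?_ (by positivity) |> abs_le.2
  nlinarith

/-- Turns the terminal layer into an initial one. The terminal angle is known only modulo 2π, hence
the shift by 2πk; the absolute values in `excess_le` make that condition insensitive to it. -/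
theorem reverse (h : LayerFamily F T p q ϑ κ θ) {k : ι → ℤ} {θ₁ : ℝ}
    (hk : Tendsto (fun i => ϑ i (T i) - k i * (2 * Real.pi)) F (𝓝 θ₁)) :
    LayerFamily F T p q (fun i s => ϑ i (T i - s) - k i * (2 * Real.pi)) (fun i s => -κ i (T i - s))
      θ₁ := by
  refine ⟨h.profile.mono fun i hi => hi.reverse (k i), h.length_lim, h.fst_lim, h.snd_lim, ?_,
    fun δ hδ => (h.excess_le δ hδ).mono fun i hi => ?_⟩
  · simpa using hk
  · rw [excess_reverse]
    have hh : ∀ y : ℝ, |Real.cos ((y - k i * (2 * Real.pi)) / 2)| = |Real.cos (y / 2)| := fun y => by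
      have := cos_half_add y (-k i)
      push_cast at this
      rwa [neg_mul, ← sub_eq_add_neg] at this
    simp only [sub_zero, sub_self, hh]
    linarith

end LayerFamily

/-! ### From minimizers to families of profiles. -/

theorem exists_int_of_dir_eq {a b : ℝ} (h : dir a = dir b) : ∃ k : ℤ, a - k * (2 * Real.pi) = b := by
  have h0 : Real.cos a = Real.cos b := by simpa using congrArg (fun v : Plane => v 0) h
  have h1 : Real.sin a = Real.sin b := by simpa using congrArg (fun v : Plane => v 1) h
  obtain ⟨k, hk⟩ := Real.Angle.angle_eq_iff_two_pi_dvd_sub.1 (Real.Angle.cos_sin_inj h0 h1)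
  exact ⟨k, by linarith⟩

theorem norm_dir_sub (a : ℝ) : ‖dir a - !₂[1, 0]‖ = 2 * |Real.sin (a / 2)| := by
  have h : ‖dir a - !₂[1, 0]‖ ^ 2 = (2 * |Real.sin (a / 2)|) ^ 2 := by
    have h1 := two_mul_sin_half_sq a
    have h2 := Real.sin_sq_add_cos_sq a
    rw [plane_norm_sq, mul_pow, sq_abs]
    simp only [PiLp.sub_apply, dir_zero, dir_one, Matrix.cons_val_zero,
      Matrix.cons_val_one]
    linarith
  exact (sq_eq_sq₀ (norm_nonneg _) (by positivity)).1 h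

/-- A curve of unit speed is at least as long as the distance of its endpoints. -/
theorem le_of_unit_speed {T X : ℝ} {x : ℝ → Plane} {ϑ : ℝ → ℝ} (hT : 0 ≤ T)
    (hx : ∀ s ∈ Icc 0 T, HasDerivWithinAt x (dir (ϑ s)) (Icc 0 T) s) (h0 : x 0 = 0)
    (hX : x T = !₂[X, 0]) : X ≤ T := by
  have h1 := (convex_Icc 0 T).norm_image_sub_le_of_norm_hasDerivWithin_le (C := 1) hx
    (fun t _ => by rw [norm_dir]) (left_mem_Icc.2 hT) (right_mem_Icc.2 hT)
  rw [h0, sub_zero, sub_zero, Real.norm_of_nonneg hT, one_mul, hX] at h1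
  have h2 := PiLp.norm_apply_le (!₂[X, 0] : Plane) 0
  simp only [Matrix.cons_val_zero, Real.norm_eq_abs] at h2
  exact (le_abs_self X).trans (h2.trans h1)

/-- The rescaled minimizers form a family of elastica profiles with boundary layers. -/
theorem exists_layerFamily {P : Set ℝ} (hP : P ⊆ Ioi 0) {l θ₀ θ₁ : ℝ → ℝ} {l' θ₀' θ₁' : ℝ}
    (hθ₀ : ∀ ε ∈ P, θ₀ ε ∈ Icc (-Real.pi) Real.pi) (hθ₁ : ∀ ε ∈ P, θ₁ ε ∈ Icc (-Real.pi) Real.pi)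
    (hl' : 0 < l') (hl_lim : Tendsto l (𝓝[P] 0) (𝓝 l')) (hθ₀_lim : Tendsto θ₀ (𝓝[P] 0) (𝓝 θ₀'))
    (hθ₁_lim : Tendsto θ₁ (𝓝[P] 0) (𝓝 θ₁')) {γ : ℝ → ℝ → Plane}
    (hγ : ∀ ε ∈ P, IsMinimizer ε (θ₀ ε) (θ₁ ε) (l ε) (γ ε)) :
    ∃ (p q : ℝ → ℝ) (ϑ κ : ℝ → ℝ → ℝ) (k : ℝ → ℤ),
      LayerFamily (𝓝[P] 0) (fun ε => length (γ ε) / ε) p q ϑ κ θ₀' ∧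
      Tendsto (fun ε => ϑ ε (length (γ ε) / ε) - k ε * (2 * Real.pi)) (𝓝[P] 0) (𝓝 θ₁') ∧
      ∀ ε ∈ P, rescaled ε (γ ε) 0 = 0 ∧
        (∀ s ∈ Icc 0 (length (γ ε) / ε),
          HasDerivWithinAt (rescaled ε (γ ε)) (dir (ϑ ε s)) (Icc 0 (length (γ ε) / ε)) s) ∧
        ∀ s ∈ Icc 0 (length (γ ε)),
          derivWithin (arcLengthParam (γ ε)) (Icc 0 (length (γ ε))) s = dir (ϑ ε (s / ε)) := by
  have hex : ∀ ε, ∃ (p q : ℝ) (ϑ κ : ℝ → ℝ) (k : ℤ), ε ∈ P →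
      Profile (length (γ ε) / ε) p q ϑ κ ∧ ϑ 0 = θ₀ ε ∧
      ϑ (length (γ ε) / ε) - k * (2 * Real.pi) = θ₁ ε ∧
      (∀ s ∈ Icc 0 (length (γ ε) / ε),
        HasDerivWithinAt (rescaled ε (γ ε)) (dir (ϑ s)) (Icc 0 (length (γ ε) / ε)) s) ∧
      rescaled ε (γ ε) 0 = 0 ∧ rescaled ε (γ ε) (length (γ ε) / ε) = !₂[l ε / ε, 0] ∧
      energy ε (γ ε) = l ε + ε * excess (length (γ ε) / ε) ϑ κ ∧
      ∀ s ∈ Icc 0 (length (γ ε)),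
        derivWithin (arcLengthParam (γ ε)) (Icc 0 (length (γ ε))) s = dir (ϑ (s / ε)) := by
    intro ε
    by_cases hε : ε ∈ P
    · obtain ⟨p, q, ϑ, κ, h1, h2, h3, h4⟩ := (hγ ε hε).exists_profile (hP hε)
      obtain ⟨k, hk⟩ := exists_int_of_dir_eq h3
      exact ⟨p, q, ϑ, κ, k, fun _ => ⟨h1, h2, hk, h4⟩⟩
    -- Off P the values are arbitrary; the filter `𝓝[P] 0` does not see them.
    · exact ⟨0, 0, 0, 0, 0, fun h => absurd h hε⟩
  choose p q ϑ κ k h using hex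
  have hmem : ∀ᶠ ε in 𝓝[P] (0 : ℝ), ε ∈ P := self_mem_nhdsWithin
  have hinv : Tendsto (fun ε : ℝ => ε⁻¹) (𝓝[P] 0) atTop :=
    tendsto_inv_nhdsGT_zero.mono_left (nhdsWithin_mono 0 hP)
  have hX : Tendsto (fun ε => l ε / ε) (𝓝[P] 0) atTop := by
    simpa only [div_eq_mul_inv] using hl_lim.pos_mul_atTop hl' hinv
  have hT : Tendsto (fun ε => length (γ ε) / ε) (𝓝[P] 0) atTop := by
    refine tendsto_atTop_mono' _ ?_ hX
    filter_upwards [hmem] with ε hε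
    obtain ⟨h1, -, -, h4, h5, h6, -⟩ := h ε hε
    exact le_of_unit_speed h1.pos.le h4 h5 h6
  have hcos : ∀ {y : ℝ}, y ∈ Icc (-Real.pi) Real.pi → |Real.cos (y / 2)| = Real.cos (y / 2) :=
    fun hy => abs_of_nonneg (Real.cos_nonneg_of_mem_Icc ⟨by linarith [hy.1], by linarith [hy.2]⟩)
  have hexc : ∀ δ > 0, ∀ᶠ ε in 𝓝[P] 0, excess (length (γ ε) / ε) (ϑ ε) (κ ε) ≤
      4 * √2 * (2 - |Real.cos (ϑ ε 0 / 2)| - |Real.cos (ϑ ε (length (γ ε) / ε) / 2)|) + δ := by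
    intro δ hδ
    obtain ⟨R, hR⟩ := exists_energy_bound hδ
    filter_upwards [hmem, hX.eventually_ge_atTop R] with ε hε hRε
    obtain ⟨-, h2, h3, -, -, -, h7, -⟩ := h ε hε
    have h8 := hR (hP hε) (hθ₀ ε hε) (hθ₁ ε hε) (hγ ε hε) hRε
    rw [h7] at h8
    have h9 := le_of_mul_le_mul_left (le_of_add_le_add_left h8) (hP hε)
    have h10 := LayerFamily.cos_half_add (θ₁ ε) (k ε)
    rw [← h3, sub_add_cancel, h3] at h10
    rwa [h2, h10, hcos (hθ₀ ε hε), hcos (hθ₁ ε hε)]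
  -- The excess is eventually at most 8√2 + 1, so the multiplier differs from (1, 0) by O(1/T).
  have hmul : ∀ᶠ ε in 𝓝[P] 0, |p ε - 1| + |q ε| ≤
      (7 * (8 * √2 + 1) + 16) / (length (γ ε) / ε - 8) := by
    filter_upwards [hmem, hexc 1 one_pos, hT.eventually_gt_atTop 8] with ε hε he h8
    obtain ⟨h1, -, -, h4, h5, h6, -⟩ := h ε hε
    rw [le_div_iff₀ (by linarith)]
    refine (h1.multiplier_le h4 h5 h6).trans ?_
    have h2 : (0 : ℝ) < √2 := by positivity
    have := abs_nonneg (Real.cos (ϑ ε 0 / 2))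
    have := abs_nonneg (Real.cos (ϑ ε (length (γ ε) / ε) / 2))
    nlinarith
  have hzero : Tendsto (fun ε => (7 * (8 * √2 + 1) + 16) / (length (γ ε) / ε - 8)) (𝓝[P] 0)
      (𝓝 0) := (tendsto_atTop_add_const_right _ (-8) hT).const_div_atTop _
  refine ⟨p, q, ϑ, κ, k, ⟨hmem.mono fun ε hε => (h ε hε).1, hT, ?_, ?_, ?_, hexc⟩, ?_,
    fun ε hε => ?_⟩
  · rw [tendsto_iff_norm_sub_tendsto_zero]
    exact squeeze_zero' (.of_forall fun _ => norm_nonneg _)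
      (hmul.mono fun ε hε => (le_add_of_nonneg_right (abs_nonneg _)).trans hε) hzero
  · rw [tendsto_zero_iff_norm_tendsto_zero]
    exact squeeze_zero' (.of_forall fun _ => norm_nonneg _)
      (hmul.mono fun ε hε => (le_add_of_nonneg_left (abs_nonneg _)).trans hε) hzero
  · exact hθ₀_lim.congr' (hmem.mono fun ε hε => (h ε hε).2.1.symm)
  · exact hθ₁_lim.congr' (hmem.mono fun ε hε => (h ε hε).2.2.1.symm)
  · obtain ⟨-, -, -, h4, h5, -, -, h8⟩ := h ε hε
    exact ⟨h5, h4, h8⟩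

/-- A subsequence is treated as the image filter, which is finer than `𝓝[P] 0`, so results on layer
families apply to it through `LayerFamily.mono`. -/
theorem TendstoSmoothLoc.of_map {α β : Type*} {f : α → ℝ → Plane} {T : α → ℝ} {F : Filter β}
    {v : β → α} {g : ℝ → Plane} (h : TendstoSmoothLoc f T (F.map v) g) :
    TendstoSmoothLoc (fun b => f (v b)) (fun b => T (v b)) F g := fun c hc =>
  ⟨eventually_map.1 (h c hc).1, (h c hc).2.1, fun k u hu => eventually_map.1 ((h c hc).2.2 k u hu)⟩

/-- Uniform estimate for the tangential angle away from the endpoints. -/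
theorem LayerFamily.eventually_sin_half_le_inner {ι : Type*} {F : Filter ι} {T p q : ι → ℝ}
    {ϑ κ : ι → ℝ → ℝ} {θ θ' : ℝ} (h : LayerFamily F T p q ϑ κ θ) {k : ι → ℤ}
    (hk : Tendsto (fun i => ϑ i (T i) - k i * (2 * Real.pi)) F (𝓝 θ'))
    (hθ : θ ∈ Icc (-Real.pi) Real.pi) (hθ' : θ' ∈ Icc (-Real.pi) Real.pi) {c δ : ℝ} (hc : 0 ≤ c)
    (hδ : 0 < δ) :
    ∀ᶠ i in F, ∀ s ∈ Icc c (T i - c), |Real.sin (ϑ i s / 2)| ≤ 2 * decay c + δ := by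
  filter_upwards [h.eventually_sin_half_le_of_mem hθ hc hδ,
    (h.reverse hk).eventually_sin_half_le_of_mem hθ' hc hδ] with i h1 h2 s hs
  rcases le_total s (T i / 2) with h3 | h3
  · exact h1 s ⟨hs.1, h3⟩
  · have h4 := h2 (T i - s) ⟨by linarith [hs.2], by linarith⟩
    rw [sub_sub_cancel] at h4
    have h5 := abs_sin_add_int_mul_pi (ϑ i s / 2) (-k i)
    rwa [← h5, show ϑ i s / 2 + ((-k i : ℤ) : ℝ) * Real.pi = (ϑ i s - k i * (2 * Real.pi)) / 2 by
      push_cast; ring]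

end ClampedElastica

/-! ### The main theorem. -/

theorem theorem2p2
    (P : Set ℝ) (hP : P ⊆ Ioi 0) (hP0 : (0 : ℝ) ∈ closure P)
    (l θ₀ θ₁ : ℝ → ℝ) (l' θ₀' θ₁' : ℝ)
    (hl : ∀ ε ∈ P, 0 < l ε)
    (hθ₀ : ∀ ε ∈ P, θ₀ ε ∈ Icc (-Real.pi) Real.pi)
    (hθ₁ : ∀ ε ∈ P, θ₁ ε ∈ Icc (-Real.pi) Real.pi)
    (hl' : 0 < l')
    (hθ₀' : θ₀' ∈ Icc (-Real.pi) Real.pi)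
    (hθ₁' : θ₁' ∈ Icc (-Real.pi) Real.pi)
    (hl_lim : Tendsto l (𝓝[P] 0) (𝓝 l'))
    (hθ₀_lim : Tendsto θ₀ (𝓝[P] 0) (𝓝 θ₀'))
    (hθ₁_lim : Tendsto θ₁ (𝓝[P] 0) (𝓝 θ₁'))
    (γ : ℝ → ℝ → Plane)
    (hγ : ∀ ε ∈ P, IsMinimizer ε (θ₀ ε) (θ₁ ε) (l ε) (γ ε)) :
    (∀ θ ∈ Icc (-Real.pi) Real.pi, ∃ γB, IsBorderlineElastica θ γB ∧
      ∀ η, IsBorderlineElastica θ η → EqOn η γB (Ici 0)) ∧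
    (|θ₀'| < Real.pi →
      ∃ γB, IsBorderlineElastica θ₀' γB ∧
        TendstoSmoothLoc (fun ε => rescaled ε (γ ε)) (fun ε => length (γ ε) / ε) (𝓝[P] 0) γB) ∧
    (|θ₀'| = Real.pi →
      ∀ u : ℕ → ℝ, (∀ n, u n ∈ P) → Tendsto u atTop (𝓝 0) →
        ∃ φ : ℕ → ℕ, StrictMono φ ∧
          ∃ γB, (IsBorderlineElastica Real.pi γB ∨ IsBorderlineElastica (-Real.pi) γB) ∧
            TendstoSmoothLoc (fun n => rescaled (u (φ n)) (γ (u (φ n))))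
              (fun n => length (γ (u (φ n))) / u (φ n)) atTop γB) ∧
    (∀ c : ℝ, 0 < c →
      (∀ᶠ ε in 𝓝[P] 0, (Icc (c * ε) (length (γ ε) - c * ε)).Nonempty) ∧
      limsup (fun ε => ⨆ s ∈ Icc (c * ε) (length (γ ε) - c * ε),
          ‖derivWithin (arcLengthParam (γ ε)) (Icc 0 (length (γ ε))) s - !₂[1, 0]‖ₑ) (𝓝[P] 0)
        ≤ ENNReal.ofReal (4 * Real.exp (-(c / Real.sqrt 2)))) := by
  have hpi := Real.pi_pos
  obtain ⟨p, q, ϑ, κ, k, hF, hk, hcurve⟩ :=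
    exists_layerFamily hP hθ₀ hθ₁ hl' hl_lim hθ₀_lim hθ₁_lim hγ
  have hmem : ∀ᶠ ε in 𝓝[P] (0 : ℝ), ε ∈ P := self_mem_nhdsWithin
  have hbot : (𝓝[P] (0 : ℝ)).NeBot := mem_closure_iff_nhdsWithin_neBot.1 hP0
  have hx : ∀ᶠ ε in 𝓝[P] (0 : ℝ), rescaled ε (γ ε) 0 = 0 ∧ ∀ s ∈ Icc 0 (length (γ ε) / ε),
      HasDerivWithinAt (rescaled ε (γ ε)) (dir (ϑ ε s)) (Icc 0 (length (γ ε) / ε)) s :=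
    hmem.mono fun ε hε => ⟨(hcurve ε hε).1, (hcurve ε hε).2.1⟩
  refine ⟨fun θ hθ => ⟨borderCurve θ, isBorderlineElastica_borderCurve hθ,
    fun η hη => hη.eqOn_borderCurve hθ⟩, fun hlt => ⟨borderCurve θ₀',
    isBorderlineElastica_borderCurve hθ₀', ?_⟩, fun heq u hu hu0 => ?_, fun c hc => ⟨?_, ?_⟩⟩
  · refine (hF.tendsto_borderline (θ' := θ₀') 0 ⟨by linarith [hθ₀'.1], by linarith [hθ₀'.2]⟩
      (by simp) ?_ hx).1
    rw [LayerFamily.borderCurv_eq hθ₀']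
    exact hF.tendsto_curv hlt
  · have hu' : Tendsto u atTop (𝓝[P] 0) := tendsto_nhdsWithin_iff.2 ⟨hu0, .of_forall hu⟩
    have hb : ∀ᶠ n in atTop, κ (u n) 0 ∈ Icc (-2 : ℝ) 2 := by
      filter_upwards [hu'.eventually hF.profile, hu'.eventually hF.curv_bound] with n hn hbn
      exact abs_le.1 (hbn.2.2 0 ⟨le_rfl, hn.pos.le⟩)
    -- At |θ₀'| = π the only undetermined datum is the sign of the initial curvature;
    -- Bolzano-Weierstrass fixes it along a subsequence.
    obtain ⟨w, -, φ, hφ, hw⟩ :=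
      (isCompact_Icc (a := (-2 : ℝ)) (b := 2)).tendsto_subseq' hb.frequently
    have hle : Tendsto (u ∘ φ) atTop (𝓝[P] 0) := hu'.comp hφ.tendsto_atTop
    have hF' := hF.mono hle
    have hw' : Tendsto (fun ε => κ ε 0) (map (u ∘ φ) atTop) (𝓝 w) := tendsto_map'_iff.2 hw
    obtain ⟨θ', j, hθ', hj, hwj⟩ := LayerFamily.exists_shift heq (hF'.sq_of_tendsto_curv hw')
    have hIcc : θ' ∈ Icc (-Real.pi) Real.pi := by
      rcases hθ' with rfl | rfl <;> constructor <;> linarith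
    have hconv := (hF'.tendsto_borderline (θ' := θ') j
      ⟨by linarith [hIcc.1], by linarith [hIcc.2]⟩ hj (hwj ▸ hw') (hx.filter_mono hle)).1
    refine ⟨φ, hφ, borderCurve θ', ?_, hconv.of_map⟩
    rcases hθ' with rfl | rfl
    · exact .inl (isBorderlineElastica_borderCurve hIcc)
    · exact .inr (isBorderlineElastica_borderCurve hIcc)
  · filter_upwards [hmem, hF.length_lim.eventually_ge_atTop (2 * c)] with ε hε hT
    have := (le_div_iff₀ (hP hε)).1 hT
    exact nonempty_Icc.2 (by linarith)
  · refine ENNReal.le_of_forall_pos_le_add fun δ hδ _ => ?_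
    have hδ' : (0 : ℝ) < δ := hδ
    refine limsup_le_of_le (h := ?_)
    -- The tolerance is halved because the distance to (1, 0) is twice |sin(ϑ/2)|.
    filter_upwards [hmem, hF.eventually_sin_half_le_inner hk hθ₀' hθ₁' hc.le
      (half_pos hδ')] with ε hε hs
    have hε0 : 0 < ε := hP hε
    refine iSup₂_le fun s hsm => ?_
    have hcε : 0 < c * ε := mul_pos hc hε0
    rw [(hcurve ε hε).2.2 s ⟨by linarith [hsm.1], by linarith [hsm.2]⟩, ← ofReal_norm,
      norm_dir_sub, ← ENNReal.ofReal_coe_nnreal, ← ENNReal.ofReal_add (by positivity) hδ'.le]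
    refine ENNReal.ofReal_le_ofReal ?_
    have h1 := hs (s / ε) ⟨(le_div_iff₀ hε0).2 hsm.1, by
      rw [div_le_iff₀ hε0, sub_mul, div_mul_cancel₀ _ hε0.ne']; exact hsm.2⟩
    rw [decay] at h1
    linarith
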